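/- Let $u\colon R\to U$ be a homological epimorphism of associative (unital) rings, that is, a ring homomorphism such that the multiplication map $U\otimes_R U\to U$ is an isomorphism and $\operatorname{Tor}_i^R(U,U)=0$ for all $i>0$. Assume that $U$ has flat dimension at most $1$ as a right $R$-module and projective dimension at most $1$ as a left $R$-module. Let $K^\bullet$ denote the two-term complex of $R$-$R$-bimodules $R\xrightarrow{u}U$ with $R$ in cohomological degree $-1$ and $U$ in degree $0$. A left $R$-module $M$ is called a $u$-comodule if $U\otimes_RM=0=\operatorname{Tor}_1^R(U,M)$, and a left $R$-module $C$ is called a $u$-contramodule if $\operatorname{Hom}_R(U,C)=0=\operatorname{Ext}^1_R(U,C)$. For a symbol $\star\in\{\mathsf b,+,-,\varnothing\}$ let $\mathsf D^\star(R\text{-}\mathsf{mod})$ be the bounded, bounded below, bounded above or unbounded derived category of left $R$-modules, viewed as the full subcategory of $\mathsf D(R\text{-}\mathsf{mod})$ cut out by the corresponding boundedness condition on cohomology (and similarly for $U$), and let $\mathsf D^\star_{u\text{-co}}(R\text{-}\mathsf{mod})$ and $\mathsf D^\star_{u\text{-ctra}}(R\text{-}\mathsf{mod})$ be the full subcategories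 of $\mathsf D^\star(R\text{-}\mathsf{mod})$ consisting of the complexes all of whose cohomology modules are $u$-comodules, respectively $u$-contramodules. Then the left derived functors $\mathbb L u^*$ of $u^*=U\otimes_R-$ and $K^\bullet[-1]\otimes_R^{\mathbb L}-$ and the right derived functors $\mathbb R u^!$ of $u^!=\operatorname{Hom}_R(U,-)$ and $\mathbb R\mathrm{Hom}_R(K^\bullet[-1],-)$ exist on $\mathsf D(R\text{-}\mathsf{mod})$ and are triangulated functors (with values in $\mathsf D(U\text{-}\mathsf{mod})$ for $\mathbb L u^*$ and $\mathbb R u^!$, and in $\mathsf D(R\text{-}\mathsf{mod})$ for the other two), and for every $\star\in\{\mathsf b,+,-,\varnothing\}$ the following holds. (1) $\mathsf D^\star_{u\text{-co}}(R\text{-}\mathsf{mod})$ and $\mathsf D^\star_{u\text{-ctra}}(R\text{-}\mathsf{mod})$ are triangulated subcategories. The functor $\mathbb R\mathrm{Hom}_R(K^\bullet[-1],-)$ takes $\mathsf D^\star(R\text{-}\mathsf{mod})$ into $\mathsf D^\star_{u\text{-ctra}}(R\text{-}\mathsf{mod})$, the functor $K^\bullet[-1]\otimes_R^{\mathbb L}-$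 takes $\mathsf D^\star(R\text{-}\mathsf{mod})$ into $\mathsf D^\star_{u\text{-co}}(R\text{-}\mathsf{mod})$, and their restrictions $$\mathbb R\mathrm{Hom}_R(K^\bullet[-1],-)\colon \mathsf D^\star_{u\text{-co}}(R\text{-}\mathsf{mod})\to\mathsf D^\star_{u\text{-ctra}}(R\text{-}\mathsf{mod}),\qquad K^\bullet[-1]\otimes_R^{\mathbb L}-\colon \mathsf D^\star_{u\text{-ctra}}(R\text{-}\mathsf{mod})\to\mathsf D^\star_{u\text{-co}}(R\text{-}\mathsf{mod})$$ are mutually inverse triangulated equivalences. (2) There is a recollement of triangulated categories $$\mathsf D^\star(U\text{-}\mathsf{mod})\;\to\;\mathsf D^\star(R\text{-}\mathsf{mod})\;\to\;\mathsf D^\star_{u\text{-co}}(R\text{-}\mathsf{mod})\simeq\mathsf D^\star_{u\text{-ctra}}(R\text{-}\mathsf{mod}).$$ Explicitly, the restriction of scalars $u_*\colon\mathsf D^\star(U\text{-}\mathsf{mod})\to\mathsf D^\star(R\text{-}\mathsf{mod})$ is fully faithful with left adjoint $\mathbb L u^*$ and right adjoint $\mathbb R u^!$; the functor $K^\bullet[-1]\otimes_R^{\mathbb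 L}-\colon\mathsf D^\star(R\text{-}\mathsf{mod})\to\mathsf D^\star_{u\text{-co}}(R\text{-}\mathsf{mod})$ has as left adjoint the inclusion of $\mathsf D^\star_{u\text{-co}}(R\text{-}\mathsf{mod})$, and as right adjoint the fully faithful composition of the equivalence $\mathsf D^\star_{u\text{-co}}(R\text{-}\mathsf{mod})\simeq\mathsf D^\star_{u\text{-ctra}}(R\text{-}\mathsf{mod})$ of (1) with the inclusion of $\mathsf D^\star_{u\text{-ctra}}(R\text{-}\mathsf{mod})$. All six functors are triangulated. The functors $K^\bullet[-1]\otimes_R^{\mathbb L}-$, $\mathbb L u^*$ and $\mathbb R u^!$ on $\mathsf D^\star(R\text{-}\mathsf{mod})$ are Verdier quotient functors by their kernels, which are the essential image of $u_*$, the subcategory $\mathsf D^\star_{u\text{-co}}(R\text{-}\mathsf{mod})$ and the subcategory $\mathsf D^\star_{u\text{-ctra}}(R\text{-}\mathsf{mod})$, respectively. -/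

import Mathlib

open CategoryTheory CategoryTheory.Limits TensorProduct ZeroObject

universe w w' u

noncomputable section

namespace Matlis

/-! ### Bimodules, tensor product and Hom over a noncommutative ring -/

/-- The category of `S`-`R`-bimodules (left action of `S`, right action of `R`), as left modules
over the ring `S ⊗ Rᵐᵒᵖ`. -/
abbrev Bimod (S R : Type u) [Ring S] [Ring R] := ModuleCat.{u} (S ⊗[ℤ] Rᵐᵒᵖ)

section Tensor

variable {S R : Type u} [Ring S] [Ring R]

/-- The inclusion `S → S ⊗ Rᵐᵒᵖ`, which gives the left action on bimodules. -/
abbrev leftIncl (S R : Type u) [Ring S] [Ring R] : S →+* S ⊗[ℤ] Rᵐᵒᵖ :=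
  (Algebra.TensorProduct.includeLeft : S →ₐ[ℤ] S ⊗[ℤ] Rᵐᵒᵖ).toRingHom

/-- The underlying left module functor from `S`-`R`-bimodules to left `S`-modules. -/
abbrev leftPart (S R : Type u) [Ring S] [Ring R] : Bimod S R ⥤ ModuleCat.{u} S :=
  ModuleCat.restrictScalars (leftIncl S R)

/-- The right action `m ↦ m · r` on a bimodule, as an endomorphism of the underlying left module. -/
def rightAct (M : Bimod S R) (r : R) : (leftPart S R).obj M ⟶ (leftPart S R).obj M :=
  ModuleCat.ofHom (X := (leftPart S R).obj M) (Y := (leftPart S R).obj M)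
    { toFun := fun (m : M) => ((1 : S) ⊗ₜ[ℤ] MulOpposite.op r • m : M)
      map_add' := fun x y => smul_add _ (show M from x) (show M from y)
      map_smul' := fun s m => by
        change ((1 : S) ⊗ₜ[ℤ] MulOpposite.op r • (s ⊗ₜ[ℤ] (1 : Rᵐᵒᵖ) • (show M from m)) : M) =
          (s ⊗ₜ[ℤ] (1 : Rᵐᵒᵖ) • ((1 : S) ⊗ₜ[ℤ] MulOpposite.op r • (show M from m)) : M)
        rw [← mul_smul, ← mul_smul]
        simp }

lemma rightAct_apply (M : Bimod S R) (r : R) (m : M) :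
    (rightAct M r).hom m = ((1 : S) ⊗ₜ[ℤ] MulOpposite.op r • m : M) := rfl

lemma rightAct_one (M : Bimod S R) : rightAct M 1 = 𝟙 _ := by
  ext m
  exact one_smul (S ⊗[ℤ] Rᵐᵒᵖ) (show M from m)

lemma rightAct_mul (M : Bimod S R) (r r' : R) :
    rightAct M (r * r') = rightAct M r ≫ rightAct M r' := by
  ext m
  change ((1 : S) ⊗ₜ[ℤ] MulOpposite.op (r * r') • (show M from m) : M) =
    ((1 : S) ⊗ₜ[ℤ] MulOpposite.op r' • ((1 : S) ⊗ₜ[ℤ] MulOpposite.op r • (show M from m)) : M)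
  rw [← mul_smul]
  simp

lemma rightAct_add (M : Bimod S R) (r r' : R) :
    rightAct M (r + r') = rightAct M r + rightAct M r' := by
  ext m
  change ((1 : S) ⊗ₜ[ℤ] MulOpposite.op (r + r') • (show M from m) : M) =
    ((1 : S) ⊗ₜ[ℤ] MulOpposite.op r • (show M from m) : M) +
      ((1 : S) ⊗ₜ[ℤ] MulOpposite.op r' • (show M from m) : M)
  rw [← add_smul, MulOpposite.op_add, TensorProduct.tmul_add]

lemma rightAct_zero (M : Bimod S R) : rightAct M (0 : R) = 0 := by
  simpa using rightAct_add M (0 : R) 0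

lemma rightAct_naturality {M M' : Bimod S R} (φ : M ⟶ M') (r : R) :
    (leftPart S R).map φ ≫ rightAct M' r = rightAct M r ≫ (leftPart S R).map φ := by
  ext m
  exact (φ.hom.map_smul _ (show M from m)).symm

/-- The left `S`-submodule of `M ⊗_ℤ N` generated by the elements `(m · r) ⊗ n - m ⊗ (r · n)`. -/
def tensorRel (M : Bimod S R) (N : ModuleCat.{u} R) :
    Submodule S ((leftPart S R).obj M ⊗[ℤ] N) :=
  Submodule.span S
    {t | ∃ (m : (leftPart S R).obj M) (r : R) (n : N),
      t = ((rightAct M r).hom m) ⊗ₜ[ℤ] n - m ⊗ₜ[ℤ] (r • n)}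

/-- The tensor product `M ⊗_R N` of an `S`-`R`-bimodule and a left `R`-module,
as a left `S`-module. -/
def tensorObj (M : Bimod S R) (N : ModuleCat.{u} R) : ModuleCat.{u} S :=
  ModuleCat.of S (((leftPart S R).obj M ⊗[ℤ] N) ⧸ tensorRel M N)

/-- The class of `m ⊗ n` in `M ⊗_R N`. -/
def tensorMk {M : Bimod S R} {N : ModuleCat.{u} R} (m : M) (n : N) : tensorObj M N :=
  (tensorRel M N).mkQ (TensorProduct.tmul ℤ (M := (leftPart S R).obj M) m n)

/-- The map `φ ⊗ g : M ⊗_ℤ N → M' ⊗_ℤ N'`. -/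
def preTensorMap {M M' : Bimod S R} {N N' : ModuleCat.{u} R} (φ : M ⟶ M') (g : N ⟶ N') :
    (leftPart S R).obj M ⊗[ℤ] N →ₗ[S] (leftPart S R).obj M' ⊗[ℤ] N' :=
  TensorProduct.AlgebraTensorModule.map ((leftPart S R).map φ).hom
    g.hom.toAddMonoidHom.toIntLinearMap

lemma preTensorMap_tmul {M M' : Bimod S R} {N N' : ModuleCat.{u} R} (φ : M ⟶ M') (g : N ⟶ N')
    (m : (leftPart S R).obj M) (n : N) :
    preTensorMap φ g (m ⊗ₜ n) = ((leftPart S R).map φ).hom m ⊗ₜ g.hom n := rfl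

lemma tensorRel_le_comap {M M' : Bimod S R} {N N' : ModuleCat.{u} R} (φ : M ⟶ M') (g : N ⟶ N') :
    tensorRel M N ≤ (tensorRel M' N').comap (preTensorMap φ g) := by
  refine Submodule.span_le.2 ?_
  rintro _ ⟨m, r, n, rfl⟩
  refine Submodule.subset_span ⟨((leftPart S R).map φ).hom m, r, g.hom n, ?_⟩
  have h := congrArg (fun f => f.hom m) (rightAct_naturality φ r)
  simp only [ModuleCat.hom_comp, LinearMap.comp_apply] at h
  rw [map_sub, preTensorMap_tmul, preTensorMap_tmul, map_smul, h]

/-- The map `φ ⊗ g : M ⊗_R N → M' ⊗_R N'`. -/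
def tensorMap {M M' : Bimod S R} {N N' : ModuleCat.{u} R} (φ : M ⟶ M') (g : N ⟶ N') :
    tensorObj M N ⟶ tensorObj M' N' :=
  ModuleCat.ofHom (Submodule.mapQ _ _ (preTensorMap φ g) (tensorRel_le_comap φ g))

lemma tensorMap_mk {M M' : Bimod S R} {N N' : ModuleCat.{u} R} (φ : M ⟶ M') (g : N ⟶ N')
    (m : M) (n : N) : (tensorMap φ g).hom (tensorMk m n) = tensorMk (φ.hom m) (g.hom n) := rfl

lemma tensorObj_hom_ext {M : Bimod S R} {N : ModuleCat.{u} R} {P : ModuleCat.{u} S}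
    {f g : tensorObj M N ⟶ P} (h : ∀ m n, f.hom (tensorMk m n) = g.hom (tensorMk m n)) :
    f = g := by
  refine ModuleCat.hom_ext (Submodule.linearMap_qext _
    (TensorProduct.AlgebraTensorModule.ext fun m n => h m n))

lemma tensorMk_add_left {M : Bimod S R} {N : ModuleCat.{u} R} (m m' : M) (n : N) :
    tensorMk (m + m') n = tensorMk m n + tensorMk m' n :=
  (congrArg (tensorRel M N).mkQ (TensorProduct.add_tmul
    (show (leftPart S R).obj M from m) (show (leftPart S R).obj M from m') n)).trans
    (map_add _ _ _)

lemma tensorMk_add_right {M : Bimod S R} {N : ModuleCat.{u} R} (m : M) (n n' : N) :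
    tensorMk m (n + n') = tensorMk m n + tensorMk m n' :=
  (congrArg (tensorRel M N).mkQ (TensorProduct.tmul_add
    (show (leftPart S R).obj M from m) n n')).trans (map_add _ _ _)

lemma tensorMk_balanced {M : Bimod S R} {N : ModuleCat.{u} R} (m : M) (r : R) (n : N) :
    tensorMk (M := M) ((rightAct M r).hom m) n = tensorMk m (r • n) :=
  (Submodule.Quotient.eq _).2 (Submodule.subset_span ⟨m, r, n, rfl⟩)

variable (S R) in
/-- The bifunctor `(M, N) ↦ M ⊗_R N` from `S`-`R`-bimodules and left `R`-modules
to left `S`-modules. -/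
def tensorBifunctor : Bimod S R ⥤ ModuleCat.{u} R ⥤ ModuleCat.{u} S where
  obj M :=
    { obj := fun N => tensorObj M N
      map := fun g => tensorMap (𝟙 M) g
      map_id := fun _ => tensorObj_hom_ext fun _ _ => rfl
      map_comp := fun _ _ => tensorObj_hom_ext fun _ _ => rfl }
  map φ :=
    { app := fun N => tensorMap φ (𝟙 N)
      naturality := fun _ _ _ => tensorObj_hom_ext fun _ _ => rfl }
  map_id _ := by
    ext N : 2
    exact tensorObj_hom_ext fun _ _ => rfl
  map_comp _ _ := by
    ext N : 2
    exact tensorObj_hom_ext fun _ _ => rfl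

instance : (tensorBifunctor S R).Additive where
  map_add := by
    intro M M' φ ψ
    ext N : 2
    exact tensorObj_hom_ext fun m n => tensorMk_add_left (φ.hom m) (ψ.hom m) n

instance (M : Bimod S R) : ((tensorBifunctor S R).obj M).Additive where
  map_add := by
    intro N N' f g
    exact tensorObj_hom_ext fun m n => tensorMk_add_right m (f.hom n) (g.hom n)

/-- The total tensor product `A ↦ K ⊗_R A` with a complex `K` of `S`-`R`-bimodules, as a functor
from complexes of left `R`-modules to complexes of left `S`-modules. In degree `n` the complex
`K ⊗_R A` is the direct sum of the modules `K^p ⊗_R A^q` over all `p + q = n`. -/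
def tensorComplex (K : CochainComplex (Bimod S R) ℤ) :
    CochainComplex (ModuleCat.{u} R) ℤ ⥤ CochainComplex (ModuleCat.{u} S) ℤ :=
  (tensorBifunctor S R).map₂CochainComplex.obj K

end Tensor

section Hom

variable {R S : Type u} [Ring R] [Ring S]

open CochainComplex.HomComplex

/-- The complex of left `R`-modules underlying a complex of `R`-`S`-bimodules. -/
abbrev leftComplex (K : CochainComplex (Bimod R S) ℤ) : CochainComplex (ModuleCat.{u} R) ℤ :=
  ((leftPart R S).mapHomologicalComplex (ComplexShape.up ℤ)).obj K

/-- The right action of an element of `S` on a complex of `R`-`S`-bimodules. -/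
def rightActComplex (K : CochainComplex (Bimod R S) ℤ) (s : S) : leftComplex K ⟶ leftComplex K where
  f n := rightAct (K.X n) s
  comm' i j _ := (rightAct_naturality (K.d i j) s).symm

lemma rightActComplex_one (K : CochainComplex (Bimod R S) ℤ) : rightActComplex K 1 = 𝟙 _ := by
  ext n : 1
  exact rightAct_one _

lemma rightActComplex_mul (K : CochainComplex (Bimod R S) ℤ) (s t : S) :
    rightActComplex K (s * t) = rightActComplex K s ≫ rightActComplex K t := by
  ext n : 1
  exact rightAct_mul _ _ _

lemma rightActComplex_add (K : CochainComplex (Bimod R S) ℤ) (s t : S) :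
    rightActComplex K (s + t) = rightActComplex K s + rightActComplex K t := by
  ext n : 1
  exact rightAct_add _ _ _

lemma rightActComplex_zero (K : CochainComplex (Bimod R S) ℤ) : rightActComplex K 0 = 0 := by
  ext n : 1
  exact rightAct_zero _

/-- The action `(s • f)(x) = f(x · s)` of `s : S` on an `R`-linear cochain `f : K → B`. -/
def cochainSMul {K : CochainComplex (Bimod R S) ℤ} {B : CochainComplex (ModuleCat.{u} R) ℤ} {n : ℤ}
    (s : S) (f : Cochain (leftComplex K) B n) : Cochain (leftComplex K) B n :=
  (Cochain.ofHom (rightActComplex K s)).comp f (zero_add n)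

section

variable {K : CochainComplex (Bimod R S) ℤ} {B B' : CochainComplex (ModuleCat.{u} R) ℤ} {n : ℤ}

lemma cochainSMul_one (f : Cochain (leftComplex K) B n) : cochainSMul 1 f = f := by
  rw [cochainSMul, rightActComplex_one, Cochain.id_comp]

lemma cochainSMul_mul (s t : S) (f : Cochain (leftComplex K) B n) :
    cochainSMul (s * t) f = cochainSMul s (cochainSMul t f) := by
  rw [cochainSMul, rightActComplex_mul, Cochain.ofHom_comp,
    Cochain.comp_assoc_of_first_is_zero_cochain]
  rfl

lemma cochainSMul_add (s t : S) (f : Cochain (leftComplex K) B n) :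
    cochainSMul (s + t) f = cochainSMul s f + cochainSMul t f := by
  rw [cochainSMul, rightActComplex_add, Cochain.ofHom_add, Cochain.add_comp]
  rfl

lemma cochainSMul_zero (f : Cochain (leftComplex K) B n) : cochainSMul (0 : S) f = 0 := by
  rw [cochainSMul, rightActComplex_zero, Cochain.ofHom_zero, Cochain.zero_comp]

lemma δ_cochainSMul (m : ℤ) (s : S) (f : Cochain (leftComplex K) B n) :
    δ n m (cochainSMul s f) = cochainSMul s (δ n m f) := by
  by_cases h : n + 1 = m
  · simp [cochainSMul, δ_zero_cochain_comp _ _ _ h]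
  · simp [cochainSMul, δ_shape _ _ h]

lemma δ_comp_ofHom (m : ℤ) (f : Cochain (leftComplex K) B n) (g : B ⟶ B') :
    δ n m (f.comp (Cochain.ofHom g) (add_zero n)) =
      (δ n m f).comp (Cochain.ofHom g) (add_zero m) := by
  by_cases h : n + 1 = m
  · simp [δ_comp_zero_cochain _ _ _ h]
  · simp [δ_shape _ _ h]

lemma comp_ofHom_comp {B'' : CochainComplex (ModuleCat.{u} R) ℤ}
    (f : Cochain (leftComplex K) B n) (g : B ⟶ B') (g' : B' ⟶ B'') :
    f.comp (Cochain.ofHom (g ≫ g')) (add_zero n) =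
      (f.comp (Cochain.ofHom g) (add_zero n)).comp (Cochain.ofHom g') (add_zero n) := by
  rw [Cochain.ofHom_comp, Cochain.comp_assoc_of_third_is_zero_cochain]

end

/-- The left `S`-module of `R`-linear cochains `K → B` of degree `n`, i.e. of families of
`R`-linear maps `K^p → B^q` for all `p + n = q`. -/
def HomCochain (K : CochainComplex (Bimod R S) ℤ) (B : CochainComplex (ModuleCat.{u} R) ℤ)
    (n : ℤ) : Type u :=
  Cochain (leftComplex K) B n

instance (K : CochainComplex (Bimod R S) ℤ) (B : CochainComplex (ModuleCat.{u} R) ℤ) (n : ℤ) :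
    AddCommGroup (HomCochain K B n) :=
  inferInstanceAs (AddCommGroup (Cochain (leftComplex K) B n))

instance (K : CochainComplex (Bimod R S) ℤ) (B : CochainComplex (ModuleCat.{u} R) ℤ) (n : ℤ) :
    Module S (HomCochain K B n) where
  smul s f := cochainSMul s f
  one_smul f := cochainSMul_one f
  mul_smul s t f := cochainSMul_mul s t f
  smul_zero s := Cochain.comp_zero (n₂ := n) (Cochain.ofHom (rightActComplex K s)) (zero_add n)
  smul_add s f g := Cochain.comp_add (Cochain.ofHom (rightActComplex K s)) f g (zero_add n)
  add_smul s t f := cochainSMul_add s t f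
  zero_smul f := cochainSMul_zero f

/-- The differential `f ↦ d ∘ f - (-1) ^ n f ∘ d` of the complex `Hom_R(K, B)`. -/
def homD (K : CochainComplex (Bimod R S) ℤ) (B : CochainComplex (ModuleCat.{u} R) ℤ) (n m : ℤ) :
    HomCochain K B n →ₗ[S] HomCochain K B m where
  toFun f := δ n m f
  map_add' f g := δ_add n m f g
  map_smul' s f := δ_cochainSMul m s f

/-- The complex of left `S`-modules `Hom_R(K, B)` for a complex `K` of `R`-`S`-bimodules and a
complex `B` of left `R`-modules. In degree `n` it is the product of the modules
`Hom_R(K^p, B^q)` over all `p + n = q`. -/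
def homComplexObj (K : CochainComplex (Bimod R S) ℤ) (B : CochainComplex (ModuleCat.{u} R) ℤ) :
    CochainComplex (ModuleCat.{u} S) ℤ where
  X n := ModuleCat.of S (HomCochain K B n)
  d n m := ModuleCat.ofHom (homD K B n m)
  shape n m h := by
    ext f
    exact δ_shape n m h f
  d_comp_d' n m k _ _ := by
    ext f
    exact δ_δ n m k f

/-- The functor `B ↦ Hom_R(K, B)` from complexes of left `R`-modules to complexes of left
`S`-modules, for a complex `K` of `R`-`S`-bimodules. -/
def homComplex (K : CochainComplex (Bimod R S) ℤ) :
    CochainComplex (ModuleCat.{u} R) ℤ ⥤ CochainComplex (ModuleCat.{u} S) ℤ where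
  obj B := homComplexObj K B
  map {B B'} g :=
    { f := fun n => ModuleCat.ofHom (X := HomCochain K B n) (Y := HomCochain K B' n)
        { toFun := fun f => Cochain.comp f (Cochain.ofHom g) (add_zero n)
          map_add' := fun f f' => Cochain.add_comp _ _ _ _
          map_smul' := fun s f => Cochain.comp_assoc_of_third_is_zero_cochain
            (Cochain.ofHom (rightActComplex K s)) f (Cochain.ofHom g) (zero_add n) }
      comm' := fun n m _ => by
        ext f
        exact δ_comp_ofHom m f g }
  map_id B := by
    ext n f
    exact Cochain.comp_id (F := leftComplex K) f
  map_comp g g' := by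
    ext n f
    exact comp_ofHom_comp f g g'

end Hom

/-! ### The bimodules and the two-term complex attached to a ring homomorphism -/

section RingHoms

/-- A ring `A` as an `A`-`A`-bimodule. -/
def regularBimod (A : Type u) [Ring A] : Bimod A A :=
  letI : Module (A ⊗[ℤ] Aᵐᵒᵖ) A := TensorProduct.Algebra.module
  ModuleCat.of (A ⊗[ℤ] Aᵐᵒᵖ) A

variable {R U : Type u} [Ring R] [Ring U]

/-- The ring homomorphism `S ⊗ Rᵐᵒᵖ → U ⊗ Uᵐᵒᵖ` induced by ring homomorphisms `g : S → U` and
`f : R → U`. -/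
def envMap {S : Type u} [Ring S] (g : S →+* U) (f : R →+* U) : S ⊗[ℤ] Rᵐᵒᵖ →+* U ⊗[ℤ] Uᵐᵒᵖ :=
  (Algebra.TensorProduct.map g.toIntAlgHom (RingHom.op f).toIntAlgHom).toRingHom

/-- The ring `U` as an `S`-`R`-bimodule via ring homomorphisms `g : S → U` and `f : R → U`. -/
def bimodOf {S : Type u} [Ring S] (g : S →+* U) (f : R →+* U) : Bimod S R :=
  (ModuleCat.restrictScalars (envMap g f)).obj (regularBimod U)

/-- A ring homomorphism `f : R → U` as an additive map between bimodules. -/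
def bimodAddHom (f : R →+* U) : regularBimod R →+ bimodOf f f := (f : R →+ U)

lemma regularBimod_smul (A : Type u) [Ring A] (a : A) (b : Aᵐᵒᵖ) (x : regularBimod A) :
    (a ⊗ₜ[ℤ] b) • x = (show regularBimod A from (a * ((show A from x) * b.unop) : A)) := rfl

lemma bimodOf_smul {S : Type u} [Ring S] (g : S →+* U) (f : R →+* U) (a : S) (b : Rᵐᵒᵖ)
    (x : bimodOf g f) :
    (a ⊗ₜ[ℤ] b) • x = (show bimodOf g f from (g a * ((show U from x) * f b.unop) : U)) := rfl

lemma zero_smul_moduleCat {E : Type u} [Ring E] (M : ModuleCat.{u} E) (x : M) :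
    (0 : E) • x = 0 := zero_smul E x

lemma bimodAddHom_smul (f : R →+* U) (t : R ⊗[ℤ] Rᵐᵒᵖ) (x : regularBimod R) :
    bimodAddHom f (t • x) = t • bimodAddHom f x := by
  induction t with
  | zero =>
    have h := zero_smul_moduleCat (regularBimod R) x
    have h' := zero_smul_moduleCat (bimodOf f f) (bimodAddHom f x)
    exact (congrArg _ h).trans ((map_zero _).trans h'.symm)
  | add a b ha hb => rw [add_smul, add_smul, map_add, ha, hb]
  | tmul a b =>
    rw [regularBimod_smul, bimodOf_smul]
    change f (a * ((show R from x) * b.unop)) = f a * (f (show R from x) * f b.unop)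
    rw [map_mul, map_mul]

/-- A ring homomorphism `f : R → U` as a morphism of `R`-`R`-bimodules. -/
def bimodMap (f : R →+* U) : regularBimod R ⟶ bimodOf f f :=
  ModuleCat.ofHom (X := regularBimod R) (Y := bimodOf f f)
    { bimodAddHom f with map_smul' := bimodAddHom_smul f }

/-- The two-term complex of `R`-`R`-bimodules `R → U`, with `R` in cohomological degree `-1`
and `U` in cohomological degree `0`. -/
def complexK (f : R →+* U) : CochainComplex (Bimod R R) ℤ :=
  HomologicalComplex.double (c := ComplexShape.up ℤ) (bimodMap f) (i₀ := -1) (i₁ := 0) (by simp)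

/-- The extension of scalars `N ↦ U ⊗_R N` from left `R`-modules to left `U`-modules. -/
def extendScalars (f : R →+* U) : ModuleCat.{u} R ⥤ ModuleCat.{u} U :=
  (tensorBifunctor U R).obj (bimodOf (RingHom.id U) f)

instance (f : R →+* U) : (extendScalars f).Additive := by
  unfold extendScalars
  infer_instance

instance (f : R →+* U) : (ModuleCat.coextendScalars.{u, u, u} f).Additive where
  map_add := rfl

lemma restrictScalars_map_exact (f : R →+* U) (S : ShortComplex (ModuleCat.{u} U)) (h : S.Exact) :
    (S.map (ModuleCat.restrictScalars.{u} f)).Exact := by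
  rw [ShortComplex.ShortExact.moduleCat_exact_iff_function_exact] at h ⊢
  exact h

instance (f : R →+* U) : PreservesFiniteLimits (ModuleCat.restrictScalars.{u} f) := by
  have h := ((Functor.exact_tfae (ModuleCat.restrictScalars.{u} f)).out 1 3).mp
    (restrictScalars_map_exact f)
  exact h.1

instance (f : R →+* U) : PreservesFiniteColimits (ModuleCat.restrictScalars.{u} f) := by
  have h := ((Functor.exact_tfae (ModuleCat.restrictScalars.{u} f)).out 1 3).mp
    (restrictScalars_map_exact f)
  exact h.2

/-- The left `U`-module `Tor_i^R(U, N)`. -/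
abbrev torU (f : R →+* U) (i : ℕ) (N : ModuleCat.{u} R) : ModuleCat.{u} U :=
  ((extendScalars f).leftDerived i).obj N

/-- The ring `U` as a left `R`-module. -/
abbrev leftModU (f : R →+* U) : ModuleCat.{u} R :=
  (ModuleCat.restrictScalars f).obj (ModuleCat.of U U)

/-- The multiplication `U ⊗_ℤ U → U`, as a left `U`-linear map. -/
def preMul (f : R →+* U) :
    (leftPart U R).obj (bimodOf (RingHom.id U) f) ⊗[ℤ] leftModU f →ₗ[U] U :=
  TensorProduct.AlgebraTensorModule.lift
    { toFun := fun (x : U) => AddMonoidHom.toIntLinearMap (M := leftModU f) (AddMonoidHom.mulLeft x)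
      map_add' := fun x y => by
        ext z
        exact add_mul (show U from x) (show U from y) (show U from z)
      map_smul' := fun a x => by
        ext z
        change a * ((show U from x) * f 1) * (show U from z) =
          a * ((show U from x) * (show U from z))
        rw [map_one, mul_one, mul_assoc] }

lemma tensorRel_le_ker_preMul (f : R →+* U) :
    tensorRel (bimodOf (RingHom.id U) f) (leftModU f) ≤ LinearMap.ker (preMul f) := by
  refine Submodule.span_le.2 ?_
  rintro _ ⟨x, r, y, rfl⟩
  rw [SetLike.mem_coe, LinearMap.mem_ker, map_sub, sub_eq_zero]
  change 1 * ((show U from x) * f r) * (show U from y) = (show U from x) * (f r * (show U from y))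
  rw [one_mul, mul_assoc]

/-- The multiplication map `U ⊗_R U → U`. -/
def mulMap (f : R →+* U) : (extendScalars f).obj (leftModU f) ⟶ ModuleCat.of U U :=
  ModuleCat.ofHom (Submodule.liftQ _ (preMul f) (tensorRel_le_ker_preMul f))

lemma mulMap_mk (f : R →+* U) (x y : U) :
    (mulMap f).hom (tensorMk (M := bimodOf (RingHom.id U) f) (N := leftModU f) x y) = x * y := rfl

/-- A ring homomorphism `f : R → U` is a homological epimorphism if the multiplication map
`U ⊗_R U → U` is an isomorphism and `Tor_i^R(U, U) = 0` for all `i > 0`. -/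
structure IsHomologicalEpi (f : R →+* U) : Prop where
  bijective_mul : Function.Bijective (mulMap f).hom
  isZero_tor : ∀ i : ℕ, 0 < i → IsZero (torU f i (leftModU f))

/-- The flat dimension of the right `R`-module `U` is at most `n`: one has `Tor_i^R(U, N) = 0` for
all left `R`-modules `N` and all `i > n`. -/
def FlatDimensionLE (f : R →+* U) (n : ℕ) : Prop :=
  ∀ (N : ModuleCat.{u} R) (i : ℕ), n < i → IsZero (torU f i N)

/-- A left `R`-module `M` is a `u`-comodule if `U ⊗_R M = 0 = Tor_1^R(U, M)`. -/
def IsComodule (f : R →+* U) : ObjectProperty (ModuleCat.{u} R) := fun M =>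
  IsZero ((extendScalars f).obj M) ∧ IsZero (torU f 1 M)

/-- A left `R`-module `C` is a `u`-contramodule if `Hom_R(U, C) = 0 = Ext^1_R(U, C)`. -/
def IsContramodule (f : R →+* U) : ObjectProperty (ModuleCat.{u} R) := fun C =>
  Subsingleton (leftModU f ⟶ C) ∧ Subsingleton (Abelian.Ext.{u} (leftModU f) C 1)

end RingHoms

/-! ### Bounded and unbounded derived categories -/

/-- The derived category symbols: `b` (bounded), `plus` (bounded below), `minus` (bounded above)
and `unbounded` (no condition). -/
inductive BoundSymbol
  | b
  | plus
  | minus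
  | unbounded

section Derived

variable (C : Type*) [Category* C] [Abelian C] [HasDerivedCategory C]

/-- The objects of the derived category which satisfy the cohomological boundedness condition
indicated by a derived category symbol. -/
def IsBounded : BoundSymbol → ObjectProperty (DerivedCategory C)
  | .b => DerivedCategory.TStructure.t.bounded
  | .plus => DerivedCategory.TStructure.t.plus
  | .minus => DerivedCategory.TStructure.t.minus
  | .unbounded => ⊤

instance (s : BoundSymbol) : (IsBounded C s).IsTriangulated := by
  cases s <;> dsimp only [IsBounded]
  · infer_instance
  · infer_instance
  · infer_instance
  · exact
      { exists_zero := ⟨0, isZero_zero _, trivial⟩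
        isStableUnderShiftBy := fun _ => ⟨fun _ _ => trivial⟩
        ext₂' := fun _ _ _ _ => ⟨_, trivial, ⟨Iso.refl _⟩⟩ }

/-- The bounded or unbounded derived category indicated by a derived category symbol, as a full
triangulated subcategory of the unbounded derived category. -/
abbrev DStar (s : BoundSymbol) := (IsBounded C s).FullSubcategory

end Derived

section DerivedModules

variable {R U : Type u} [Ring R] [Ring U] [HasDerivedCategory.{w} (ModuleCat.{u} R)]

/-- The objects of the (bounded or unbounded) derived category of left `R`-modules whose
cohomology modules are `u`-comodules. -/
def HasComoduleCohomology (f : R →+* U) (s : BoundSymbol) :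
    ObjectProperty (DerivedCategory (ModuleCat.{u} R)) :=
  IsBounded _ s ⊓ fun X => ∀ n : ℤ, IsComodule f ((DerivedCategory.homologyFunctor _ n).obj X)

/-- The objects of the (bounded or unbounded) derived category of left `R`-modules whose
cohomology modules are `u`-contramodules. -/
def HasContramoduleCohomology (f : R →+* U) (s : BoundSymbol) :
    ObjectProperty (DerivedCategory (ModuleCat.{u} R)) :=
  IsBounded _ s ⊓ fun X => ∀ n : ℤ, IsContramodule f ((DerivedCategory.homologyFunctor _ n).obj X)

/-- The category of complexes with `u`-comodule cohomology. -/
abbrev DCo (f : R →+* U) (s : BoundSymbol) := (HasComoduleCohomology f s).FullSubcategory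

/-- The category of complexes with `u`-contramodule cohomology. -/
abbrev DCtra (f : R →+* U) (s : BoundSymbol) := (HasContramoduleCohomology f s).FullSubcategory

/-- The restriction of scalars functor `u_*` between the unbounded derived categories. -/
abbrev restrictD [HasDerivedCategory.{w'} (ModuleCat.{u} U)] (f : R →+* U) :
    DerivedCategory (ModuleCat.{u} U) ⥤ DerivedCategory (ModuleCat.{u} R) :=
  (ModuleCat.restrictScalars.{u} f).mapDerivedCategory

end DerivedModules

/-- The functor between full subcategories induced by a functor `F` between ambient categories. -/
abbrev restrictFunctor {A B : Type*} [Category* A] [Category* B] (F : A ⥤ B)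
    (P : ObjectProperty A) (Q : ObjectProperty B) (h : ∀ X, P X → Q (F.obj X)) :
    P.FullSubcategory ⥤ Q.FullSubcategory :=
  Q.lift (P.ι ⋙ F) fun X => h X.1 X.2

/-- The inclusion functor between full subcategories. -/
abbrev inclusionFunctor {A : Type*} [Category* A] (P Q : ObjectProperty A) (h : ∀ X, P X → Q X) :
    P.FullSubcategory ⥤ Q.FullSubcategory :=
  Q.lift P.ι fun X => h X.1 X.2

/-! ### Recollements -/

open Pretriangulated

/-- Six triangulated functors form a recollement of `D` by `Z` and `E`: `iL ⊣ i ⊣ iR` and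
`jL ⊣ j ⊣ jR`, the functors `i`, `jL`, `jR` are fully faithful, the functors `j`, `iL`, `iR` are
Verdier quotient functors by their kernels, and these kernels are the essential images of
`i`, `jL`, `jR`, respectively. -/
structure IsRecollement {Z D E : Type*} [Category* Z] [Category* D] [Category* E]
    [HasZeroObject Z] [HasZeroObject D] [HasZeroObject E]
    [Preadditive Z] [Preadditive D] [Preadditive E]
    [HasShift Z ℤ] [HasShift D ℤ] [HasShift E ℤ]
    [∀ n : ℤ, (shiftFunctor Z n).Additive] [∀ n : ℤ, (shiftFunctor D n).Additive]
    [∀ n : ℤ, (shiftFunctor E n).Additive]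
    [Pretriangulated Z] [Pretriangulated D] [Pretriangulated E]
    (iL : D ⥤ Z) (i : Z ⥤ D) (iR : D ⥤ Z) (jL : E ⥤ D) (j : D ⥤ E) (jR : E ⥤ D)
    [iL.CommShift ℤ] [i.CommShift ℤ] [iR.CommShift ℤ]
    [jL.CommShift ℤ] [j.CommShift ℤ] [jR.CommShift ℤ] : Prop where
  isTriangulated_iL : iL.IsTriangulated
  isTriangulated_i : i.IsTriangulated
  isTriangulated_iR : iR.IsTriangulated
  isTriangulated_jL : jL.IsTriangulated
  isTriangulated_j : j.IsTriangulated
  isTriangulated_jR : jR.IsTriangulated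
  adj_iL_i : Nonempty (iL ⊣ i)
  adj_i_iR : Nonempty (i ⊣ iR)
  adj_jL_j : Nonempty (jL ⊣ j)
  adj_j_jR : Nonempty (j ⊣ jR)
  full_i : i.Full
  faithful_i : i.Faithful
  full_jL : jL.Full
  faithful_jL : jL.Faithful
  full_jR : jR.Full
  faithful_jR : jR.Faithful
  kernel_j : j.kernel = i.essImage
  kernel_iL : iL.kernel = jL.essImage
  kernel_iR : iR.kernel = jR.essImage
  isLocalization_j : j.IsLocalization j.kernel.trW
  isLocalization_iL : iL.IsLocalization iL.kernel.trW
  isLocalization_iR : iR.IsLocalization iR.kernel.trW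

end Matlis

end

open Matlis

/-!
Restriction of scalars `u_*` along a homological epimorphism `u : R → U` is fully faithful on
derived categories, and everything follows from two families of distinguished triangles which
measure the failure of `u_*` to be essentially surjective,
`K[-1] ⊗^𝕃 Z ⟶ Z ⟶ u_* 𝕃u^* Z` and `u_* ℝu^! Z ⟶ Z ⟶ ℝHom(K[-1], Z)`.

*Derived functors.* Call a left `R`-module acyclic if `Tor₁(U, -)` vanishes on it (`LeftAcyclic`).
Since `Tor₂(U, -) = 0`, submodules of acyclic modules are acyclic (`LeftAcyclic.of_subobject`).
Hence every complex, bounded or not, has a functorial resolution by acyclic modules with just two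
steps: the cone of `ker ⟶ P` for a functorial termwise epimorphism `P ⟶ X` from projective modules
(`exists_left_resolution`). The functor taking a module to the free module on its elements does not
preserve zero morphisms, which is repaired by passing to a direct summand (`reducedSub`). By the
same dimension argument `U ⊗_R -` preserves exactness of unbounded complexes of acyclic modules, so
these resolutions compute derived functors of unbounded complexes
(`isLeftDerivedFunctor_of_deformation`, `exists_leftDerived`). Dually, since `U` has projective
dimension at most one on the left, modules with `Ext¹(U, -) = 0` (`RightAcyclic`) are closed under
quotients and give functorial right resolutions.

*Full faithfulness.* For a homological epimorphism, `U ⊗_R N ≅ N` for every `U`-module `N`, and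
`Tor₁(U, N) = 0`: this passes from `U` to direct sums of copies of `U` and then to their quotients
(`IsHomologicalEpi.leftAcyclic_restrictScalars`). So the counit `𝕃u^* u_* ⟶ 1` is invertible
(`isIso_counit`).

*Gluing triangles.* On the level of complexes `K[-1] ⊗_R X` is the cocone of the unit
`X ⟶ U ⊗_R X` (`tensorPresentation`), and `Hom_R(K[-1], B)` is the cone of the counit
`Hom_R(U, B) ⟶ B` (`homPresentation`). Evaluated on acyclic resolutions these give the two triangles
(`exists_left_triangle`, `exists_right_triangle`).

*Recollement.* A pair of such triangles around a fully faithful functor formally yields the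
recollement and the equivalence between the kernels of `𝕃u^*` and `ℝu^!`
(`HasGluingTriangles.equivalence`, `HasGluingTriangles.isRecollement`). Finally the cohomology
of `U ⊗_R X`, for a complex `X` of acyclic modules, vanishes in degree `n` if and only if
`U ⊗_R Hⁿ(X) = 0` and `Tor₁(U, Hⁿ⁺¹(X)) = 0` (`exactAt_mapHomologicalComplex_iff`). This identifies
the kernel of `𝕃u^*` with the complexes whose cohomology modules are comodules, and shows that the
functors respect boundedness; the dual statement treats contramodules.
-/

noncomputable section

namespace Matlis

/-! ### Derived functors from deformations -/

section Deformation

variable {C D E : Type*} [Category* C] [Category* D] [Category* E]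

/-- Let `r` be a functorial left deformation of `C`, that is, `π : r ⟶ 𝟭` consists of weak
equivalences. If `α` is invertible on the objects `r X`, then `LF` is the total left derived functor
of `F`: a comparison `G ⟶ LF` is forced to be given by `β` on the objects `r X`, transported along
the isomorphisms `L (π X)`. -/
theorem isLeftDerivedFunctor_of_deformation {L : C ⥤ D} (W : MorphismProperty C)
    [L.IsLocalization W] {F : C ⥤ E} {LF : D ⥤ E} (α : L ⋙ LF ⟶ F) (r : C ⥤ C)
    (π : r ⟶ 𝟭 C) (hπ : ∀ X, W (π.app X)) (hα : ∀ X, IsIso (α.app (r.obj X))) :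
    LF.IsLeftDerivedFunctor α W := by
  have : ((Functor.whiskeringLeft C D E).obj L).Full :=
    inferInstanceAs (Localization.whiskeringLeftFunctor' L W E).Full
  have : ((Functor.whiskeringLeft C D E).obj L).Faithful :=
    inferInstanceAs (Localization.whiskeringLeftFunctor' L W E).Faithful
  have hL : ∀ X, IsIso (L.map (π.app X)) := fun X => Localization.inverts L W _ (hπ X)
  have nat : ∀ {X Y : C} (g : X ⟶ Y), r.map g ≫ π.app Y = π.app X ≫ g := fun g => π.naturality g
  -- naturality along `π X` leaves no choice: pass to `r X`, where `α` is invertible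
  let lift (G : D ⥤ E) (β : L ⋙ G ⟶ F) : L ⋙ G ⟶ L ⋙ LF :=
    { app := fun X => inv (G.map (L.map (π.app X))) ≫ β.app (r.obj X) ≫
        inv (α.app (r.obj X)) ≫ LF.map (L.map (π.app X))
      naturality := by
        intro X Y g
        have hβ := β.naturality (r.map g)
        have hα' := α.naturality (r.map g)
        dsimp at hβ hα' ⊢
        have e : inv (α.app (r.obj X)) ≫ LF.map (L.map (r.map g)) =
            F.map (r.map g) ≫ inv (α.app (r.obj Y)) := by
          rw [IsIso.inv_comp_eq, ← Category.assoc, ← hα', Category.assoc, IsIso.hom_inv_id,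
            Category.comp_id]
        rw [Category.assoc, Category.assoc, Category.assoc, ← LF.map_comp, ← L.map_comp,
          ← nat, L.map_comp, LF.map_comp, reassoc_of% e, IsIso.eq_inv_comp,
          ← G.map_comp_assoc, ← L.map_comp, ← nat, L.map_comp, G.map_comp, Category.assoc,
          IsIso.hom_inv_id_assoc, reassoc_of% hβ] }
  have ex (G : D ⥤ E) (β : L ⋙ G ⟶ F) :
      ∃ γ : G ⟶ LF, ∀ X, γ.app (L.obj X) ≫ α.app X = β.app X := by
    obtain ⟨γ, hγ⟩ : ∃ γ : G ⟶ LF, Functor.whiskerLeft L γ = lift G β :=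
      ⟨_, ((Functor.whiskeringLeft C D E).obj L).map_preimage (lift G β)⟩
    refine ⟨γ, fun X => ?_⟩
    have h : γ.app (L.obj X) = (lift G β).app X := congr_app hγ X
    have h1 := α.naturality (π.app X)
    have h2 := β.naturality (π.app X)
    dsimp at h1 h2
    rw [h]
    dsimp [lift]
    rw [Category.assoc, Category.assoc, Category.assoc, h1, IsIso.inv_hom_id_assoc, ← h2,
      IsIso.inv_hom_id_assoc]
  have uniq (G : D ⥤ E) (γ γ' : G ⟶ LF)
      (h : ∀ X, γ.app (L.obj X) ≫ α.app X = γ'.app (L.obj X) ≫ α.app X) : γ = γ' := by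
    apply ((Functor.whiskeringLeft C D E).obj L).map_injective
    ext X
    have h1 := γ.naturality (L.map (π.app X))
    have h2 := γ'.naturality (L.map (π.app X))
    dsimp
    rw [← cancel_epi (G.map (L.map (π.app X)))]
    dsimp at h1 h2
    rw [h1, h2]
    congr 1
    rw [← cancel_mono (α.app (r.obj X))]
    exact h _
  choose d hd using ex
  refine ⟨⟨⟨IsTerminal.ofUniqueHom (fun S =>
    CostructuredArrow.homMk (d S.left S.hom) ?_) ?_⟩⟩⟩
  · ext X
    exact hd S.left S.hom X
  · intro S m
    apply CostructuredArrow.hom_ext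
    refine uniq S.left _ _ fun X => Eq.trans ?_ (hd S.left S.hom X).symm
    exact congr_app (CostructuredArrow.w m) X

/-- The dual criterion: a functorial right deformation on whose values `α` is invertible exhibits
`RF` as the total right derived functor of `F`. -/
theorem isRightDerivedFunctor_of_deformation {L : C ⥤ D} (W : MorphismProperty C)
    [L.IsLocalization W] {F : C ⥤ E} {RF : D ⥤ E} (α : F ⟶ L ⋙ RF) (r : C ⥤ C)
    (ι : 𝟭 C ⟶ r) (hι : ∀ X, W (ι.app X)) (hα : ∀ X, IsIso (α.app (r.obj X))) :
    RF.IsRightDerivedFunctor α W := by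
  have : ((Functor.whiskeringLeft C D E).obj L).Full :=
    inferInstanceAs (Localization.whiskeringLeftFunctor' L W E).Full
  have : ((Functor.whiskeringLeft C D E).obj L).Faithful :=
    inferInstanceAs (Localization.whiskeringLeftFunctor' L W E).Faithful
  have hL : ∀ X, IsIso (L.map (ι.app X)) := fun X => Localization.inverts L W _ (hι X)
  have nat : ∀ {X Y : C} (g : X ⟶ Y), g ≫ ι.app Y = ι.app X ≫ r.map g := fun g => ι.naturality g
  -- naturality along `ι X` leaves no choice: pass to `r X`, where `α` is invertible
  let desc (G : D ⥤ E) (β : F ⟶ L ⋙ G) : L ⋙ RF ⟶ L ⋙ G :=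
    { app := fun X => RF.map (L.map (ι.app X)) ≫ inv (α.app (r.obj X)) ≫ β.app (r.obj X) ≫
        inv (G.map (L.map (ι.app X)))
      naturality := by
        intro X Y g
        have hβ := β.naturality (r.map g)
        have hα' := α.naturality (r.map g)
        dsimp at hβ hα' ⊢
        have e : RF.map (L.map (r.map g)) ≫ inv (α.app (r.obj Y)) =
            inv (α.app (r.obj X)) ≫ F.map (r.map g) := by
          rw [IsIso.eq_inv_comp, ← Category.assoc, ← hα', Category.assoc, IsIso.hom_inv_id,
            Category.comp_id]
        have e' : inv (G.map (L.map (ι.app X))) ≫ G.map (L.map g) =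
            G.map (L.map (r.map g)) ≫ inv (G.map (L.map (ι.app Y))) := by
          rw [IsIso.inv_comp_eq, ← Category.assoc, ← G.map_comp, ← L.map_comp, ← nat, L.map_comp,
            G.map_comp, Category.assoc, IsIso.hom_inv_id, Category.comp_id]
        rw [Category.assoc, Category.assoc, Category.assoc, e', ← reassoc_of% hβ,
          ← reassoc_of% e, ← RF.map_comp_assoc, ← L.map_comp, nat, L.map_comp, RF.map_comp,
          Category.assoc] }
  have ex (G : D ⥤ E) (β : F ⟶ L ⋙ G) :
      ∃ γ : RF ⟶ G, ∀ X, α.app X ≫ γ.app (L.obj X) = β.app X := by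
    obtain ⟨γ, hγ⟩ : ∃ γ : RF ⟶ G, Functor.whiskerLeft L γ = desc G β :=
      ⟨_, ((Functor.whiskeringLeft C D E).obj L).map_preimage (desc G β)⟩
    refine ⟨γ, fun X => ?_⟩
    have h : γ.app (L.obj X) = (desc G β).app X := congr_app hγ X
    have h1 := α.naturality (ι.app X)
    have h2 := β.naturality (ι.app X)
    dsimp at h1 h2
    rw [h]
    dsimp [desc]
    rw [← reassoc_of% h1, IsIso.hom_inv_id_assoc, reassoc_of% h2, IsIso.hom_inv_id,
      Category.comp_id]
  have uniq (G : D ⥤ E) (γ γ' : RF ⟶ G)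
      (h : ∀ X, α.app X ≫ γ.app (L.obj X) = α.app X ≫ γ'.app (L.obj X)) : γ = γ' := by
    apply ((Functor.whiskeringLeft C D E).obj L).map_injective
    ext X
    have h1 := γ.naturality (L.map (ι.app X))
    have h2 := γ'.naturality (L.map (ι.app X))
    dsimp
    rw [← cancel_mono (G.map (L.map (ι.app X)))]
    dsimp at h1 h2
    rw [← h1, ← h2]
    congr 1
    rw [← cancel_epi (α.app (r.obj X))]
    exact h _
  choose d hd using ex
  refine ⟨⟨⟨IsInitial.ofUniqueHom (fun S =>
    StructuredArrow.homMk (d S.right S.hom) ?_) ?_⟩⟩⟩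
  · ext X
    exact hd S.right S.hom X
  · intro S m
    apply StructuredArrow.hom_ext
    refine uniq S.right _ _ fun X => Eq.trans ?_ (hd S.right S.hom X).symm
    exact congr_app (StructuredArrow.w m) X

end Deformation

/-! ### Recollements from gluing triangles -/

section

open Pretriangulated

section Adjunctions

variable {A B : Type*} [Category* A] [Category* B]

/-- A fully faithful functor `J` is left adjoint to `K` if composition with `ε : K ⋙ J ⟶ 𝟭` is
bijective on morphisms out of the image of `J`. The counit of this adjunction is `ε`. -/
def adjunctionOfBijectiveCounit {J : A ⥤ B} (hJ : J.FullyFaithful) {K : B ⥤ A}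
    (ε : K ⋙ J ⟶ 𝟭 B)
    (h : ∀ X Y, Function.Bijective fun g : J.obj X ⟶ J.obj (K.obj Y) => g ≫ ε.app Y) :
    J ⊣ K :=
  Adjunction.mkOfHomEquiv
    { homEquiv := fun X Y => ((Equiv.ofBijective _ (h X Y)).symm).trans hJ.homEquiv.symm
      homEquiv_naturality_left_symm := by
        intro X' X Y f g
        simp [Functor.FullyFaithful.homEquiv]
      homEquiv_naturality_right := by
        intro X Y Y' f g
        apply hJ.homEquiv.injective
        apply (h X Y').1
        have h1 := (Equiv.ofBijective _ (h X Y')).apply_symm_apply (f ≫ g)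
        have h2 := (Equiv.ofBijective _ (h X Y)).apply_symm_apply f
        have h3 := ε.naturality g
        dsimp at h1 h2 h3
        simp only [Functor.FullyFaithful.homEquiv, Equiv.trans_apply, Equiv.coe_fn_symm_mk,
          Equiv.coe_fn_mk, Functor.map_comp, hJ.map_preimage, Category.assoc, h3]
        rw [h1, reassoc_of% h2] }

/-- A fully faithful functor `J` is right adjoint to `K` if composition with `η : 𝟭 ⟶ K ⋙ J` is
bijective on morphisms into the image of `J`. The unit of this adjunction is `η`. -/
def adjunctionOfBijectiveUnit {J : A ⥤ B} (hJ : J.FullyFaithful) {K : B ⥤ A}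
    (η : 𝟭 B ⟶ K ⋙ J)
    (h : ∀ X Y, Function.Bijective fun g : J.obj (K.obj Y) ⟶ J.obj X => η.app Y ≫ g) :
    K ⊣ J :=
  Adjunction.mkOfHomEquiv
    { homEquiv := fun Y X => hJ.homEquiv.trans (Equiv.ofBijective _ (h X Y))
      homEquiv_naturality_right := by
        intro X Y Y' f g
        simp [Functor.FullyFaithful.homEquiv]
      homEquiv_naturality_left_symm := by
        intro Y' Y X f g
        apply hJ.homEquiv.injective
        apply (h X Y').1
        have h1 := (Equiv.ofBijective _ (h X Y')).apply_symm_apply (f ≫ g)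
        have h2 := (Equiv.ofBijective _ (h X Y)).apply_symm_apply g
        have h3 := η.naturality f
        dsimp at h1 h2 h3
        simp only [Functor.FullyFaithful.homEquiv, Equiv.symm_trans_apply, Equiv.coe_fn_symm_mk,
          Equiv.coe_fn_mk, Functor.map_comp, hJ.map_preimage, ← reassoc_of% h3]
        rw [h1, h2] }

end Adjunctions

lemma isZero_fullSubcategory_iff {C : Type*} [Category* C] [Preadditive C] (P : ObjectProperty C)
    (X : P.FullSubcategory) : IsZero X ↔ IsZero X.1 :=
  ⟨fun h => P.ι.map_isZero h, fun h => IsZero.of_full_of_faithful_of_isZero P.ι _ h⟩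

section Triangulated

set_option linter.unusedSectionVars false

variable {Z D : Type*} [Category* Z] [Category* D] [HasZeroObject Z] [HasZeroObject D]
  [Preadditive Z] [Preadditive D] [HasShift Z ℤ] [HasShift D ℤ]
  [∀ n : ℤ, (shiftFunctor Z n).Additive] [∀ n : ℤ, (shiftFunctor D n).Additive]
  [Pretriangulated Z] [Pretriangulated D]

/-- Composition with the first morphism of a distinguished triangle is bijective on morphisms out of
an object which is left orthogonal to all shifts of the third object. -/
lemma bijective_comp_mor₁ (S : Triangle D) (hS : S ∈ distTriang D) (X : D)
    (h : ∀ n : ℤ, ∀ g : X ⟶ S.obj₃⟦n⟧, g = 0) :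
    Function.Bijective fun g : X ⟶ S.obj₁ => g ≫ S.mor₁ := by
  refine ⟨(injective_iff_map_eq_zero (AddMonoidHom.mk' (fun g : X ⟶ S.obj₁ => g ≫ S.mor₁)
    (fun a b => Preadditive.add_comp _ _ _ a b _))).2 fun g hg => ?_, fun g => ?_⟩
  · obtain ⟨k, hk⟩ := Triangle.coyoneda_exact₂ _ (inv_rot_of_distTriang _ hS) g hg
    have : k = 0 := h (-1) k
    rw [this, zero_comp] at hk
    exact hk
  · have h0 : g ≫ S.mor₂ = 0 := by
      rw [← cancel_mono ((shiftFunctorZero D ℤ).inv.app S.obj₃), zero_comp]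
      exact h 0 _
    obtain ⟨k, hk⟩ := Triangle.coyoneda_exact₂ _ hS g h0
    exact ⟨k, hk.symm⟩

/-- Composition with the second morphism of a distinguished triangle is bijective on morphisms into
an object which is right orthogonal to all shifts of the first object. -/
lemma bijective_mor₂_comp (S : Triangle D) (hS : S ∈ distTriang D) (Y : D)
    (h : ∀ n : ℤ, ∀ g : S.obj₁⟦n⟧ ⟶ Y, g = 0) :
    Function.Bijective fun g : S.obj₃ ⟶ Y => S.mor₂ ≫ g := by
  refine ⟨(injective_iff_map_eq_zero (AddMonoidHom.mk' (fun g : S.obj₃ ⟶ Y => S.mor₂ ≫ g)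
    (fun a b => Preadditive.comp_add _ _ _ _ a b))).2 fun g hg => ?_, fun g => ?_⟩
  · obtain ⟨k, hk⟩ := Triangle.yoneda_exact₂ _ (rot_of_distTriang _ hS) g hg
    have : k = 0 := h 1 k
    rw [this, comp_zero] at hk
    exact hk
  · have h0 : S.mor₁ ≫ g = 0 := by
      rw [← cancel_epi ((shiftFunctorZero D ℤ).hom.app S.obj₁), comp_zero]
      exact h 0 _
    obtain ⟨k, hk⟩ := Triangle.yoneda_exact₂ _ hS g h0
    exact ⟨k, hk.symm⟩

instance isTriangulated_isZero : ObjectProperty.IsTriangulated (IsZero (C := Z)) where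
  exists_zero := ⟨0, isZero_zero _, isZero_zero _⟩
  isStableUnderShiftBy n := ⟨fun X (hX : IsZero X) => (shiftFunctor Z n).map_isZero hX⟩
  ext₂' T hT h₁ h₃ := ⟨T.obj₂, Triangle.isZero₂_of_isZero₁₃ T hT h₁ h₃, ⟨Iso.refl _⟩⟩

instance isTriangulated_kernel (F : D ⥤ Z) [F.CommShift ℤ] [F.IsTriangulated] :
    F.kernel.IsTriangulated :=
  inferInstanceAs (ObjectProperty.inverseImage (IsZero (C := Z)) F).IsTriangulated

lemma kernel_trW_eq (F : D ⥤ Z) [F.CommShift ℤ] [F.IsTriangulated] :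
    F.kernel.trW = (MorphismProperty.isomorphisms Z).inverseImage F := by
  ext X Y f
  obtain ⟨W, g, h, hT⟩ := distinguished_cocone_triangle f
  refine (F.kernel.trW_iff_of_distinguished _ hT).trans ?_
  exact Triangle.isZero₃_iff_isIso₁ _ (F.map_distinguished _ hT)

variable {L : D ⥤ Z} {i : Z ⥤ D} {R : D ⥤ Z} {T H : D ⥤ D} (adjL : L ⊣ i) (adjR : i ⊣ R)
  (ε : T ⟶ 𝟭 D) (η : 𝟭 D ⟶ H)

/-- Gluing triangles for a functor `i` with adjoints `L ⊣ i ⊣ R`: the unit of the first adjunction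
and the counit of the second one are completed to distinguished triangles
`T X ⟶ X ⟶ i (L X) ⟶ T X⟦1⟧` and `i (R X) ⟶ X ⟶ H X ⟶ i (R X)⟦1⟧` by functors `T` and `H`. The
connecting morphisms are not required to be natural. -/
structure HasGluingTriangles : Prop where
  /-- The triangle `T X ⟶ X ⟶ i (L X) ⟶ T X⟦1⟧`. -/
  exists_left : ∀ X, ∃ h, Triangle.mk (ε.app X) (adjL.unit.app X) h ∈ distTriang D
  /-- The triangle `i (R X) ⟶ X ⟶ H X ⟶ i (R X)⟦1⟧`. -/
  exists_right : ∀ X, ∃ h, Triangle.mk (adjR.counit.app X) (η.app X) h ∈ distTriang D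

namespace HasGluingTriangles

variable {adjL adjR ε η}

lemma isZero_obj_left (hG : HasGluingTriangles adjL adjR ε η) [L.CommShift ℤ] [L.IsTriangulated]
    [i.Full] [i.Faithful] (X : D) : IsZero (L.obj (T.obj X)) := by
  obtain ⟨h, hT⟩ := hG.exists_left X
  refine (Triangle.isZero₁_iff_isIso₂ _ (L.map_distinguished _ hT)).2 ?_
  change IsIso (L.map (adjL.unit.app X))
  infer_instance

lemma isZero_obj_right (hG : HasGluingTriangles adjL adjR ε η) [R.CommShift ℤ] [R.IsTriangulated]
    [i.Full] [i.Faithful] (X : D) : IsZero (R.obj (H.obj X)) := by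
  obtain ⟨h, hT⟩ := hG.exists_right X
  refine (Triangle.isZero₃_iff_isIso₁ _ (R.map_distinguished _ hT)).2 ?_
  change IsIso (R.map (adjR.counit.app X))
  infer_instance

lemma isIso_ε (hG : HasGluingTriangles adjL adjR ε η) [i.CommShift ℤ] [i.IsTriangulated]
    {X : D} (hX : IsZero (L.obj X)) : IsIso (ε.app X) := by
  obtain ⟨h, hT⟩ := hG.exists_left X
  exact (Triangle.isZero₃_iff_isIso₁ _ hT).1 (i.map_isZero hX)

lemma isIso_η (hG : HasGluingTriangles adjL adjR ε η) [i.CommShift ℤ] [i.IsTriangulated]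
    {X : D} (hX : IsZero (R.obj X)) : IsIso (η.app X) := by
  obtain ⟨h, hT⟩ := hG.exists_right X
  exact (Triangle.isZero₁_iff_isIso₂ _ hT).1 (i.map_isZero hX)

lemma isZero_T_iff (hG : HasGluingTriangles adjL adjR ε η) (X : D) :
    IsZero (T.obj X) ↔ IsIso (adjL.unit.app X) := by
  obtain ⟨h, hT⟩ := hG.exists_left X
  exact Triangle.isZero₁_iff_isIso₂ _ hT

lemma isZero_H_iff (hG : HasGluingTriangles adjL adjR ε η) (X : D) :
    IsZero (H.obj X) ↔ IsIso (adjR.counit.app X) := by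
  obtain ⟨h, hT⟩ := hG.exists_right X
  exact Triangle.isZero₃_iff_isIso₁ _ hT

lemma isZero_T_obj (hG : HasGluingTriangles adjL adjR ε η) [i.Full] [i.Faithful] (Y : Z) :
    IsZero (T.obj (i.obj Y)) :=
  (hG.isZero_T_iff _).2 inferInstance

lemma isZero_H_obj (hG : HasGluingTriangles adjL adjR ε η) [i.Full] [i.Faithful] (Y : Z) :
    IsZero (H.obj (i.obj Y)) :=
  (hG.isZero_H_iff _).2 inferInstance

lemma bijective_comp_ε (hG : HasGluingTriangles adjL adjR ε η) [i.CommShift ℤ]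
    {X : D} (hX : IsZero (L.obj X)) (Y : D) :
    Function.Bijective fun g : X ⟶ T.obj Y => g ≫ ε.app Y := by
  obtain ⟨h, hT⟩ := hG.exists_left Y
  refine bijective_comp_mor₁ _ hT X fun n g => ?_
  have e : i.obj ((L.obj Y)⟦n⟧) ≅ (i.obj (L.obj Y))⟦n⟧ := (i.commShiftIso n).app (L.obj Y)
  have h0 : ∀ g' : X ⟶ i.obj ((L.obj Y)⟦n⟧), g' = 0 := fun g' =>
    (adjL.homEquiv _ _).symm.injective (hX.eq_of_src _ _)
  suffices ∀ g : X ⟶ (i.obj (L.obj Y))⟦n⟧, g = 0 from this g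
  intro g
  rw [← cancel_mono e.inv, zero_comp]
  exact h0 _

lemma bijective_η_comp (hG : HasGluingTriangles adjL adjR ε η) [i.CommShift ℤ]
    {Y : D} (hY : IsZero (R.obj Y)) (X : D) :
    Function.Bijective fun g : H.obj X ⟶ Y => η.app X ≫ g := by
  obtain ⟨h, hT⟩ := hG.exists_right X
  refine bijective_mor₂_comp _ hT Y fun n g => ?_
  have e : i.obj ((R.obj X)⟦n⟧) ≅ (i.obj (R.obj X))⟦n⟧ := (i.commShiftIso n).app (R.obj X)
  have h0 : ∀ g' : i.obj ((R.obj X)⟦n⟧) ⟶ Y, g' = 0 := fun g' =>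
    (adjR.homEquiv _ _).injective (hY.eq_of_tgt _ _)
  suffices ∀ g : (i.obj (R.obj X))⟦n⟧ ⟶ Y, g = 0 from this g
  intro g
  rw [← cancel_epi e.hom, comp_zero]
  exact h0 _

/-- The functor `T` is triangulated: it is the right adjoint of the inclusion of the kernel of `L`,
followed by this inclusion. -/
lemma exists_commShift_T (hG : HasGluingTriangles adjL adjR ε η) [i.CommShift ℤ]
    [L.CommShift ℤ] [L.IsTriangulated] [i.Full] [i.Faithful] :
    ∃ (_ : T.CommShift ℤ), T.IsTriangulated := by
  let Tl : D ⥤ L.kernel.FullSubcategory := L.kernel.lift T hG.isZero_obj_left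
  let e : Tl ⋙ L.kernel.ι ≅ T := L.kernel.liftCompιIso T hG.isZero_obj_left
  let ε' : Tl ⋙ L.kernel.ι ⟶ 𝟭 D :=
    { app := fun X => ε.app X
      naturality := fun _ _ f => ε.naturality f }
  let adj : L.kernel.ι ⊣ Tl := adjunctionOfBijectiveCounit L.kernel.fullyFaithfulι ε'
    (fun X Y => hG.bijective_comp_ε X.2 Y)
  let : Tl.CommShift ℤ := adj.rightAdjointCommShift ℤ
  have : adj.CommShift ℤ := adj.commShift_of_leftAdjoint ℤ
  have : Tl.IsTriangulated := adj.isTriangulated_rightAdjoint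
  let : T.CommShift ℤ := Functor.CommShift.ofIso e ℤ
  have : NatTrans.CommShift e.hom ℤ := Functor.CommShift.ofIso_compatibility e ℤ
  exact ⟨inferInstance, Functor.isTriangulated_of_iso e⟩

/-- The functor `H` is triangulated: it is the left adjoint of the inclusion of the kernel of `R`,
followed by this inclusion. -/
lemma exists_commShift_H (hG : HasGluingTriangles adjL adjR ε η) [i.CommShift ℤ]
    [R.CommShift ℤ] [R.IsTriangulated] [i.Full] [i.Faithful] :
    ∃ (_ : H.CommShift ℤ), H.IsTriangulated := by
  let Hl : D ⥤ R.kernel.FullSubcategory := R.kernel.lift H hG.isZero_obj_right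
  let e : Hl ⋙ R.kernel.ι ≅ H := R.kernel.liftCompιIso H hG.isZero_obj_right
  let η' : 𝟭 D ⟶ Hl ⋙ R.kernel.ι :=
    { app := fun X => η.app X
      naturality := fun _ _ f => η.naturality f }
  let adj : Hl ⊣ R.kernel.ι := adjunctionOfBijectiveUnit R.kernel.fullyFaithfulι η'
    (fun Y X => hG.bijective_η_comp Y.2 X)
  let : Hl.CommShift ℤ := adj.leftAdjointCommShift ℤ
  have : adj.CommShift ℤ := adj.commShift_of_rightAdjoint ℤ
  have : Hl.IsTriangulated := adj.isTriangulated_leftAdjoint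
  let : H.CommShift ℤ := Functor.CommShift.ofIso e ℤ
  have : NatTrans.CommShift e.hom ℤ := Functor.CommShift.ofIso_compatibility e ℤ
  exact ⟨inferInstance, Functor.isTriangulated_of_iso e⟩

lemma isIso_H_map_ε (hG : HasGluingTriangles adjL adjR ε η) [i.Full] [i.Faithful]
    [H.CommShift ℤ] [H.IsTriangulated] (X : D) : IsIso (H.map (ε.app X)) := by
  obtain ⟨h, hT⟩ := hG.exists_left X
  exact (Triangle.isZero₃_iff_isIso₁ _ (H.map_distinguished _ hT)).1 (hG.isZero_H_obj _)

lemma isIso_T_map_η (hG : HasGluingTriangles adjL adjR ε η) [i.Full] [i.Faithful]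
    [T.CommShift ℤ] [T.IsTriangulated] (X : D) : IsIso (T.map (η.app X)) := by
  obtain ⟨h, hT⟩ := hG.exists_right X
  exact (Triangle.isZero₁_iff_isIso₂ _ (T.map_distinguished _ hT)).1 (hG.isZero_T_obj _)

section Restriction

variable {PD : ObjectProperty D} {PZ : ObjectProperty Z} {Co Ctra : ObjectProperty D}

/-- Let `PD` be a condition on objects of `D`, and let `Co` and `Ctra` be the objects satisfying it
which lie in the kernels of `L` and of `R`. Then `H : Co ⥤ Ctra` and `T : Ctra ⥤ Co` are mutually
inverse: on the kernel of `L` the map `ε` is invertible, and `T` inverts `η`; dually for `H`. -/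
def equivalence (hG : HasGluingTriangles adjL adjR ε η)
    (hCo : ∀ X, Co X ↔ PD X ∧ IsZero (L.obj X)) (hCtra : ∀ X, Ctra X ↔ PD X ∧ IsZero (R.obj X))
    (hT : ∀ X, PD X → Co (T.obj X)) (hH : ∀ X, PD X → Ctra (H.obj X))
    [i.CommShift ℤ] [i.IsTriangulated] [i.Full] [i.Faithful]
    [H.CommShift ℤ] [H.IsTriangulated] [T.CommShift ℤ] [T.IsTriangulated] :
    Co.FullSubcategory ≌ Ctra.FullSubcategory :=
  have h1 : ∀ X : Co.FullSubcategory, IsIso (ε.app X.1) :=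
    fun X => hG.isIso_ε ((hCo _).1 X.2).2
  have h2 : ∀ X : Ctra.FullSubcategory, IsIso (η.app X.1) :=
    fun X => hG.isIso_η ((hCtra _).1 X.2).2
  have h3 := hG.isIso_H_map_ε
  have h4 := hG.isIso_T_map_η
  CategoryTheory.Equivalence.mk
    (restrictFunctor H Co Ctra (fun X hX => hH X ((hCo X).1 hX).1))
    (restrictFunctor T Ctra Co (fun X hX => hT X ((hCtra X).1 hX).1))
    (NatIso.ofComponents (fun X => Co.isoMk ((asIso (ε.app X.1)).symm ≪≫
      asIso (T.map (η.app X.1)))) (fun {X Y} f => by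
        ext
        have e1 := ε.naturality f.hom
        have e2 := η.naturality f.hom
        dsimp at e1 e2
        change f.hom ≫ inv (ε.app Y.1) ≫ T.map (η.app Y.1) =
          (inv (ε.app X.1) ≫ T.map (η.app X.1)) ≫ T.map (H.map f.hom)
        rw [Category.assoc, IsIso.eq_inv_comp, ← reassoc_of% e1, IsIso.hom_inv_id_assoc,
          ← T.map_comp, e2, T.map_comp]))
    (NatIso.ofComponents (fun X => Ctra.isoMk (asIso (H.map (ε.app X.1)) ≪≫
      (asIso (η.app X.1)).symm)) (fun {X Y} f => by
        ext
        have e1 := ε.naturality f.hom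
        have e2 := η.naturality f.hom
        dsimp at e1 e2
        change H.map (T.map f.hom) ≫ H.map (ε.app Y.1) ≫ inv (η.app Y.1) =
          (H.map (ε.app X.1) ≫ inv (η.app X.1)) ≫ f.hom
        rw [← Category.assoc, IsIso.comp_inv_eq, Category.assoc, Category.assoc, e2,
          IsIso.inv_hom_id_assoc, ← H.map_comp, e1, H.map_comp]))

variable (hCo : ∀ X, Co X ↔ PD X ∧ IsZero (L.obj X))
  (hCtra : ∀ X, Ctra X ↔ PD X ∧ IsZero (R.obj X))
  (hT : ∀ X, PD X → Co (T.obj X)) (hH : ∀ X, PD X → Ctra (H.obj X))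

/-- Functors with gluing triangles restrict to a recollement of the objects satisfying `PD`, with
open part the kernel `Co` of `L`. Since `R` and `L` have a fully faithful adjoint, as does `T`, they
are Verdier quotient functors. -/
theorem isRecollement (hG : HasGluingTriangles adjL adjR ε η)
    [i.CommShift ℤ] [i.IsTriangulated] [i.Full] [i.Faithful]
    [L.CommShift ℤ] [L.IsTriangulated] [R.CommShift ℤ] [R.IsTriangulated]
    [H.CommShift ℤ] [H.IsTriangulated] [T.CommShift ℤ] [T.IsTriangulated]
    [PD.IsTriangulated] [PZ.IsTriangulated] [Co.IsTriangulated] [Ctra.IsTriangulated]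
    (hi : ∀ Y, PZ Y → PD (i.obj Y)) (hL : ∀ X, PD X → PZ (L.obj X))
    (hR : ∀ X, PD X → PZ (R.obj X)) :
    IsRecollement (restrictFunctor L PD PZ hL) (restrictFunctor i PZ PD hi)
      (restrictFunctor R PD PZ hR) (inclusionFunctor Co PD (fun X hX => ((hCo X).1 hX).1))
      (restrictFunctor T PD Co hT)
      (restrictFunctor H Co Ctra (fun X hX => hH X ((hCo X).1 hX).1) ⋙
        inclusionFunctor Ctra PD (fun X hX => ((hCtra X).1 hX).1)) := by
  let iL := restrictFunctor L PD PZ hL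
  let i' := restrictFunctor i PZ PD hi
  let iR := restrictFunctor R PD PZ hR
  let jL := inclusionFunctor Co PD (fun X hX => ((hCo X).1 hX).1)
  let j := restrictFunctor T PD Co hT
  let H' := restrictFunctor H Co Ctra (fun X hX => hH X ((hCo X).1 hX).1)
  let k := inclusionFunctor Ctra PD (fun X hX => ((hCtra X).1 hX).1)
  let e := hG.equivalence hCo hCtra hT hH
  have : H'.IsEquivalence := inferInstanceAs e.functor.IsEquivalence
  have adj₁ : iL ⊣ i' := adjL.restrictFullyFaithful PD.fullyFaithfulι PZ.fullyFaithfulι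
    (Iso.refl _) (Iso.refl _)
  have adj₂ : i' ⊣ iR := adjR.restrictFullyFaithful PZ.fullyFaithfulι PD.fullyFaithfulι
    (Iso.refl _) (Iso.refl _)
  have adj₃ : jL ⊣ j := adjunctionOfBijectiveCounit (.ofFullyFaithful _)
    { app X := ObjectProperty.homMk (ε.app X.1)
      naturality X Y g := by ext; exact ε.naturality g.hom } (fun X Y => by
        have hb := hG.bijective_comp_ε ((hCo _).1 X.2).2 Y.1
        refine ⟨fun g g' h => ?_, fun g => ?_⟩
        · ext
          exact hb.1 (congrArg (fun t => t.hom) h)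
        · obtain ⟨t, ht⟩ := hb.2 g.hom
          exact ⟨ObjectProperty.homMk t, by ext; exact ht⟩)
  have hε := hG.isIso_H_map_ε
  have adj₄ : j ⊣ H' ⋙ k := adjunctionOfBijectiveUnit (.ofFullyFaithful _)
    -- the unit is the composite of `X ⟶ H X` with the inverse of `H (T X) ⟶ H X`
    { app X := ObjectProperty.homMk (η.app X.1 ≫ inv (H.map (ε.app X.1)))
      naturality X Y g := by
        ext
        have e1 := ε.naturality g.hom
        have e2 := η.naturality g.hom
        dsimp at e1 e2
        change g.hom ≫ η.app Y.1 ≫ inv (H.map (ε.app Y.1)) =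
          (η.app X.1 ≫ inv (H.map (ε.app X.1))) ≫ H.map (T.map g.hom)
        rw [Category.assoc, reassoc_of% e2]
        congr 1
        rw [IsIso.eq_inv_comp, ← Category.assoc, IsIso.comp_inv_eq, ← H.map_comp, ← H.map_comp,
          e1] } (fun X Y => by
        have hb := hG.bijective_η_comp ((hCtra _).1 (hH _ ((hCo _).1 X.2).1)).2 Y.1
        refine ⟨fun g g' h => ?_, fun g => ?_⟩
        · have h1 : (η.app Y.1 ≫ inv (H.map (ε.app Y.1))) ≫ g.hom =
              (η.app Y.1 ≫ inv (H.map (ε.app Y.1))) ≫ g'.hom := congrArg (fun t => t.hom) h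
          rw [Category.assoc, Category.assoc] at h1
          ext
          exact (cancel_epi (inv (H.map (ε.app Y.1)))).1 (hb.1 h1)
        · obtain ⟨t, ht⟩ := hb.2 g.hom
          refine ⟨ObjectProperty.homMk (H.map (ε.app Y.1) ≫ t), ?_⟩
          ext
          change (η.app Y.1 ≫ inv (H.map (ε.app Y.1))) ≫ H.map (ε.app Y.1) ≫ t = g.hom
          rw [Category.assoc, IsIso.inv_hom_id_assoc]
          exact ht)
  have : i'.Full := inferInstance
  have : i'.Faithful := inferInstance
  have : (H' ⋙ k).Full := inferInstance
  have : (H' ⋙ k).Faithful := inferInstance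
  exact
    { isTriangulated_iL := inferInstance
      isTriangulated_i := inferInstance
      isTriangulated_iR := inferInstance
      isTriangulated_jL := inferInstance
      isTriangulated_j := inferInstance
      isTriangulated_jR := inferInstance
      adj_iL_i := ⟨adj₁⟩
      adj_i_iR := ⟨adj₂⟩
      adj_jL_j := ⟨adj₃⟩
      adj_j_jR := ⟨adj₄⟩
      full_i := inferInstance
      faithful_i := inferInstance
      full_jL := inferInstance
      faithful_jL := inferInstance
      full_jR := inferInstance
      faithful_jR := inferInstance
      kernel_j := by
        ext X
        refine ⟨fun hX => ?_, ?_⟩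
        · have hX' := (hG.isZero_T_iff X.1).1 ((isZero_fullSubcategory_iff _ _).1 hX)
          exact ⟨iL.obj X, ⟨PD.isoMk (asIso (adjL.unit.app X.1)).symm⟩⟩
        · rintro ⟨Y, ⟨e⟩⟩
          exact (isZero_fullSubcategory_iff _ _).2
            ((hG.isZero_T_obj Y.1).of_iso (T.mapIso (PD.ι.mapIso e.symm)))
      kernel_iL := by
        ext X
        refine ⟨fun hX => ?_, ?_⟩
        · exact ⟨⟨X.1, (hCo _).2 ⟨X.2, (isZero_fullSubcategory_iff _ _).1 hX⟩⟩, ⟨Iso.refl _⟩⟩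
        · rintro ⟨Y, ⟨e⟩⟩
          exact (isZero_fullSubcategory_iff _ _).2
            (((hCo _).1 Y.2).2.of_iso (L.mapIso (PD.ι.mapIso e.symm)))
      kernel_iR := by
        ext X
        refine ⟨fun hX => ?_, ?_⟩
        · let X' : Ctra.FullSubcategory :=
            ⟨X.1, (hCtra _).2 ⟨X.2, (isZero_fullSubcategory_iff _ _).1 hX⟩⟩
          -- `H` restricts to an equivalence onto `Ctra`, so every object of `Ctra` is in the image
          exact ⟨H'.objPreimage X', ⟨k.mapIso (H'.objObjPreimageIso X')⟩⟩
        · rintro ⟨Y, ⟨e⟩⟩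
          exact (isZero_fullSubcategory_iff _ _).2 (((hCtra _).1 (hH _ ((hCo _).1 Y.2).1)).2.of_iso
            (R.mapIso (PD.ι.mapIso e.symm)))
      isLocalization_j := by
        rw [kernel_trW_eq]
        exact adj₄.isLocalization
      isLocalization_iL := by
        rw [kernel_trW_eq]
        exact adj₁.isLocalization
      isLocalization_iR := by
        rw [kernel_trW_eq]
        exact adj₂.isLocalization' }

end Restriction

end HasGluingTriangles

end Triangulated

end

/-! ### Objects acyclic for a right exact functor -/

section LeftAcyclic

set_option linter.unusedSectionVars false

variable {A B : Type*} [Category* A] [Category* B] [Abelian A] [Abelian B]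

/-- An object `M` is acyclic for a right exact functor `F` if `F` preserves the exactness of every
short exact sequence ending in `M`. -/
def LeftAcyclic (F : A ⥤ B) : ObjectProperty A := fun M =>
  ∀ ⦃N E : A⦄ (i : N ⟶ E) (p : E ⟶ M) (w : i ≫ p = 0),
    (ShortComplex.mk i p w).ShortExact → Mono (F.map i)

lemma exact_mk_iff {X Y Z : A} {f : X ⟶ Y} {g : Y ⟶ Z} (w : f ≫ g = 0) :
    (ShortComplex.mk f g w).Exact ↔ ∀ ⦃T : A⦄ (x : T ⟶ Y), x ≫ g = 0 →
      ∃ (T' : A) (π : T' ⟶ T) (_ : Epi π) (y : T' ⟶ X), π ≫ x = y ≫ f :=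
  ShortComplex.exact_iff_exact_up_to_refinements _

lemma shortExact_kernel_ι {P M : A} (q : P ⟶ M) [Epi q] :
    (ShortComplex.mk _ _ (kernel.condition q)).ShortExact :=
  { exact := ShortComplex.exact_kernel q }

lemma exists_shortExact_pullback {N E M M' : A} {i : N ⟶ E} {p : E ⟶ M} {w : i ≫ p = 0}
    (h : (ShortComplex.mk i p w).ShortExact) (g : M' ⟶ M) :
    ∃ (i' : N ⟶ pullback p g) (w' : i' ≫ pullback.snd p g = 0),
      i' ≫ pullback.fst p g = i ∧ (ShortComplex.mk i' (pullback.snd p g) w').ShortExact := by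
  have hi := h.mono_f
  have hp := h.epi_g
  dsimp at hi hp
  have e : pullback.lift i 0 (by simp [w]) ≫ pullback.fst p g = i := pullback.lift_fst _ _ _
  refine ⟨pullback.lift i 0 (by simp [w]), pullback.lift_snd _ _ _, e, ?_⟩
  have : Mono (pullback.lift i 0 (by simp [w]) : N ⟶ pullback p g) :=
    mono_of_mono_fac e
  refine { exact := ShortComplex.exact_of_f_is_kernel _ (KernelFork.IsLimit.ofι' _ _
    fun {T} k hk => ⟨h.exact.lift (k ≫ pullback.fst p g) ?_, ?_⟩) }
  · dsimp at hk ⊢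
    rw [Category.assoc, pullback.condition, reassoc_of% hk, zero_comp]
  · dsimp at hk ⊢
    apply pullback.hom_ext
    · rw [Category.assoc, e]
      exact h.exact.lift_f _ _
    · refine (Category.assoc _ _ _).trans (Eq.trans ?_ hk.symm)
      rw [pullback.lift_snd, comp_zero]

lemma exists_shortExact_pullback' {N E M M' : A} {i : N ⟶ M'} {p : E ⟶ M} {q : M' ⟶ M}
    {w : i ≫ q = 0} (h : (ShortComplex.mk i q w).ShortExact) [Epi p] :
    ∃ (i' : N ⟶ pullback p q) (w' : i' ≫ pullback.fst p q = 0),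
      i' ≫ pullback.snd p q = i ∧ (ShortComplex.mk i' (pullback.fst p q) w').ShortExact := by
  have hi := h.mono_f
  have hp := h.epi_g
  dsimp at hi hp
  have e : pullback.lift 0 i (by simp [w]) ≫ pullback.snd p q = i := pullback.lift_snd _ _ _
  refine ⟨pullback.lift 0 i (by simp [w]), pullback.lift_fst _ _ _, e, ?_⟩
  have : Mono (pullback.lift 0 i (by simp [w]) : N ⟶ pullback p q) :=
    mono_of_mono_fac e
  refine { exact := ShortComplex.exact_of_f_is_kernel _ (KernelFork.IsLimit.ofι' _ _
    fun {T} k hk => ⟨h.exact.lift (k ≫ pullback.snd p q) ?_, ?_⟩) }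
  · dsimp at hk ⊢
    rw [Category.assoc, ← pullback.condition, reassoc_of% hk, zero_comp]
  · dsimp at hk ⊢
    apply pullback.hom_ext
    · refine (Category.assoc _ _ _).trans (Eq.trans ?_ hk.symm)
      rw [pullback.lift_fst, comp_zero]
    · rw [Category.assoc, e]
      exact h.exact.lift_f _ _

variable (F : A ⥤ B)

section

variable {F}

lemma LeftAcyclic.of_retract {M M' : A} (h : Retract M M') (hM' : LeftAcyclic F M') :
    LeftAcyclic F M := by
  intro N E i p w hS
  obtain ⟨i', w', fac, hS'⟩ := exists_shortExact_pullback hS h.r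
  have := hM' _ _ _ hS'
  obtain ⟨l, hl₁, hl₂⟩ : ∃ l : E ⟶ pullback p h.r,
      l ≫ pullback.fst p h.r = 𝟙 E ∧ l ≫ pullback.snd p h.r = p ≫ h.i :=
    ⟨pullback.lift (𝟙 E) (p ≫ h.i) (by simp), pullback.lift_fst _ _ _, pullback.lift_snd _ _ _⟩
  have e : i ≫ l = i' := by
    apply pullback.hom_ext
    · rw [Category.assoc, hl₁, Category.comp_id, fac]
    · rw [Category.assoc, hl₂, w', reassoc_of% w, zero_comp]
  rw [← e, F.map_comp] at this
  exact mono_of_mono _ (F.map l)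

lemma LeftAcyclic.of_iso {M M' : A} (e : M ≅ M') (hM' : LeftAcyclic F M') : LeftAcyclic F M :=
  hM'.of_retract e.retract

lemma LeftAcyclic.of_projective (P : A) [Projective P] : LeftAcyclic F P := by
  intro N E i p w hS
  have : Mono i := hS.mono_f
  have : Epi p := hS.epi_g
  have : IsSplitMono i := ⟨⟨(hS.splittingOfProjective).splitMono_f⟩⟩
  infer_instance

lemma LeftAcyclic.of_extension {M' M M'' : A} {a : M' ⟶ M} {b : M ⟶ M''} {w : a ≫ b = 0}
    (h : (ShortComplex.mk a b w).ShortExact) (h' : LeftAcyclic F M') (h'' : LeftAcyclic F M'') :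
    LeftAcyclic F M := by
  intro N E i p wp hS
  have : Epi p := hS.epi_g
  have : Epi b := h.epi_g
  obtain ⟨i', w', fac, hS'⟩ := exists_shortExact_pullback hS a
  have h1 := h' _ _ _ hS'
  have h2 : (ShortComplex.mk (pullback.fst p a) (p ≫ b)
      (by rw [pullback.condition_assoc, w, comp_zero])).ShortExact := by
    have : Mono a := h.mono_f
    refine { exact := ShortComplex.exact_of_f_is_kernel _ (KernelFork.IsLimit.ofι' _ _
      fun {T} k hk => ⟨pullback.lift k (h.exact.lift (k ≫ p) ?_) ?_, pullback.lift_fst _ _ _⟩) }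
    · exact (Category.assoc _ _ _).trans hk
    · exact (h.exact.lift_f _ _).symm
  have h3 := h'' _ _ _ h2
  rw [← fac, F.map_comp]
  exact mono_comp _ _

variable [F.Additive] [PreservesFiniteColimits F]

lemma exact_and_epi_map {X Y Z : A} {f : X ⟶ Y} {g : Y ⟶ Z} {w : f ≫ g = 0}
    (h : (ShortComplex.mk f g w).Exact) [Epi g] :
    (ShortComplex.mk (F.map f) (F.map g) (by rw [← F.map_comp, w, F.map_zero])).Exact ∧
      Epi (F.map g) :=
  have hF : ∀ S : ShortComplex A, S.Exact ∧ Epi S.g → (S.map F).Exact ∧ Epi (F.map S.g) :=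
    ((Functor.preservesFiniteColimits_tfae F).out 3 1).1 ‹PreservesFiniteColimits F›
  hF _ ⟨h, ‹Epi g›⟩

/-- A quotient `P/K` of an acyclic object is acyclic once `F` keeps the inclusion of `K` monic. This
is where the diagram chase comparing two presentations of an object takes place. -/
lemma LeftAcyclic.of_mono {K P M : A} {k : K ⟶ P} {q : P ⟶ M} {w : k ≫ q = 0}
    (h : (ShortComplex.mk k q w).ShortExact) (hP : LeftAcyclic F P) [Mono (F.map k)] :
    LeftAcyclic F M := by
  intro N E i p wp hS
  have : Epi p := hS.epi_g
  obtain ⟨i', w', fac, hS'⟩ := exists_shortExact_pullback hS q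
  obtain ⟨k', w'', fac', hK⟩ := exists_shortExact_pullback' (p := p) h
  have := hP _ _ _ hS'
  have hE : Epi (pullback.fst p q) := hK.epi_g
  have hex := (exact_mk_iff _).1 (exact_and_epi_map (F := F) hK.exact).1
  refine Preadditive.mono_of_cancel_zero _ fun {T} x hx => ?_
  rw [← fac, F.map_comp, ← Category.assoc] at hx
  obtain ⟨T', π, hπ, z, hz⟩ := hex _ hx
  have hz0 : z = 0 := by
    rw [← cancel_mono (F.map k), ← fac', F.map_comp, ← reassoc_of% hz, ← F.map_comp, w',
      F.map_zero, comp_zero, comp_zero, zero_comp]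
  rw [hz0, zero_comp] at hz
  rw [← cancel_epi π, ← cancel_mono (F.map i'), Category.assoc, hz, comp_zero, zero_comp]

/-- Let `X ⟶ Y ⟶ Z` be exact with the second map factoring through its image `K`. Then `F`
preserves the exactness if and only if it keeps `K ⟶ Z` monic. -/
lemma exact_map_iff_mono {X Y Z K : A} {f : X ⟶ Y} {g : Y ⟶ Z} {w : f ≫ g = 0}
    (hS : (ShortComplex.mk f g w).Exact) (e : Y ⟶ K) (m : K ⟶ Z) [Epi e] [Mono m]
    (fac : e ≫ m = g) :
    (ShortComplex.mk (F.map f) (F.map g) (by rw [← F.map_comp, w, F.map_zero])).Exact ↔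
      Mono (F.map m) := by
  have he : f ≫ e = 0 := by rw [← cancel_mono m, Category.assoc, fac, w, zero_comp]
  have hS' : (ShortComplex.mk f e he).Exact := by
    rw [exact_mk_iff] at hS ⊢
    intro T x hx
    exact hS x (by rw [← fac, reassoc_of% hx, zero_comp])
  obtain ⟨h1, h2⟩ := exact_and_epi_map (F := F) hS'
  rw [exact_mk_iff] at h1 ⊢
  constructor
  · intro h
    refine Preadditive.mono_of_cancel_zero _ fun {T} x hx => ?_
    obtain ⟨T', π, hπ, y, hy⟩ := surjective_up_to_refinements_of_epi (F.map e) x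
    obtain ⟨T'', π', hπ', z, hz⟩ := h y (by
      rw [← fac, F.map_comp, ← reassoc_of% hy, hx, comp_zero])
    rw [← cancel_epi π, ← cancel_epi π', hy, reassoc_of% hz, ← F.map_comp, he, F.map_zero]
    simp
  · intro h T x hx
    refine h1 x ?_
    rw [← cancel_mono (F.map m), Category.assoc, ← F.map_comp, fac, hx, zero_comp]

variable [HasProjectiveResolutions A]

lemma isZero_leftDerived_iff {M : A} (P : ProjectiveResolution M) (n : ℕ) :
    IsZero ((F.leftDerived (n + 1)).obj M) ↔
      (ShortComplex.mk (F.map (P.complex.d (n + 2) (n + 1))) (F.map (P.complex.d (n + 1) n))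
        (by rw [← F.map_comp, P.complex.d_comp_d, F.map_zero])).Exact := by
  rw [(P.isoLeftDerivedObj F (n + 1)).isZero_iff]
  refine (HomologicalComplex.exactAt_iff_isZero_homology _ _).symm.trans ?_
  exact HomologicalComplex.exactAt_iff' _ (n + 2) (n + 1) n (by simp) (by simp)

/-- Acyclic objects are those at which the first left derived functor vanishes. -/
lemma isZero_leftDerived_one_iff (M : A) :
    IsZero ((F.leftDerived 1).obj M) ↔ LeftAcyclic F M := by
  let P := projectiveResolution M
  have hS : (ShortComplex.mk _ _ (P.complex.d_comp_d 2 1 0)).Exact := P.exact_succ 0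
  have hP : (ShortComplex.mk _ _ P.complex_d_comp_π_f_zero).Exact := P.exact₀
  have : Epi (kernel.lift (P.π.f 0) (P.complex.d 1 0) P.complex_d_comp_π_f_zero) :=
    hP.epi_kernelLift
  have hK := shortExact_kernel_ι (P.π.f 0)
  rw [isZero_leftDerived_iff P 0, exact_map_iff_mono hS
    (kernel.lift (P.π.f 0) (P.complex.d 1 0) P.complex_d_comp_π_f_zero) (kernel.ι (P.π.f 0))
    (kernel.lift_ι _ _ _)]
  exact ⟨fun _ => LeftAcyclic.of_mono hK (LeftAcyclic.of_projective _), fun h => h _ _ _ hK⟩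

/-- If the second left derived functor vanishes at `C`, the first syzygy of `C` is acyclic. -/
lemma exists_acyclic_syzygy {C : A} (h : IsZero ((F.leftDerived 2).obj C)) :
    ∃ (K P : A) (k : K ⟶ P) (q : P ⟶ C) (w : k ≫ q = 0), Projective P ∧
      (ShortComplex.mk k q w).ShortExact ∧ LeftAcyclic F K := by
  let P := projectiveResolution C
  have hπ : Epi (P.π.f 0) := inferInstance
  change Epi (Y := C) (P.π.f 0) at hπ
  refine ⟨_, _, _, P.π.f 0, kernel.condition _, inferInstance, shortExact_kernel_ι _, ?_⟩
  have hS : (ShortComplex.mk _ _ (P.complex.d_comp_d 3 2 1)).Exact := P.exact_succ 1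
  have hS' : (ShortComplex.mk _ _ (P.complex.d_comp_d 2 1 0)).Exact := P.exact_succ 0
  have hP : (ShortComplex.mk _ _ P.complex_d_comp_π_f_zero).Exact := P.exact₀
  let q := kernel.lift (P.π.f 0) (P.complex.d 1 0) P.complex_d_comp_π_f_zero
  have : Epi q := hP.epi_kernelLift
  have hq : q ≫ kernel.ι _ = P.complex.d 1 0 := kernel.lift_ι _ _ _
  have hdq : P.complex.d 2 1 ≫ q = 0 := by
    rw [← cancel_mono (kernel.ι (P.π.f 0)), Category.assoc, hq, P.complex.d_comp_d, zero_comp]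
  have hS'' : (ShortComplex.mk _ _ hdq).Exact := by
    rw [exact_mk_iff] at hS' ⊢
    intro T x hx
    exact hS' x (by rw [← hq, reassoc_of% hx, zero_comp])
  have : Epi (kernel.lift q (P.complex.d 2 1) hdq) := hS''.epi_kernelLift
  rw [isZero_leftDerived_iff P 1, exact_map_iff_mono hS (kernel.lift q (P.complex.d 2 1) hdq)
    (kernel.ι q) (kernel.lift_ι _ _ _)] at h
  exact LeftAcyclic.of_mono (shortExact_kernel_ι q) (LeftAcyclic.of_projective _)

/-- If the second left derived functor vanishes, subobjects of acyclic objects are acyclic. The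
pullback of `M' ⟶ M'/M` along a projective presentation of `M'/M` with acyclic kernel is an
extension of `M'` by an acyclic object, and it contains `M` as a direct summand. -/
lemma LeftAcyclic.of_subobject (hF : ∀ C : A, IsZero ((F.leftDerived 2).obj C)) {M M' : A}
    (hM' : LeftAcyclic F M') (m : M ⟶ M') [Mono m] : LeftAcyclic F M := by
  obtain ⟨K, P, k, q, w, hP, hK, hK'⟩ := exists_acyclic_syzygy (hF (cokernel m))
  have hm : (ShortComplex.mk m (cokernel.π m) (cokernel.condition m)).ShortExact :=
    { exact := ShortComplex.exact_cokernel m }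
  have : Epi q := hK.epi_g
  obtain ⟨i', w', -, h1⟩ := exists_shortExact_pullback' (p := cokernel.π m) hK
  obtain ⟨j, w'', -, h2⟩ := exists_shortExact_pullback hm q
  have hE : LeftAcyclic F (pullback (cokernel.π m) q) := LeftAcyclic.of_extension h1 hK' hM'
  have s : (ShortComplex.mk j _ w'').Splitting := h2.splittingOfProjective
  exact hE.of_retract ⟨j, s.r, s.f_r⟩

end

end LeftAcyclic

/-! ### Extension of scalars along a homological epimorphism -/

section ExtendScalars

set_option linter.unusedSectionVars false

variable {R U : Type u} [Ring R] [Ring U] (f : R →+* U)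

/-- The class of `x ⊗ n` in `U ⊗_R N`. -/
def extMk {N : ModuleCat.{u} R} (x : U) (n : N) : (extendScalars f).obj N :=
  tensorMk (M := bimodOf (RingHom.id U) f) x n

variable {f}

lemma extMk_add_left {N : ModuleCat.{u} R} (x y : U) (n : N) :
    extMk f (x + y) n = extMk f x n + extMk f y n :=
  tensorMk_add_left (M := bimodOf (RingHom.id U) f) x y n

lemma extMk_add_right {N : ModuleCat.{u} R} (x : U) (n n' : N) :
    extMk f x (n + n') = extMk f x n + extMk f x n' :=
  tensorMk_add_right (M := bimodOf (RingHom.id U) f) x n n'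

lemma extMk_mul {N : ModuleCat.{u} R} (x : U) (r : R) (n : N) :
    extMk f (x * f r) n = extMk f x (r • n) := by
  refine Eq.trans ?_ (tensorMk_balanced (M := bimodOf (RingHom.id U) f) x r n)
  change extMk f (x * f r) n = extMk f (1 * (x * f r)) n
  rw [one_mul]

lemma smul_extMk {N : ModuleCat.{u} R} (y x : U) (n : N) :
    y • extMk f x n = extMk f (y * x) n := by
  change extMk f (y * (x * f 1)) n = extMk f (y * x) n
  rw [map_one, mul_one]

lemma map_extMk {N N' : ModuleCat.{u} R} (g : N ⟶ N') (x : U) (n : N) :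
    ((extendScalars f).map g).hom (extMk f x n) = extMk f x (g.hom n) := rfl

lemma extendScalars_hom_ext {N : ModuleCat.{u} R} {P : ModuleCat.{u} U}
    {g h : (extendScalars f).obj N ⟶ P} (H : ∀ n, g.hom (extMk f 1 n) = h.hom (extMk f 1 n)) :
    g = h := by
  refine tensorObj_hom_ext fun x n => ?_
  have hx : tensorMk (M := bimodOf (RingHom.id U) f) x n = (show U from x) • extMk f 1 n := by
    rw [smul_extMk, mul_one]
    rfl
  rw [hx]
  refine (g.hom.map_smul (show U from x) _).trans
    (Eq.trans ?_ (h.hom.map_smul (show U from x) _).symm)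
  rw [H]

lemma extendScalars_induction {N : ModuleCat.{u} R} {p : (extendScalars f).obj N → Prop}
    (h0 : p 0) (hadd : ∀ a b, p a → p b → p (a + b)) (hmk : ∀ x n, p (extMk f x n)) (t) : p t := by
  obtain ⟨t, rfl⟩ := Submodule.Quotient.mk_surjective _ t
  induction t with
  | zero => exact h0
  | tmul x n => exact hmk x n
  | add a b ha hb => exact hadd _ _ ha hb

variable (f)

/-- The unit `n ↦ 1 ⊗ n` of the extension of scalars. -/
def extUnit (N : ModuleCat.{u} R) :
    N ⟶ (ModuleCat.restrictScalars f).obj ((extendScalars f).obj N) :=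
  ModuleCat.ofHom (Y := (ModuleCat.restrictScalars f).obj ((extendScalars f).obj N))
    { toFun := fun n => extMk f 1 n
      map_add' := fun n n' => extMk_add_right 1 n n'
      map_smul' := fun r n => by
        refine (extMk_mul 1 r n).symm.trans ?_
        refine Eq.trans ?_ (smul_extMk (f r) 1 n).symm
        rw [one_mul, mul_one] }

/-- The counit `x ⊗ p ↦ x • p` of the extension of scalars. -/
def extCounit (P : ModuleCat.{u} U) :
    (extendScalars f).obj ((ModuleCat.restrictScalars f).obj P) ⟶ P :=
  ModuleCat.ofHom (Submodule.liftQ _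
    (TensorProduct.AlgebraTensorModule.lift (R := ℤ) (A := U)
      (M := (leftPart U R).obj (bimodOf (RingHom.id U) f))
      (N := (ModuleCat.restrictScalars f).obj P) (P := P)
      { toFun := fun (x : U) => AddMonoidHom.toIntLinearMap
          (M := (ModuleCat.restrictScalars f).obj P) (DistribSMul.toAddMonoidHom P x)
        map_add' := fun x y => by
          ext z
          exact add_smul (show U from x) (show U from y) (show P from z)
        map_smul' := fun a x => by
          ext z
          change (a * ((show U from x) * f 1)) • (show P from z) =
            a • ((show U from x) • (show P from z))
          rw [map_one, mul_one, mul_smul] }) (by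
    refine Submodule.span_le.2 ?_
    rintro _ ⟨x, r, y, rfl⟩
    rw [SetLike.mem_coe, LinearMap.mem_ker, map_sub, sub_eq_zero]
    change (1 * ((show U from x) * f r)) • (show P from y) =
      (show U from x) • (f r • (show P from y))
    rw [one_mul, mul_smul]))

lemma extCounit_mk (P : ModuleCat.{u} U) (x : U) (p : P) :
    (extCounit f P).hom (extMk f (N := (ModuleCat.restrictScalars f).obj P) x p) = x • p := rfl

lemma extCounit_naturality {P P' : ModuleCat.{u} U} (g : P ⟶ P') :
    (extendScalars f).map ((ModuleCat.restrictScalars f).map g) ≫ extCounit f P' =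
      extCounit f P ≫ g := by
  refine extendScalars_hom_ext fun n => ?_
  rw [ModuleCat.hom_comp, ModuleCat.hom_comp, LinearMap.comp_apply, LinearMap.comp_apply,
    map_extMk]
  refine (extCounit_mk f P' 1 (g.hom n)).trans
    (Eq.trans ?_ (congrArg g.hom (extCounit_mk f P 1 n)).symm)
  exact (g.hom.map_smul 1 (show P from n)).symm

lemma extUnit_extCounit (P : ModuleCat.{u} U) :
    extUnit f ((ModuleCat.restrictScalars f).obj P) ≫
      (ModuleCat.restrictScalars f).map (extCounit f P) = 𝟙 _ := by
  ext p
  exact one_smul U (show P from p)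

lemma map_extUnit_extCounit (N : ModuleCat.{u} R) :
    (extendScalars f).map (extUnit f N) ≫ extCounit f ((extendScalars f).obj N) = 𝟙 _ := by
  refine extendScalars_hom_ext fun n => ?_
  rw [ModuleCat.hom_comp, LinearMap.comp_apply, map_extMk]
  refine (extCounit_mk f _ 1 (extMk f 1 n)).trans ?_
  rw [one_smul]
  rfl

/-- The adjunction between extension and restriction of scalars. -/
def extendRestrictAdj : extendScalars f ⊣ ModuleCat.restrictScalars.{u} f :=
  Adjunction.mkOfUnitCounit
    { unit := { app := extUnit f, naturality := fun _ _ _ => rfl }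
      counit := { app := extCounit f, naturality := fun _ _ g => extCounit_naturality f g }
      left_triangle := by
        ext N : 2
        exact (congrArg _ (Category.id_comp _)).trans (map_extUnit_extCounit f N)
      right_triangle := by
        ext P : 2
        exact (congrArg _ (Category.id_comp _)).trans (extUnit_extCounit f P) }

instance : (extendScalars f).IsLeftAdjoint := (extendRestrictAdj f).isLeftAdjoint

variable {f}

/-- For a homological epimorphism `R → U`, the counit `U ⊗_R P → P` is an isomorphism. -/
lemma IsHomologicalEpi.isIso_extCounit (hf : IsHomologicalEpi f) (P : ModuleCat.{u} U) :
    IsIso (extCounit f P) := by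
  let P' := (ModuleCat.restrictScalars f).obj P
  -- injectivity of the multiplication `U ⊗_R U → U` gives `x ⊗ 1 = 1 ⊗ x`
  have key : ∀ (x : U) (p : P), extMk f (N := P') x p = extMk f (N := P') 1 (x • p : P) := by
    intro x p
    have h1 : extMk f (N := leftModU f) x (1 : U) = extMk f (N := leftModU f) 1 x := by
      apply hf.bijective_mul.1
      refine (mulMap_mk f x 1).trans (Eq.trans ?_ (mulMap_mk f 1 x).symm)
      rw [mul_one, one_mul]
    let φ : ModuleCat.of U U ⟶ P := ModuleCat.ofHom (LinearMap.toSpanSingleton U P p)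
    have h2 := congrArg ((extendScalars f).map ((ModuleCat.restrictScalars f).map φ)).hom h1
    have h3 : extMk f (N := P') x ((1 : U) • p : P) = extMk f (N := P') 1 (x • p : P) := h2
    rwa [one_smul] at h3
  have key' : ∀ t, t = extMk f (N := P') 1 ((extCounit f P).hom t : P) := by
    intro t
    induction t using extendScalars_induction with
    | h0 =>
      rw [map_zero]
      have h0 : extMk f (N := P') 1 0 = 0 := by
        simpa using extMk_add_right (f := f) (N := P') 1 0 0
      exact h0.symm
    | hadd a b ha hb =>
      conv_lhs => rw [ha, hb]
      rw [map_add]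
      exact (extMk_add_right (f := f) (N := P') 1 _ _).symm
    | hmk x n => exact key x n
  refine (ConcreteCategory.isIso_iff_bijective (extCounit f P)).2 ⟨fun a b h => ?_, fun p => ?_⟩
  · rw [key' a, key' b]
    exact congrArg (fun t : P => extMk f (N := P') 1 t) h
  · exact ⟨extMk f (N := P') 1 p, one_smul U p⟩

/-- The functor `M ↦ M^{(J)}`. -/
def copower (R : Type u) [Ring R] (J : Type u) : ModuleCat.{u} R ⥤ ModuleCat.{u} R :=
  Functor.const (Discrete J) ⋙ colim

instance (J : Type u) : (copower R J).IsLeftAdjoint := by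
  have := (constLimAdj (J := Discrete J) (C := ModuleCat.{u} R)).isLeftAdjoint
  have := (colimConstAdj (J := Discrete J) (C := ModuleCat.{u} R)).isLeftAdjoint
  exact Functor.isLeftAdjoint_comp (Functor.const (Discrete J) : ModuleCat.{u} R ⥤ _) colim

instance (J : Type u) : PreservesFiniteLimits (copower R J) := by
  have := (colimConstAdj (J := Discrete J) (C := ModuleCat.{u} R)).isRightAdjoint
  have : PreservesFiniteLimits (Functor.const (Discrete J) : ModuleCat.{u} R ⥤ _) :=
    PreservesLimitsOfSize.preservesFiniteLimits.{0, 0} _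
  exact comp_preservesFiniteLimits _ _

instance (J : Type u) : PreservesFiniteColimits (copower R J) :=
  PreservesColimitsOfSize.preservesFiniteColimits.{0, 0} _

instance (J : Type u) : (copower R J).PreservesZeroMorphisms :=
  Functor.preservesZeroMorphisms_of_isLeftAdjoint _

/-- The inclusion of a summand in a copower. -/
def copowerι (J : Type u) (M : ModuleCat.{u} R) (j : J) : M ⟶ (copower R J).obj M :=
  colimit.ι ((Functor.const (Discrete J)).obj M) ⟨j⟩

/-- The morphism from a copower given by a family of morphisms. -/
def copowerDesc {J : Type u} {M N : ModuleCat.{u} R} (φ : J → (M ⟶ N)) :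
    (copower R J).obj M ⟶ N :=
  colimit.desc ((Functor.const (Discrete J)).obj M)
    { pt := N, ι := Discrete.natTrans fun j => φ j.as }

lemma copowerι_desc {J : Type u} {M N : ModuleCat.{u} R} (φ : J → (M ⟶ N)) (j : J) :
    copowerι J M j ≫ copowerDesc φ = φ j :=
  colimit.ι_desc _ _

lemma copower_hom_ext {J : Type u} {M N : ModuleCat.{u} R} {a b : (copower R J).obj M ⟶ N}
    (h : ∀ j, copowerι J M j ≫ a = copowerι J M j ≫ b) : a = b :=
  colimit.hom_ext fun j => h j.as

instance (J : Type u) (P : ModuleCat.{u} R) [Projective P] : Projective ((copower R J).obj P) where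
  factors g e _ := ⟨copowerDesc fun j => Projective.factorThru (copowerι J P j ≫ g) e,
    copower_hom_ext fun j => by
      rw [← Category.assoc, copowerι_desc, Projective.factorThru_comp]⟩

/-- A left adjoint functor commutes with copowers. -/
def copowerCompIso (G : ModuleCat.{u} R ⥤ ModuleCat.{u} U) [G.IsLeftAdjoint] (J : Type u) :
    copower R J ⋙ G ≅ G ⋙ copower U J :=
  let e : Functor.const (Discrete J) ⋙ (Functor.whiskeringRight _ _ _).obj G ≅
      G ⋙ Functor.const (Discrete J) :=
    NatIso.ofComponents fun M => NatIso.ofComponents fun _ => Iso.refl _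
  Functor.isoWhiskerLeft (Functor.const _) (preservesColimitNatIso (J := Discrete J) G) ≪≫
    Functor.isoWhiskerRight e colim

lemma mono_map_of_natIso {C D : Type*} [Category* C] [Category* D] {G H : C ⥤ D} (e : G ≅ H)
    {X Y : C} (g : X ⟶ Y) (h : Mono (G.map g)) : Mono (H.map g) := by
  rw [← NatIso.naturality_1 e g]
  have : Mono (G.map g ≫ e.hom.app Y) := mono_comp _ _
  exact mono_comp _ _

lemma leftAcyclic_copower (J : Type u) {M : ModuleCat.{u} R}
    (hM : LeftAcyclic (extendScalars f) M) :
    LeftAcyclic (extendScalars f) ((copower R J).obj M) := by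
  have hK := shortExact_kernel_ι (Projective.π M)
  have hP : LeftAcyclic (extendScalars f) ((copower R J).obj (Projective.over M)) :=
    LeftAcyclic.of_projective _
  have h1 := hM _ _ _ hK
  have h2 := hK.map_of_exact (copower R J)
  have : Mono ((extendScalars f).map ((copower R J).map (kernel.ι (Projective.π M)))) := by
    have h : Mono ((copower U J).map ((extendScalars f).map (kernel.ι (Projective.π M)))) :=
      inferInstance
    exact mono_map_of_natIso (copowerCompIso (extendScalars f) J).symm _ h
  exact LeftAcyclic.of_mono h2 hP

/-- All `U`-modules are acyclic for the extension of scalars. A module `N` is the quotient of a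
copower of `U`, which is acyclic since `Tor₁(U, U) = 0`, by a `U`-submodule. On `U`-modules the
extension of scalars is the identity, so it keeps the inclusion of this submodule monic. -/
lemma IsHomologicalEpi.leftAcyclic_restrictScalars (hf : IsHomologicalEpi f)
    (N : ModuleCat.{u} U) :
    LeftAcyclic (extendScalars f) ((ModuleCat.restrictScalars f).obj N) := by
  have h1 : LeftAcyclic (extendScalars f) (leftModU f) :=
    (isZero_leftDerived_one_iff _).1 (hf.isZero_tor 1 one_pos)
  let q : (copower U N).obj (ModuleCat.of U U) ⟶ N :=
    copowerDesc fun n => ModuleCat.ofHom (LinearMap.toSpanSingleton U N n)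
  have hq : Epi q := by
    refine (ModuleCat.epi_iff_surjective _).2 fun n => ?_
    refine ⟨(copowerι N (ModuleCat.of U U) n).hom (1 : U), ?_⟩
    have h := copowerι_desc
      (fun n : N => (ModuleCat.ofHom (LinearMap.toSpanSingleton U N n) : ModuleCat.of U U ⟶ N)) n
    refine (congrArg (fun t : ModuleCat.of U U ⟶ N => t.hom (1 : U)) h).trans ?_
    exact one_smul U n
  have hK := (shortExact_kernel_ι q).map_of_exact (ModuleCat.restrictScalars.{u} f)
  have hP : LeftAcyclic (extendScalars f)
      ((ModuleCat.restrictScalars f).obj ((copower U N).obj (ModuleCat.of U U))) := by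
    refine LeftAcyclic.of_iso ?_ (leftAcyclic_copower N h1)
    exact (copowerCompIso (ModuleCat.restrictScalars f) N).app (ModuleCat.of U U)
  have : Mono ((extendScalars f).map ((ModuleCat.restrictScalars f).map (kernel.ι q))) := by
    have := hf.isIso_extCounit (kernel q)
    have := hf.isIso_extCounit ((copower U N).obj (ModuleCat.of U U))
    have e := extCounit_naturality f (kernel.ι q)
    have h : Mono (extCounit f (kernel q) ≫ kernel.ι q) := inferInstance
    rw [← e] at h
    exact mono_of_mono _ (extCounit f ((copower U N).obj (ModuleCat.of U U)))
  exact LeftAcyclic.of_mono hK hP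

end ExtendScalars

/-! ### Cohomology of complexes of acyclic objects -/

section Exactness

set_option linter.unusedSectionVars false

variable {A B : Type*} [Category* A] [Category* B] [Abelian A] [Abelian B]

/-- Exactness of a composite `X ⟶ Z ⟶ Y ⟶ I ⟶ W` at `Y`, where `0 ⟶ Z ⟶ Y ⟶ I ⟶ 0` is
exact. -/
lemma exact_comp_iff {X Z Y I W : A} {a : X ⟶ Z} {i : Z ⟶ Y} {e : Y ⟶ I} {m : I ⟶ W}
    {w : i ≫ e = 0} (h : (ShortComplex.mk i e w).ShortExact) {f : X ⟶ Y} {g : Y ⟶ W}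
    (hf : a ≫ i = f) (hg : e ≫ m = g) (w' : f ≫ g = 0) :
    (ShortComplex.mk f g w').Exact ↔ Epi a ∧ Mono m := by
  have hi : Mono i := h.mono_f
  have he : Epi e := h.epi_g
  have hex := (exact_mk_iff w).1 h.exact
  subst hf hg
  rw [exact_mk_iff]
  constructor
  · intro hS
    constructor
    · obtain ⟨T', π, hπ, y, hy⟩ := hS i (by rw [reassoc_of% w, zero_comp])
      rw [← Category.assoc, cancel_mono] at hy
      subst hy
      exact epi_of_epi y a
    · refine Preadditive.mono_of_cancel_zero _ fun {T} t ht => ?_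
      obtain ⟨T', π, hπ, y, hy⟩ := surjective_up_to_refinements_of_epi e t
      obtain ⟨T'', π', hπ', z, hz⟩ := hS y (by rw [← reassoc_of% hy, ht, comp_zero])
      rw [← cancel_epi π, ← cancel_epi π', hy, reassoc_of% hz, w]
      simp
  · rintro ⟨ha, hm⟩ T x hx
    obtain ⟨T', π, hπ, z, hz⟩ := hex x (by rw [← cancel_mono m, Category.assoc, hx, zero_comp])
    obtain ⟨T'', π', hπ', y, hy⟩ := surjective_up_to_refinements_of_epi a z
    exact ⟨T'', π' ≫ π, inferInstance, y, by rw [Category.assoc, hz, reassoc_of% hy]⟩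

lemma shortExact_factorThruImage {X Y Z : A} {f : X ⟶ Y} {g : Y ⟶ Z} {w : f ≫ g = 0}
    (h : (ShortComplex.mk f g w).Exact) [Mono f] :
    (ShortComplex.mk f (factorThruImage g) (by
      rw [← cancel_mono (image.ι _), Category.assoc, image.fac, w, zero_comp])).ShortExact where
  exact := by
    rw [exact_mk_iff] at h ⊢
    exact fun T x hx => h x (by rw [← image.fac g, reassoc_of% hx, zero_comp])

lemma shortExact_imageι {X Y Z : A} {f : X ⟶ Y} {g : Y ⟶ Z} {w : f ≫ g = 0}
    (h : (ShortComplex.mk f g w).Exact) [Epi g] :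
    (ShortComplex.mk (image.ι f) g (by
      rw [← cancel_epi (factorThruImage _), image.fac_assoc, w, comp_zero])).ShortExact where
  exact := by
    rw [exact_mk_iff] at h ⊢
    intro T x hx
    obtain ⟨T', π, hπ, y, hy⟩ := h x hx
    exact ⟨T', π, hπ, y ≫ factorThruImage f, by rw [hy, Category.assoc, image.fac]⟩

section

variable (X : CochainComplex A ℤ) (n m : ℤ)

lemma exact_iCycles (h : n + 1 = m) :
    (ShortComplex.mk (X.iCycles n) (X.d n m) (X.iCycles_d n m)).Exact :=
  ShortComplex.exact_of_f_is_kernel _ (X.cyclesIsKernel n m (by simp [h]))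

lemma exact_pOpcycles (h : n + 1 = m) :
    (ShortComplex.mk (X.d n m) (X.pOpcycles m) (X.d_pOpcycles n m)).Exact :=
  ShortComplex.exact_of_g_is_cokernel _ (X.opcyclesIsCokernel n m (by simp [← h]))

lemma exact_homologyι (h : n + 1 = m) :
    (ShortComplex.mk (X.homologyι n) (X.fromOpcycles n m)
      (X.homologyι_comp_fromOpcycles n m)).Exact :=
  ShortComplex.exact_of_f_is_kernel _ (X.homologyIsKernel n m (by simp [h]))

lemma exact_homologyπ (h : n + 1 = m) :
    (ShortComplex.mk (X.toCycles n m) (X.homologyπ m) (X.toCycles_comp_homologyπ n m)).Exact :=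
  ShortComplex.exact_of_g_is_cokernel _ (X.homologyIsCokernel n m (by simp [← h]))

end

section Left

variable {F : A ⥤ B} [F.Additive] [PreservesFiniteColimits F]

lemma shortExact_map_of_leftAcyclic {X Y Z : A} {f : X ⟶ Y} {g : Y ⟶ Z} {w : f ≫ g = 0}
    (h : (ShortComplex.mk f g w).ShortExact) (hZ : LeftAcyclic F Z) :
    (ShortComplex.mk (F.map f) (F.map g) (by rw [← F.map_comp, w, F.map_zero])).ShortExact := by
  have : Epi g := h.epi_g
  obtain ⟨h1, h2⟩ := exact_and_epi_map (F := F) h.exact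
  have := hZ _ _ _ h
  exact { exact := h1 }

/-- A right exact functor kills a cokernel if and only if it takes the morphism to
an epimorphism. -/
lemma isZero_obj_iff_epi_map {X Y Z : A} {f : X ⟶ Y} {g : Y ⟶ Z} {w : f ≫ g = 0}
    (h : (ShortComplex.mk f g w).Exact) [Epi g] : IsZero (F.obj Z) ↔ Epi (F.map f) := by
  obtain ⟨h1, h2⟩ := exact_and_epi_map (F := F) h
  constructor
  · intro hZ
    exact (ShortComplex.exact_iff_epi _ (hZ.eq_of_tgt _ _)).1 h1
  · intro hf
    have h0 : F.map g = 0 := by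
      rw [← cancel_epi (F.map f), ← F.map_comp, w, F.map_zero, comp_zero]
    rw [IsZero.iff_id_eq_zero, ← cancel_epi (F.map g), h0]
    simp

/-- For a complex `X` of acyclic objects, exactness of `F X` is detected by the cohomology of
`X`. With `I` the image of `d : Xⁿ ⟶ Xⁿ⁺¹`, exactness in degree `n` means that `F` takes
`Xⁿ⁻¹ ⟶ Zⁿ` to an epimorphism and `I ⟶ Xⁿ⁺¹` to a monomorphism. The former is the vanishing of
`F Hⁿ`, and the latter is the acyclicity of `Xⁿ⁺¹/I`, which is that of its subobject `Hⁿ⁺¹`. -/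
lemma exactAt_mapHomologicalComplex_iff (hsub : ∀ {M M' : A}, LeftAcyclic F M' → ∀ m : M ⟶ M',
      Mono m → LeftAcyclic F M)
    (X : CochainComplex A ℤ) (hX : ∀ n, LeftAcyclic F (X.X n)) (n : ℤ) :
    ((F.mapHomologicalComplex (ComplexShape.up ℤ)).obj X).ExactAt n ↔
      IsZero (F.obj (X.homology n)) ∧ LeftAcyclic F (X.homology (n + 1)) := by
  have h1 := shortExact_factorThruImage
    (exact_iCycles X n (n + 1) rfl)
  have h2 : LeftAcyclic F (image (X.d n (n + 1))) := hsub (hX (n + 1)) (image.ι _) inferInstance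
  rw [HomologicalComplex.exactAt_iff' _ (n - 1) n (n + 1) (by simp) (by simp)]
  refine (exact_comp_iff (shortExact_map_of_leftAcyclic h1 h2)
    (a := F.map (X.toCycles (n - 1) n)) (m := F.map (image.ι _)) (f := F.map (X.d (n - 1) n))
    (g := F.map (X.d n (n + 1))) (by rw [← F.map_comp, X.toCycles_i])
    (by rw [← F.map_comp, image.fac]) (by rw [← F.map_comp, X.d_comp_d, F.map_zero])).trans
    (and_congr ?_ ?_)
  · exact (isZero_obj_iff_epi_map (exact_homologyπ X (n - 1) n (by ring))).symm
  · have h3 := shortExact_imageι (exact_pOpcycles X n (n + 1) rfl)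
    have h4 := shortExact_factorThruImage (exact_homologyι X (n + 1) (n + 2) (by ring))
    have h5 : LeftAcyclic F (image (X.fromOpcycles (n + 1) (n + 2))) :=
      hsub (hX (n + 2)) (image.ι _) inferInstance
    constructor
    · intro hm
      exact hsub (LeftAcyclic.of_mono h3 (hX _)) (X.homologyι (n + 1)) inferInstance
    · intro hH
      exact LeftAcyclic.of_extension h4 hH h5 _ _ _ h3

end Left

section Right

variable [HasExt.{w} A]

/-- An object `M` is acyclic for the functor represented by `W` if `Ext¹(W, M) = 0`. -/
def RightAcyclic (W : A) : ObjectProperty A := fun M => Subsingleton (Abelian.Ext.{w} W M 1)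

variable {W : A}

/-- Morphisms from `W` lift along an epimorphism with acyclic kernel. -/
lemma RightAcyclic.exists_lift {X Y Z : A} {f : X ⟶ Y} {g : Y ⟶ Z} {w : f ≫ g = 0}
    (h : (ShortComplex.mk f g w).ShortExact) (hX : RightAcyclic W X) (φ : W ⟶ Z) :
    ∃ ψ : W ⟶ Y, ψ ≫ g = φ := by
  obtain ⟨x, hx⟩ := Abelian.Ext.covariant_sequence_exact₃ W h (Abelian.Ext.mk₀ φ) (zero_add 1)
    (hX.elim _ _)
  obtain ⟨ψ, rfl⟩ := (Abelian.Ext.mk₀_bijective W Y).2 x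
  refine ⟨ψ, (Abelian.Ext.mk₀_bijective W Z).1 ?_⟩
  rw [← hx, Abelian.Ext.mk₀_comp_mk₀]

lemma RightAcyclic.of_forall_lift {X Y Z : A} {f : X ⟶ Y} {g : Y ⟶ Z} {w : f ≫ g = 0}
    (h : (ShortComplex.mk f g w).ShortExact) (hY : RightAcyclic W Y)
    (hl : ∀ φ : W ⟶ Z, ∃ ψ : W ⟶ Y, ψ ≫ g = φ) : RightAcyclic W X := by
  refine subsingleton_of_forall_eq 0 fun x => ?_
  obtain ⟨y, hy⟩ := Abelian.Ext.covariant_sequence_exact₁ W h x (hY.elim _ _) (zero_add 1)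
  obtain ⟨φ, rfl⟩ := (Abelian.Ext.mk₀_bijective W Z).2 y
  obtain ⟨ψ, rfl⟩ := hl φ
  rw [← hy, ← Abelian.Ext.mk₀_comp_mk₀, Abelian.Ext.comp_assoc_of_second_deg_zero]
  have h0 := h.comp_extClass
  dsimp at h0
  rw [h0, Abelian.Ext.comp_zero]

lemma RightAcyclic.of_extension {X Y Z : A} {f : X ⟶ Y} {g : Y ⟶ Z} {w : f ≫ g = 0}
    (h : (ShortComplex.mk f g w).ShortExact) (hX : RightAcyclic W X) (hZ : RightAcyclic W Z) :
    RightAcyclic W Y := by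
  refine subsingleton_of_forall_eq 0 fun x => ?_
  obtain ⟨y, hy⟩ := Abelian.Ext.covariant_sequence_exact₂ W h x (hZ.elim _ _)
  rw [← hy, hX.elim y 0, Abelian.Ext.zero_comp]

lemma RightAcyclic.of_injective (I : A) [Injective I] : RightAcyclic W I :=
  subsingleton_of_forall_eq 0 fun x => x.eq_zero_of_injective

/-- If `W` has projective dimension at most one, quotients of acyclic objects are acyclic. -/
lemma RightAcyclic.of_epi (hW : HasProjectiveDimensionLE W 1) {M M' : A} (hM : RightAcyclic W M)
    (p : M ⟶ M') [Epi p] : RightAcyclic W M' := by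
  refine subsingleton_of_forall_eq 0 fun x => ?_
  obtain ⟨y, hy⟩ := Abelian.Ext.covariant_sequence_exact₃ W (shortExact_kernel_ι p) x
    (one_add_one_eq_two) (Abelian.Ext.eq_zero_of_hasProjectiveDimensionLT _ 2 le_rfl)
  rw [← hy, hM.elim y 0, Abelian.Ext.zero_comp]

variable {G : A ⥤ B} [G.Additive] [PreservesFiniteLimits G]

lemma exact_and_mono_map {X Y Z : A} {f : X ⟶ Y} {g : Y ⟶ Z} {w : f ≫ g = 0}
    (h : (ShortComplex.mk f g w).Exact) [Mono f] :
    (ShortComplex.mk (G.map f) (G.map g) (by rw [← G.map_comp, w, G.map_zero])).Exact ∧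
      Mono (G.map f) :=
  have hG : ∀ S : ShortComplex A, S.Exact ∧ Mono S.f → (S.map G).Exact ∧ Mono (G.map S.f) :=
    ((Functor.preservesFiniteLimits_tfae G).out 3 1).1 ‹PreservesFiniteLimits G›
  hG _ ⟨h, ‹Mono f›⟩

lemma isZero_obj_iff_mono_map {X Y Z : A} {f : X ⟶ Y} {g : Y ⟶ Z} {w : f ≫ g = 0}
    (h : (ShortComplex.mk f g w).Exact) [Mono f] : IsZero (G.obj X) ↔ Mono (G.map g) := by
  obtain ⟨h1, h2⟩ := exact_and_mono_map (G := G) h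
  constructor
  · intro hZ
    exact (ShortComplex.exact_iff_mono _ (hZ.eq_of_src _ _)).1 h1
  · intro hf
    have h0 : G.map f = 0 := by
      rw [← cancel_mono (G.map g), ← G.map_comp, w, G.map_zero, zero_comp]
    rw [IsZero.iff_id_eq_zero, ← cancel_mono (G.map f), h0]
    simp

/-- For a complex `X` of objects acyclic for `G`, exactness of `G X` is detected by the cohomology
of `X`. Here `G` stands for the functor represented by `W`, with values in modules over a ring
acting on `W`; the hypothesis `hG` says that `G g` is epic if and only if morphisms from `W` lift
along `g`. -/
lemma exactAt_mapHomologicalComplex_iff' (hW : HasProjectiveDimensionLE W 1)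
    (hG : ∀ {X Y : A} (g : X ⟶ Y), Epi (G.map g) ↔ ∀ φ : W ⟶ Y, ∃ ψ : W ⟶ X, ψ ≫ g = φ)
    (X : CochainComplex A ℤ) (hX : ∀ n, RightAcyclic W (X.X n)) (n : ℤ) :
    ((G.mapHomologicalComplex (ComplexShape.up ℤ)).obj X).ExactAt n ↔
      RightAcyclic W (X.homology (n - 1)) ∧ IsZero (G.obj (X.homology n)) := by
  have h1 := shortExact_imageι (exact_pOpcycles X (n - 1) n (by ring))
  have h2 : RightAcyclic W (image (X.d (n - 1) n)) :=
    (hX (n - 1)).of_epi hW (factorThruImage _)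
  obtain ⟨h3, h4⟩ := exact_and_mono_map (G := G) h1.exact
  have h5 : (ShortComplex.mk _ _ _).ShortExact :=
    { exact := h3
      epi_g := (hG _).2 (h2.exists_lift h1) }
  rw [HomologicalComplex.exactAt_iff' _ (n - 1) n (n + 1) (by simp) (by simp)]
  refine (exact_comp_iff h5
    (a := G.map (factorThruImage _)) (m := G.map (X.fromOpcycles n (n + 1)))
    (f := G.map (X.d (n - 1) n)) (g := G.map (X.d n (n + 1)))
    (by rw [← G.map_comp, image.fac]) (by rw [← G.map_comp, X.p_fromOpcycles])
    (by rw [← G.map_comp, X.d_comp_d, G.map_zero])).trans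
    (and_congr ?_ ?_)
  · have h6 := shortExact_factorThruImage (exact_iCycles X (n - 1) n (by ring))
    have h7 := shortExact_imageι (exact_homologyπ X (n - 2) (n - 1) (by ring))
    have h8 : RightAcyclic W (image (X.toCycles (n - 2) (n - 1))) :=
      (hX (n - 2)).of_epi hW (factorThruImage _)
    rw [hG]
    constructor
    · intro hl
      exact (RightAcyclic.of_forall_lift h6 (hX _) hl).of_epi hW (X.homologyπ (n - 1))
    · intro hH
      exact (RightAcyclic.of_extension h7 h8 hH).exists_lift h6
  · exact (isZero_obj_iff_mono_map (exact_homologyι X n (n + 1) rfl)).symm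

end Right

end Exactness

/-! ### Functorial acyclic resolutions of unbounded complexes -/

section

open CochainComplex

section ReducedFunctors

set_option linter.unusedSectionVars false

variable {A : Type*} [Category* A] [Abelian A]

/-- The reduced part `X ↦ ker (Φ(0) : Φ X ⟶ Φ X)` of a functor `Φ` on an abelian category. It
preserves zero morphisms, although `Φ` need not, and so applies to complexes term by term. -/
def reducedSub (Φ : A ⥤ A) : A ⥤ A where
  obj X := kernel (Φ.map (0 : X ⟶ X))
  map {X Y} f := kernel.map _ _ (Φ.map f) (Φ.map f) (by simp [← Φ.map_comp])
  map_id X := by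
    rw [← cancel_mono (kernel.ι _)]
    simp
  map_comp f g := by
    rw [← cancel_mono (kernel.ι _)]
    simp

lemma kernel_map_zero_eq_zero (Φ : A ⥤ A) (X Y : A) :
    (kernel.lift (Φ.map (0 : Y ⟶ Y)) (kernel.ι (Φ.map (0 : X ⟶ X)) ≫ Φ.map (0 : X ⟶ Y))
      (by rw [Category.assoc, ← Φ.map_comp, zero_comp, ← zero_comp (f := (0 : X ⟶ Y)),
        Φ.map_comp, kernel.condition_assoc, zero_comp])) = 0 := by
  rw [← cancel_mono (kernel.ι _), kernel.lift_ι, zero_comp, ← zero_comp (f := (0 : X ⟶ Y)),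
    Φ.map_comp, kernel.condition_assoc, zero_comp]

instance (Φ : A ⥤ A) : (reducedSub Φ).PreservesZeroMorphisms where
  map_zero X Y := kernel_map_zero_eq_zero Φ X Y

/-- The reduced part of `Φ X` is a direct summand. -/
def reducedSubRetract (Φ : A ⥤ A) (X : A) :
    Retract (kernel (Φ.map (0 : X ⟶ X))) (Φ.obj X) where
  i := kernel.ι _
  r := kernel.lift _ (𝟙 _ - Φ.map (0 : X ⟶ X)) (by
    rw [Preadditive.sub_comp, Category.id_comp, ← Φ.map_comp, comp_zero, sub_self])
  retract := by
    rw [← cancel_mono (kernel.ι _), Category.assoc, kernel.lift_ι, Preadditive.comp_sub,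
      kernel.condition, sub_zero, Category.comp_id, Category.id_comp]

/-- The augmentation of the reduced part. -/
def reducedSubπ {Φ : A ⥤ A} (ε : Φ ⟶ 𝟭 A) : reducedSub Φ ⟶ 𝟭 A where
  app X := kernel.ι _ ≫ ε.app X
  naturality X Y f := by
    have h := ε.naturality f
    dsimp [reducedSub] at h ⊢
    simp [h]

lemma epi_reducedSubπ {Φ : A ⥤ A} (ε : Φ ⟶ 𝟭 A) (X : A) [Epi (ε.app X)] :
    Epi ((reducedSubπ ε).app X) := by
  have h : Φ.map (0 : X ⟶ X) ≫ ε.app X = 0 := (ε.naturality (0 : X ⟶ X)).trans comp_zero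
  have e : (reducedSubRetract Φ X).r ≫ kernel.ι _ ≫ ε.app X = ε.app X := by
    simp only [reducedSubRetract, kernel.lift_ι_assoc, Preadditive.sub_comp,
      Category.id_comp, h]
    exact sub_zero _
  exact epi_of_epi_fac e

/-- The reduced quotient `X ↦ coker (Φ(0) : Φ X ⟶ Φ X)` of a functor `Φ` on an abelian category.
It preserves zero morphisms. -/
def reducedQuot (Φ : A ⥤ A) : A ⥤ A where
  obj X := cokernel (Φ.map (0 : X ⟶ X))
  map {X Y} f := cokernel.map _ _ (Φ.map f) (Φ.map f) (by simp [← Φ.map_comp])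
  map_id X := by
    rw [← cancel_epi (cokernel.π _)]
    simp
  map_comp f g := by
    rw [← cancel_epi (cokernel.π _)]
    simp

lemma cokernel_map_zero_eq_zero (Φ : A ⥤ A) (X Y : A) :
    (cokernel.desc (Φ.map (0 : X ⟶ X)) (Φ.map (0 : X ⟶ Y) ≫ cokernel.π (Φ.map (0 : Y ⟶ Y)))
      (by rw [← Category.assoc, ← Φ.map_comp, comp_zero, ← comp_zero (f := (0 : X ⟶ Y)),
        Φ.map_comp, Category.assoc, cokernel.condition, comp_zero])) = 0 := by
  rw [← cancel_epi (cokernel.π _), cokernel.π_desc, comp_zero, ← comp_zero (f := (0 : X ⟶ Y)),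
    Φ.map_comp, Category.assoc, cokernel.condition, comp_zero]

instance (Φ : A ⥤ A) : (reducedQuot Φ).PreservesZeroMorphisms where
  map_zero X Y := cokernel_map_zero_eq_zero Φ X Y

/-- The coaugmentation of the reduced quotient. -/
def reducedQuotι {Φ : A ⥤ A} (η : 𝟭 A ⟶ Φ) : 𝟭 A ⟶ reducedQuot Φ where
  app X := η.app X ≫ cokernel.π _
  naturality X Y f := by
    have h := η.naturality f
    dsimp [reducedQuot] at h ⊢
    simp [reassoc_of% h]

lemma mono_reducedQuotι {Φ : A ⥤ A} (η : 𝟭 A ⟶ Φ) (X : A) [Mono (η.app X)] :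
    Mono ((reducedQuotι η).app X) := by
  have h : η.app X ≫ Φ.map (0 : X ⟶ X) = 0 := (η.naturality (0 : X ⟶ X)).symm.trans zero_comp
  have e : (η.app X ≫ cokernel.π (Φ.map (0 : X ⟶ X))) ≫
      cokernel.desc _ (𝟙 _ - Φ.map (0 : X ⟶ X)) (by
      rw [Preadditive.comp_sub, Category.comp_id, ← Φ.map_comp, comp_zero, sub_self]) =
        η.app X := by
    simp only [cokernel.π_desc, Preadditive.comp_sub, Category.assoc, Category.comp_id, h]
    exact sub_zero _
  exact mono_of_mono_fac e

end ReducedFunctors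

section Cones

set_option linter.unusedSectionVars false

variable {A : Type*} [Category* A] [Abelian A]

lemma quasiIso_mappingConeMap {K₁ L₁ K₂ L₂ : CochainComplex A ℤ} (φ₁ : K₁ ⟶ L₁) (φ₂ : K₂ ⟶ L₂)
    (a : K₁ ⟶ K₂) (b : L₁ ⟶ L₂) (comm : φ₁ ≫ b = a ≫ φ₂) [QuasiIso a] [QuasiIso b] :
    QuasiIso (mappingCone.map φ₁ φ₂ a b comm) := by
  let _ := HasDerivedCategory.standard A
  rw [← DerivedCategory.isIso_Q_map_iff_quasiIso]
  exact Pretriangulated.isIso₃_of_isIso₁₂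
    (DerivedCategory.Q.mapTriangle.map (mappingCone.triangleMap φ₁ φ₂ a b comm))
    (DerivedCategory.mappingCone_triangle_distinguished φ₁)
    (DerivedCategory.mappingCone_triangle_distinguished φ₂)
    (inferInstanceAs (IsIso (DerivedCategory.Q.map a)))
    (inferInstanceAs (IsIso (DerivedCategory.Q.map b)))

/-- The comparison `X₁⟦1⟧ ⟶ cone (X₂ ⟶ X₃)` for a short complex `X₁ ⟶ X₂ ⟶ X₃`. -/
def shiftToCone (S : ShortComplex (CochainComplex A ℤ)) :
    S.X₁⟦(1 : ℤ)⟧ ⟶ mappingCone S.g :=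
  (mappingCone.rotateHomotopyEquiv S.f).hom ≫
    mappingCone.map (mappingCone.inr S.f) S.g (𝟙 _) (mappingCone.descShortComplex S) (by simp)

lemma quasiIso_shiftToCone {S : ShortComplex (CochainComplex A ℤ)} (hS : S.ShortExact) :
    QuasiIso (shiftToCone S) := by
  have := mappingCone.quasiIso_descShortComplex hS
  have := quasiIso_mappingConeMap (mappingCone.inr S.f) S.g (𝟙 _)
    (mappingCone.descShortComplex S) (by simp)
  unfold shiftToCone
  infer_instance

lemma shiftToCone_f (S : ShortComplex (CochainComplex A ℤ)) (n : ℤ) :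
    (shiftToCone S).f n =
      S.f.f (n + 1) ≫ (mappingCone.inl S.g).v (n + 1) n (by lia) := by
  simp only [shiftToCone, mappingCone.rotateHomotopyEquiv, mappingCone.map,
    HomologicalComplex.comp_f, mappingCone.lift_desc_f _ _ _ _ _ _ _ n (n + 1) rfl,
    HomComplex.Cocycle.coe_neg, HomComplex.Cocycle.leftShift_coe, HomComplex.Cocycle.ofHom_coe,
    HomComplex.Cochain.neg_v,
    (HomComplex.Cochain.ofHom S.f).leftShift_v 1 1 (zero_add 1) n (n + 1) rfl (n + 1) (by lia),
    (mappingCone.inl S.f).leftShift_v 1 0 (neg_add_cancel 1) n n (add_zero n) (n + 1) (by lia)]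
  -- the composite has two summands, and the one through `inl S.f` dies in `S.X₃`
  have h : (mappingCone.inl S.f).v (n + 1) n (by lia) ≫
      (mappingCone.descShortComplex S).f n = 0 := by
    simp [mappingCone.descShortComplex]
  have h0 : ∀ (X : A) (x : X ⟶ S.X₁.X (n + 1)),
      (-((1 * 0 + 1 * (1 - 1) / 2 : ℤ).negOnePow •
          x ≫ (mappingCone.inl S.f).v (n + 1) n (by lia))) ≫
      (mappingCone.descShortComplex S).f n ≫ (mappingCone.inr S.g).f n = 0 := by
    intro X x
    simp [reassoc_of% h]
  have h1 : ∀ (X : A) (x : X ⟶ S.X₁.X (n + 1)),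
      (-((1 * 1 + 1 * (1 - 1) / 2 : ℤ).negOnePow • x ≫
        (HomComplex.Cochain.ofHom S.f).v (n + 1) (n + 1) (by lia))) ≫
      ((HomComplex.Cochain.ofHom (𝟙 S.X₂)).comp (mappingCone.inl S.g)
        (zero_add (-1))).v (n + 1) n (by lia) =
      x ≫ S.f.f (n + 1) ≫ (mappingCone.inl S.g).v (n + 1) n (by lia) := by
    intro X x
    simp
  exact (congrArg₂ (· + ·) (h1 _ _) (h0 _ _)).trans
    ((add_zero _).trans (Category.id_comp _))

lemma shiftToCone_naturality {S S' : ShortComplex (CochainComplex A ℤ)} (φ : S ⟶ S') :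
    φ.τ₁⟦(1 : ℤ)⟧' ≫ shiftToCone S' =
      shiftToCone S ≫ mappingCone.map S.g S'.g φ.τ₂ φ.τ₃ φ.comm₂₃.symm := by
  ext n
  have h := congrArg (fun f => f.f (n + 1)) φ.comm₁₂
  simp only [HomologicalComplex.comp_f] at h
  simp only [HomologicalComplex.comp_f, shiftToCone_f, mappingCone.map]
  simp [reassoc_of% h]

lemma shortExact_mappingCone_X {K L : CochainComplex A ℤ} (φ : K ⟶ L) (n m : ℤ) (h : n + 1 = m) :
    (ShortComplex.mk ((mappingCone.inr φ).f n)
      ((mappingCone.fst φ).1.v n m h) (by simp)).ShortExact := by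
  have s : (ShortComplex.mk ((mappingCone.inr φ).f n)
      ((mappingCone.fst φ).1.v n m h) (by simp)).Splitting :=
    { r := (mappingCone.snd φ).v n n (add_zero n)
      s := (mappingCone.inl φ).v m n (by lia)
      f_r := by simp
      s_g := by simp
      id := by
        dsimp
        rw [add_comm, mappingCone.id_X] }
  exact s.shortExact

section

variable {C : Type*} [Category* C] (S : C ⥤ ShortComplex (CochainComplex A ℤ))

/-- The cone of the first map of a functorial short complex of complexes. -/
def coneResolution : C ⥤ CochainComplex A ℤ where
  obj X := mappingCone (S.obj X).f
  map g := mappingCone.map _ _ (S.map g).τ₁ (S.map g).τ₂ (S.map g).comm₁₂.symm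
  map_id X := by
    simp only [S.map_id]
    exact mappingCone.map_id _
  map_comp g g' := by
    simp only [S.map_comp]
    exact mappingCone.map_comp _ _ _ _ _ _ _ _ _

/-- The projection from the cone of the first map to the third complex. -/
def coneResolutionπ : coneResolution S ⟶ S ⋙ ShortComplex.π₃ where
  app X := mappingCone.descShortComplex (S.obj X)
  naturality _ _ g := mappingCone.map_descShortComplex _ _ (S.map g)

/-- The cocone of the second map of a functorial short complex of complexes. -/
def coconeResolution : C ⥤ CochainComplex A ℤ where
  obj X := (mappingCone (S.obj X).g)⟦(-1 : ℤ)⟧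
  map g := (mappingCone.map _ _ (S.map g).τ₂ (S.map g).τ₃ (S.map g).comm₂₃.symm)⟦(-1 : ℤ)⟧'
  map_id X := by
    simp only [S.map_id]
    exact (congrArg _ (mappingCone.map_id _)).trans (CategoryTheory.Functor.map_id _ _)
  map_comp g g' := by
    simp only [S.map_comp]
    exact (congrArg _ (mappingCone.map_comp _ _ _ _ _ _ _ _ _)).trans
      (CategoryTheory.Functor.map_comp _ _ _)

/-- The inclusion of the first complex into the cocone of the second map. -/
def coconeResolutionι : S ⋙ ShortComplex.π₁ ⟶ coconeResolution S where
  app X := (shiftFunctorCompIsoId (CochainComplex A ℤ) (1 : ℤ) (-1) (by simp)).inv.app _ ≫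
    (shiftToCone (S.obj X))⟦(-1 : ℤ)⟧'
  naturality X Y g := by
    have h1 := (shiftFunctorCompIsoId (CochainComplex A ℤ) (1 : ℤ) (-1) (by simp)).inv.naturality
      (S.map g).τ₁
    have h2 := congrArg (fun f => f⟦(-1 : ℤ)⟧') (shiftToCone_naturality (S.map g))
    simp only [Functor.map_comp] at h2
    refine (Category.assoc _ _ _).symm.trans ((congrArg (· ≫ _) h1).trans
      ((Category.assoc _ _ _).trans ((congrArg (_ ≫ ·) h2).trans (Category.assoc _ _ _).symm)))

lemma quasiIso_coconeResolutionι (hS : ∀ X, (S.obj X).ShortExact) (X : C) :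
    QuasiIso ((coconeResolutionι S).app X) := by
  have := quasiIso_shiftToCone (hS X)
  have : QuasiIso ((shiftToCone (S.obj X))⟦(-1 : ℤ)⟧') := by
    rw [quasiIso_shift_iff]
    infer_instance
  exact inferInstanceAs (QuasiIso
    ((shiftFunctorCompIsoId (CochainComplex A ℤ) (1 : ℤ) (-1) (by simp)).inv.app (S.obj X).X₁ ≫
    (shiftToCone (S.obj X))⟦(-1 : ℤ)⟧'))

end

end Cones

section Resolutions

variable {A : Type*} [Category* A] [Abelian A]

/-- A natural transformation to the identity functor, applied to the terms of a complex. -/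
def termwiseπ {p : A ⥤ A} [p.PreservesZeroMorphisms] (ε : p ⟶ 𝟭 A) (X : CochainComplex A ℤ) :
    (p.mapHomologicalComplex _).obj X ⟶ X where
  f n := ε.app (X.X n)
  comm' i j _ := (ε.naturality (X.d i j)).symm

/-- A natural transformation from the identity functor, applied to the terms of a complex. -/
def termwiseι {q : A ⥤ A} [q.PreservesZeroMorphisms] (η : 𝟭 A ⟶ q) (X : CochainComplex A ℤ) :
    X ⟶ (q.mapHomologicalComplex _).obj X where
  f n := η.app (X.X n)
  comm' i j _ := (η.naturality (X.d i j)).symm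

/-- The functorial short complex `0 ⟶ ker ε ⟶ p X ⟶ X ⟶ 0`, applied to the terms of a complex. -/
def kernelShortComplex {p : A ⥤ A} [p.PreservesZeroMorphisms] (ε : p ⟶ 𝟭 A) :
    CochainComplex A ℤ ⥤ ShortComplex (CochainComplex A ℤ) where
  obj X := ShortComplex.mk (X₃ := X)
    (kernel.ι (termwiseπ ε X)) (termwiseπ ε X) (kernel.condition _)
  map {X Y} g :=
    { τ₁ := kernel.map _ _ ((p.mapHomologicalComplex _).map g) g (by
        ext n
        exact (ε.naturality (g.f n)).symm)
      τ₂ := (p.mapHomologicalComplex _).map g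
      τ₃ := g
      comm₁₂ := by simp
      comm₂₃ := by
        ext n
        exact (ε.naturality (g.f n)) }
  map_id X := by
    ext : 1
    · exact (cancel_mono (kernel.ι _)).1 (by simp)
    · simp
    · simp
  map_comp f g := by
    ext : 1
    · exact (cancel_mono (kernel.ι _)).1 (by simp)
    · simp
    · simp

lemma shortExact_kernelShortComplex {p : A ⥤ A} [p.PreservesZeroMorphisms] (ε : p ⟶ 𝟭 A)
    (hε : ∀ X, Epi (ε.app X)) (X : CochainComplex A ℤ) :
    ((kernelShortComplex ε).obj X).ShortExact := by
  have := HomologicalComplex.epi_of_epi_f ((kernelShortComplex ε).obj X).g fun n => hε (X.X n)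
  exact
    { exact := ShortComplex.exact_kernel _
      mono_f := inferInstanceAs (Mono (kernel.ι (termwiseπ ε X)))
      epi_g := this }

/-- The functorial short complex `0 ⟶ X ⟶ q X ⟶ coker η ⟶ 0`, applied to the terms of a
complex. -/
def cokernelShortComplex {q : A ⥤ A} [q.PreservesZeroMorphisms] (η : 𝟭 A ⟶ q) :
    CochainComplex A ℤ ⥤ ShortComplex (CochainComplex A ℤ) where
  obj X := ShortComplex.mk (X₁ := X)
    (termwiseι η X) (cokernel.π (termwiseι η X)) (cokernel.condition _)
  map {X Y} g :=
    { τ₁ := g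
      τ₂ := (q.mapHomologicalComplex _).map g
      τ₃ := cokernel.map _ _ g ((q.mapHomologicalComplex _).map g) (by
        ext n
        exact (η.naturality (g.f n)).symm)
      comm₁₂ := by
        ext n
        exact (η.naturality (g.f n))
      comm₂₃ := by simp }
  map_id X := by
    ext : 1
    · simp
    · simp
    · exact (cancel_epi (cokernel.π _)).1 (by simp)
  map_comp f g := by
    ext : 1
    · simp
    · simp
    · exact (cancel_epi (cokernel.π _)).1 (by simp)

lemma shortExact_cokernelShortComplex {q : A ⥤ A} [q.PreservesZeroMorphisms] (η : 𝟭 A ⟶ q)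
    (hη : ∀ X, Mono (η.app X)) (X : CochainComplex A ℤ) :
    ((cokernelShortComplex η).obj X).ShortExact := by
  have := HomologicalComplex.mono_of_mono_f ((cokernelShortComplex η).obj X).f
    fun n => hη (X.X n)
  exact
    { exact := ShortComplex.exact_cokernel _
      mono_f := this
      epi_g := inferInstanceAs (Epi (cokernel.π (termwiseι η X))) }

/-- Functorial left resolutions of unbounded complexes by objects of a class which contains the
projective objects and is closed under subobjects and extensions. -/
lemma exists_left_resolution (p : A ⥤ A) (ε : p ⟶ 𝟭 A) (hε : ∀ X, Epi (ε.app X))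
    (hp : ∀ X, Projective (p.obj X)) (P : ObjectProperty A)
    (hproj : ∀ (X : A) [Projective X], P X)
    (hsub : ∀ {X Y : A} (m : X ⟶ Y) [Mono m], P Y → P X)
    (hext : ∀ {S : ShortComplex A}, S.ShortExact → P S.X₁ → P S.X₃ → P S.X₂) :
    ∃ (r : CochainComplex A ℤ ⥤ CochainComplex A ℤ) (π : r ⟶ 𝟭 _),
      (∀ X, QuasiIso (π.app X)) ∧ ∀ X n, P ((r.obj X).X n) := by
  have hε' := fun X => epi_reducedSubπ ε X
  refine ⟨coneResolution (kernelShortComplex (reducedSubπ ε)),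
    coneResolutionπ (kernelShortComplex (reducedSubπ ε)), fun X =>
    mappingCone.quasiIso_descShortComplex (shortExact_kernelShortComplex _ hε' X), fun X n => ?_⟩
  have h : ∀ n, P (((kernelShortComplex (reducedSubπ ε)).obj X).X₂.X n) := fun n => by
    have h' : P (kernel (p.map (0 : X.X n ⟶ X.X n))) := hsub (kernel.ι _) (hproj _)
    exact h'
  have hS := shortExact_kernelShortComplex _ hε' X
  have := hS.mono_f
  exact hext (shortExact_mappingCone_X ((kernelShortComplex (reducedSubπ ε)).obj X).f n _ rfl)
    (h n) (hsub (((kernelShortComplex (reducedSubπ ε)).obj X).f.f (n + 1)) (h (n + 1)))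

/-- Functorial right resolutions of unbounded complexes by objects of a class which contains the
injective objects and is closed under quotients and extensions. -/
lemma exists_right_resolution (q : A ⥤ A) (η : 𝟭 A ⟶ q) (hη : ∀ X, Mono (η.app X))
    (hq : ∀ X, Injective (q.obj X)) (P : ObjectProperty A)
    (hinj : ∀ (X : A) [Injective X], P X)
    (hquot : ∀ {X Y : A} (m : X ⟶ Y) [Epi m], P X → P Y)
    (hext : ∀ {S : ShortComplex A}, S.ShortExact → P S.X₁ → P S.X₃ → P S.X₂) :
    ∃ (r : CochainComplex A ℤ ⥤ CochainComplex A ℤ) (ι : 𝟭 _ ⟶ r),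
      (∀ X, QuasiIso (ι.app X)) ∧ ∀ X n, P ((r.obj X).X n) := by
  have hη' := fun X => mono_reducedQuotι η X
  refine ⟨coconeResolution (cokernelShortComplex (reducedQuotι η)),
    coconeResolutionι (cokernelShortComplex (reducedQuotι η)), fun X =>
    quasiIso_coconeResolutionι _ (fun X => (shortExact_cokernelShortComplex _ hη' X)) X,
    fun X n => ?_⟩
  have h : ∀ n, P (((cokernelShortComplex (reducedQuotι η)).obj X).X₂.X n) := fun n => by
    have h' : P (cokernel (q.map (0 : X.X n ⟶ X.X n))) := hquot (cokernel.π _) (hinj _)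
    exact h'
  have hS := shortExact_cokernelShortComplex _ hη' X
  have := hS.epi_g
  exact hext
    (shortExact_mappingCone_X ((cokernelShortComplex (reducedQuotι η)).obj X).g (n + -1) _ rfl)
    (hquot (((cokernelShortComplex (reducedQuotι η)).obj X).g.f (n + -1)) (h (n + -1))) (h _)

end Resolutions

end

/-! ### Derived functors and adjunctions on derived categories -/

section

open CochainComplex

section Acyclic

variable {A B : Type*} [Category* A] [Category* B] [Abelian A] [Abelian B]

lemma isZero_Q_obj_iff_acyclic [HasDerivedCategory.{w} A] (X : CochainComplex A ℤ) :
    IsZero (DerivedCategory.Q.obj X) ↔ X.Acyclic := by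
  constructor
  · intro h n
    rw [HomologicalComplex.exactAt_iff_isZero_homology]
    exact ((DerivedCategory.homologyFunctor A n).map_isZero h).of_iso
      ((DerivedCategory.homologyFunctorFactors A n).app X).symm
  · intro h
    have h0 : IsZero (0 : CochainComplex A ℤ) := isZero_zero _
    have : QuasiIso (0 : X ⟶ 0) := ⟨fun n => by
      rw [quasiIsoAt_iff_exactAt _ _ (h n), HomologicalComplex.exactAt_iff_isZero_homology]
      exact (HomologicalComplex.homologyFunctor A _ n).map_isZero h0⟩
    exact (DerivedCategory.Q.map_isZero h0).of_iso (asIso (DerivedCategory.Q.map (0 : X ⟶ 0)))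

lemma quasiIso_iff_acyclic_mappingCone {X Y : CochainComplex A ℤ} (g : X ⟶ Y) :
    QuasiIso g ↔ (mappingCone g).Acyclic := by
  let _ := HasDerivedCategory.standard A
  rw [← DerivedCategory.isIso_Q_map_iff_quasiIso, ← isZero_Q_obj_iff_acyclic]
  exact (Pretriangulated.Triangle.isZero₃_iff_isIso₁ _
    (DerivedCategory.mappingCone_triangle_distinguished g)).symm

lemma quasiIso_mapHomologicalComplex_iff (F : A ⥤ B) [F.Additive] {X Y : CochainComplex A ℤ}
    (g : X ⟶ Y) : QuasiIso ((F.mapHomologicalComplex (ComplexShape.up ℤ)).map g) ↔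
      ((F.mapHomologicalComplex (ComplexShape.up ℤ)).obj (mappingCone g)).Acyclic := by
  rw [quasiIso_iff_acyclic_mappingCone]
  exact ⟨fun h n => (h n).of_iso (mappingCone.mapHomologicalComplexIso g F).symm,
    fun h n => (h n).of_iso (mappingCone.mapHomologicalComplexIso g F)⟩

/-- A right exact functor preserves quasi-isomorphisms between unbounded complexes of acyclic
objects, since it preserves the exactness of the mapping cone. -/
lemma quasiIso_map_of_leftAcyclic {F : A ⥤ B} [F.Additive] [PreservesFiniteColimits F]
    (hsub : ∀ {M M' : A}, LeftAcyclic F M' → ∀ m : M ⟶ M', Mono m → LeftAcyclic F M)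
    {X Y : CochainComplex A ℤ} (g : X ⟶ Y) [hg : QuasiIso g]
    (hX : ∀ n, LeftAcyclic F (X.X n)) (hY : ∀ n, LeftAcyclic F (Y.X n)) :
    QuasiIso ((F.mapHomologicalComplex (ComplexShape.up ℤ)).map g) := by
  rw [quasiIso_mapHomologicalComplex_iff]
  rw [quasiIso_iff_acyclic_mappingCone] at hg
  have h0 : ∀ n, IsZero ((mappingCone g).homology n) := fun n => (hg n).isZero_homology
  intro n
  refine (exactAt_mapHomologicalComplex_iff hsub _ (fun m => LeftAcyclic.of_extension
    (shortExact_mappingCone_X g m _ rfl) (hY _) (hX _)) n).2 ⟨F.map_isZero (h0 n), ?_⟩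
  have := (h0 (n + 1)).projective
  exact LeftAcyclic.of_projective _

/-- A left exact functor preserves quasi-isomorphisms between unbounded complexes of acyclic
objects, since it preserves the exactness of the mapping cone. -/
lemma quasiIso_map_of_rightAcyclic [HasExt.{w} A] {W : A} {G : A ⥤ B} [G.Additive]
    [PreservesFiniteLimits G] (hW : HasProjectiveDimensionLE W 1)
    (hG : ∀ {X Y : A} (g : X ⟶ Y), Epi (G.map g) ↔ ∀ φ : W ⟶ Y, ∃ ψ : W ⟶ X, ψ ≫ g = φ)
    {X Y : CochainComplex A ℤ} (g : X ⟶ Y) [hg : QuasiIso g]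
    (hX : ∀ n, RightAcyclic W (X.X n)) (hY : ∀ n, RightAcyclic W (Y.X n)) :
    QuasiIso ((G.mapHomologicalComplex (ComplexShape.up ℤ)).map g) := by
  rw [quasiIso_mapHomologicalComplex_iff]
  rw [quasiIso_iff_acyclic_mappingCone] at hg
  have h0 : ∀ n, IsZero ((mappingCone g).homology n) := fun n => (hg n).isZero_homology
  intro n
  refine (exactAt_mapHomologicalComplex_iff' hW hG _ (fun m => RightAcyclic.of_extension
    (shortExact_mappingCone_X g m _ rfl) (hY _) (hX _)) n).2 ⟨?_, G.map_isZero (h0 n)⟩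
  have := (h0 (n - 1)).injective
  exact RightAcyclic.of_injective _

end Acyclic

section Derived

variable {C D E : Type*} [Category* C] [Category* D] [Category* E] (L : C ⥤ D)
  (W : MorphismProperty C) [L.IsLocalization W] [W.HasTwoOutOfThreeProperty]
  (P : ObjectProperty C)

/-- Existence of left derived functors from a functorial left resolution by objects on which the
functor inverts the weak equivalences. -/
theorem exists_leftDerived (r : C ⥤ C) (π : r ⟶ 𝟭 C) (hπ : ∀ X, W (π.app X))
    (hP : ∀ X, P (r.obj X)) (Φ : C ⥤ E)
    (hΦ : ∀ {X Y : C} (g : X ⟶ Y), P X → P Y → W g → IsIso (Φ.map g)) :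
    ∃ (LΦ : D ⥤ E) (α : L ⋙ LΦ ⟶ Φ), ∀ X, P X → IsIso (α.app X) := by
  have h : W.IsInvertedBy (r ⋙ Φ) := fun X Y g hg => by
    refine hΦ _ (hP X) (hP Y) (W.of_postcomp _ _ (hπ Y) ?_)
    have e : r.map g ≫ π.app Y = π.app X ≫ g := π.naturality g
    rw [e]
    exact W.comp_mem _ _ (hπ X) hg
  refine ⟨Localization.lift _ h L,
    (Localization.fac _ h L).hom ≫ Functor.whiskerRight π Φ ≫ (Functor.leftUnitor _).hom,
    fun X hX => ?_⟩
  have : IsIso (Φ.map (π.app X)) := hΦ _ (hP X) hX (hπ X)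
  dsimp
  infer_instance

/-- Existence of right derived functors from a functorial right resolution by objects on which the
functor inverts the weak equivalences. -/
theorem exists_rightDerived (r : C ⥤ C) (ι : 𝟭 C ⟶ r) (hι : ∀ X, W (ι.app X))
    (hP : ∀ X, P (r.obj X)) (Φ : C ⥤ E)
    (hΦ : ∀ {X Y : C} (g : X ⟶ Y), P X → P Y → W g → IsIso (Φ.map g)) :
    ∃ (RΦ : D ⥤ E) (α : Φ ⟶ L ⋙ RΦ), ∀ X, P X → IsIso (α.app X) := by
  have h : W.IsInvertedBy (r ⋙ Φ) := fun X Y g hg => by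
    refine hΦ _ (hP X) (hP Y) (W.of_precomp _ _ (hι X) ?_)
    have e : g ≫ ι.app Y = ι.app X ≫ r.map g := ι.naturality g
    rw [← e]
    exact W.comp_mem _ _ hg (hι Y)
  refine ⟨Localization.lift _ h L,
    (Functor.leftUnitor _).inv ≫ Functor.whiskerRight ι Φ ≫ (Localization.fac _ h L).inv,
    fun X hX => ?_⟩
  have : IsIso (Φ.map (ι.app X)) := hΦ _ hX (hP X) (hι X)
  dsimp
  infer_instance

/-- Every natural transformation between the restrictions of two functors along a localization
extends to the functors themselves. -/
lemma exists_natTrans_of_isLocalization (W : MorphismProperty C) [L.IsLocalization W]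
    {F G : D ⥤ E} (τ : L ⋙ F ⟶ L ⋙ G) :
    ∃ σ : F ⟶ G, ∀ X, σ.app (L.obj X) = τ.app X := by
  have : ((Functor.whiskeringLeft C D E).obj L).Full :=
    inferInstanceAs (Localization.whiskeringLeftFunctor' L W E).Full
  exact ⟨_, fun X => congr_app (((Functor.whiskeringLeft C D E).obj L).map_preimage τ) X⟩

open Functor in
/-- An adjunction between functors which admit resolutions by acyclic objects induces an
adjunction of derived functors, compatible with the units and counits. -/
theorem exists_derived_adjunction {C₁ C₂ D₁ D₂ : Type*} [Category* C₁] [Category* C₂] [Category* D₁]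
    [Category* D₂] {G : C₁ ⥤ C₂} {F : C₂ ⥤ C₁} (adj : G ⊣ F)
    {L₁ : C₁ ⥤ D₁} {L₂ : C₂ ⥤ D₂} (W₁ : MorphismProperty C₁) (W₂ : MorphismProperty C₂)
    [L₁.IsLocalization W₁] [L₂.IsLocalization W₂] {G' : D₁ ⥤ D₂} {F' : D₂ ⥤ D₁}
    (α : L₁ ⋙ G' ⟶ G ⋙ L₂) (β : F ⋙ L₁ ⟶ L₂ ⋙ F')
    (r₁ : C₁ ⥤ C₁) (π : r₁ ⟶ 𝟭 C₁) (hπ : ∀ X, W₁ (π.app X)) (hα : ∀ X, IsIso (α.app (r₁.obj X)))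
    (r₂ : C₂ ⥤ C₂) (ι : 𝟭 C₂ ⟶ r₂) (hι : ∀ X, W₂ (ι.app X))
    (hβ : ∀ X, IsIso (β.app (r₂.obj X))) :
    ∃ adj' : G' ⊣ F',
      (∀ X, adj'.unit.app (L₁.obj X) ≫ F'.map (α.app X) =
        L₁.map (adj.unit.app X) ≫ β.app (G.obj X)) ∧
      ∀ X, G'.map (β.app X) ≫ adj'.counit.app (L₂.obj X) =
        α.app (F.obj X) ≫ L₂.map (adj.counit.app X) := by
  have := isLeftDerivedFunctor_of_deformation W₁ α r₁ π hπ hα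
  have := isRightDerivedFunctor_of_deformation W₂ β r₂ ι hι hβ
  have : (G' ⋙ F').IsLeftDerivedFunctor ((Functor.associator _ _ _).inv ≫ whiskerRight α F') W₁ :=
    isLeftDerivedFunctor_of_deformation W₁ _ r₁ π hπ fun X => by
      dsimp
      infer_instance
  have : (F' ⋙ G').IsRightDerivedFunctor (whiskerRight β G' ≫ (Functor.associator _ _ _).hom) W₂ :=
    isRightDerivedFunctor_of_deformation W₂ _ r₂ ι hι fun X => by
      dsimp
      infer_instance
  refine ⟨adj.derived W₁ W₂ α β, fun X => ?_, fun X => ?_⟩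
  · rw [Adjunction.derived_unit]
    exact adj.derivedη_fac_app W₁ α β X
  · rw [Adjunction.derived_counit]
    exact adj.derivedε_fac_app W₂ α β X

end Derived

section MapComplex

variable {A B : Type*} [Category* A] [Category* B] [Preadditive A] [Preadditive B]

/-- The adjunction on complexes induced by an adjunction of additive functors. -/
def mapComplexAdjunction {F : A ⥤ B} {G : B ⥤ A} [F.Additive] [G.Additive] (adj : F ⊣ G) :
    F.mapHomologicalComplex (ComplexShape.up ℤ) ⊣ G.mapHomologicalComplex (ComplexShape.up ℤ) :=
  { unit :=
      { app X := { f n := adj.unit.app (X.X n), comm' i j _ := (adj.unit.naturality _).symm }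
        naturality X Y g := by
          ext n
          exact adj.unit.naturality (g.f n) }
    counit :=
      { app X := { f n := adj.counit.app (X.X n), comm' i j _ := (adj.counit.naturality _).symm }
        naturality X Y g := by
          ext n
          exact adj.counit.naturality (g.f n) }
    left_triangle_components X := by
      ext n
      exact adj.left_triangle_components (X.X n)
    right_triangle_components X := by
      ext n
      exact adj.right_triangle_components (X.X n) }

end MapComplex

end

/-! ### Acyclic resolutions of complexes of modules -/

section Modules

variable {R U : Type u} [Ring R] [Ring U]

/-- The free module on the elements of a module. -/
def freeCover (R : Type u) [Ring R] : ModuleCat.{u} R ⥤ ModuleCat.{u} R :=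
  forget (ModuleCat.{u} R) ⋙ ModuleCat.free R

/-- The canonical epimorphism from the free module on the elements of a module. -/
def freeCoverπ (R : Type u) [Ring R] : freeCover R ⟶ 𝟭 _ := (ModuleCat.adj R).counit

instance (X : ModuleCat.{u} R) : Epi ((freeCoverπ R).app X) :=
  inferInstanceAs (Epi ((ModuleCat.adj R).counit.app X))

instance (X : ModuleCat.{u} R) : Projective ((freeCover R).obj X) :=
  inferInstanceAs (Projective ((ModuleCat.free R).obj _))

/-- The product of copies of `E` indexed by the homomorphisms `X ⟶ E`. For an injective
coseparator `E`, it is a functorial injective object containing `X`. -/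
def homPower (E : ModuleCat.{u} R) : ModuleCat.{u} R ⥤ ModuleCat.{u} R where
  obj X := ∏ᶜ fun (_ : X ⟶ E) => E
  map {X Y} g := Pi.lift fun h => Pi.π _ (g ≫ h)

/-- The evaluation homomorphism from `X` to the product of copies of `E` indexed by the
homomorphisms `X ⟶ E`. -/
def homPowerι (E : ModuleCat.{u} R) : 𝟭 _ ⟶ homPower E where
  app X := Pi.lift fun h => h
  naturality X Y g := by
    refine Pi.hom_ext _ _ fun h => ?_
    simp [homPower]

lemma mono_homPowerι {E : ModuleCat.{u} R} (hE : IsCoseparator E) (X : ModuleCat.{u} R) :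
    Mono ((homPowerι E).app X) := by
  refine ⟨fun a b h => hE.def _ _ fun g => ?_⟩
  have e : ∀ {T : ModuleCat.{u} R} (t : T ⟶ X),
      (t ≫ (homPowerι E).app X) ≫ Pi.π (fun (_ : X ⟶ E) => E) g = t ≫ g := fun t =>
    (Category.assoc _ _ _).trans (congrArg (t ≫ ·) (Pi.lift_π _ _))
  exact (e a).symm.trans ((congrArg (· ≫ Pi.π (fun (_ : X ⟶ E) => E) g) h).trans (e b))

lemma exists_leftAcyclic_resolution (f : R →+* U) (hfd : FlatDimensionLE f 1) :
    ∃ (r : CochainComplex (ModuleCat.{u} R) ℤ ⥤ CochainComplex (ModuleCat.{u} R) ℤ) (π : r ⟶ 𝟭 _),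
      (∀ X, QuasiIso (π.app X)) ∧ ∀ X n, LeftAcyclic (extendScalars f) ((r.obj X).X n) := by
  refine exists_left_resolution (freeCover R) (freeCoverπ R) inferInstance inferInstance
    (LeftAcyclic (extendScalars f)) (fun X _ => LeftAcyclic.of_projective X)
    (fun m _ h => LeftAcyclic.of_subobject (fun C => hfd C 2 one_lt_two) h m)
    (fun hS h1 h3 => LeftAcyclic.of_extension hS h1 h3)

lemma exists_rightAcyclic_resolution (f : R →+* U) (hpd : HasProjectiveDimensionLE (leftModU f) 1) :
    ∃ (r : CochainComplex (ModuleCat.{u} R) ℤ ⥤ CochainComplex (ModuleCat.{u} R) ℤ) (ι : 𝟭 _ ⟶ r),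
      (∀ X, QuasiIso (ι.app X)) ∧ ∀ X n, RightAcyclic.{u} (leftModU f) ((r.obj X).X n) := by
  obtain ⟨E, hE, hE'⟩ := Abelian.has_injective_coseparator (separator (ModuleCat.{u} R))
    (isSeparator_separator _)
  exact exists_right_resolution (homPower E) (homPowerι E) (mono_homPowerι hE')
    (fun X => inferInstanceAs (Injective (∏ᶜ fun (_ : X ⟶ E) => E)))
    (RightAcyclic.{u} (leftModU f)) (fun X _ => RightAcyclic.of_injective X)
    (fun m _ h => RightAcyclic.of_epi hpd h m)
    (fun hS h1 h3 => RightAcyclic.of_extension hS h1 h3)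

instance (f : R →+* U) : PreservesFiniteLimits (ModuleCat.coextendScalars.{u, u, u} f) :=
  have := (ModuleCat.restrictCoextendScalarsAdj.{u, u, u} f).isRightAdjoint
  PreservesLimitsOfSize.preservesFiniteLimits.{0, 0} _

instance (f : R →+* U) : PreservesFiniteColimits (extendScalars f) :=
  PreservesColimitsOfSize.preservesFiniteColimits.{0, 0} _

lemma epi_coextendScalars_map_iff (f : R →+* U) {X Y : ModuleCat.{u} R} (g : X ⟶ Y) :
    Epi ((ModuleCat.coextendScalars.{u, u, u} f).map g) ↔
      ∀ φ : leftModU f ⟶ Y, ∃ ψ : leftModU f ⟶ X, ψ ≫ g = φ := by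
  rw [ModuleCat.epi_iff_surjective]
  constructor
  · intro h φ
    obtain ⟨ψ, hψ⟩ := h (show (ModuleCat.coextendScalars.{u, u, u} f).obj Y from φ.hom)
    exact ⟨ModuleCat.ofHom (X := leftModU f) (Y := X) ψ, ModuleCat.hom_ext hψ⟩
  · intro h φ
    obtain ⟨ψ, hψ⟩ := h (ModuleCat.ofHom (X := leftModU f) (Y := Y) φ)
    exact ⟨ψ.hom, congrArg (fun t => t.hom) hψ⟩

lemma isZero_coextendScalars_iff (f : R →+* U) (X : ModuleCat.{u} R) :
    IsZero ((ModuleCat.coextendScalars.{u, u, u} f).obj X) ↔ Subsingleton (leftModU f ⟶ X) := by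
  rw [ModuleCat.isZero_iff_subsingleton]
  constructor
  · intro h
    exact ⟨fun a b => ModuleCat.hom_ext (h.elim (show (ModuleCat.coextendScalars.{u, u, u} f).obj X
      from a.hom) b.hom)⟩
  · intro h
    exact ⟨fun a b => congrArg (fun t => t.hom) (h.elim
      (ModuleCat.ofHom (X := leftModU f) (Y := X) a)
      (ModuleCat.ofHom (X := leftModU f) (Y := X) b))⟩

end Modules

/-! ### Tensor product with a two-term complex -/

section

open CochainComplex CochainComplex.HomComplex HomologicalComplex

open Pretriangulated

/-- A pair of composable morphisms isomorphic to the first two morphisms of a distinguished triangle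
is completed to a distinguished triangle. -/
lemma exists_distinguished_of_iso {D : Type*} [Category* D] [HasZeroObject D] [HasShift D ℤ]
    [Preadditive D] [∀ n : ℤ, (CategoryTheory.shiftFunctor D n).Additive] [Pretriangulated D]
    {T : Triangle D} (hT : T ∈ distTriang D) {X Y Z : D} (e₁ : X ≅ T.obj₁) (e₂ : Y ≅ T.obj₂)
    (e₃ : Z ≅ T.obj₃) (f : X ⟶ Y) (g : Y ⟶ Z) (comm₁ : f ≫ e₂.hom = e₁.hom ≫ T.mor₁)
    (comm₂ : g ≫ e₃.hom = e₂.hom ≫ T.mor₂) : ∃ h, Triangle.mk f g h ∈ distTriang D :=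
  ⟨e₃.hom ≫ T.mor₃ ≫ e₁.inv⟦(1 : ℤ)⟧', isomorphic_distinguished _ hT _
    (Triangle.isoMk _ _ e₁ e₂ e₃ comm₁ comm₂ (by
      change (e₃.hom ≫ T.mor₃ ≫ e₁.inv⟦(1 : ℤ)⟧') ≫ e₁.hom⟦(1 : ℤ)⟧' = e₃.hom ≫ T.mor₃
      rw [Category.assoc, Category.assoc, ← CategoryTheory.Functor.map_comp, e₁.inv_hom_id,
        CategoryTheory.Functor.map_id, Category.comp_id]))⟩

section TwoTermTensor

variable {C A : Type*} [Category* C] [Category* A] [Preadditive C] [Abelian A]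
  {F : C ⥤ A ⥤ A} [F.Additive] [∀ M, (F.obj M).Additive]
  [∀ (K : CochainComplex C ℤ) (X : CochainComplex A ℤ), HasMapBifunctor K X F (.up ℤ)]
  {K : CochainComplex C ℤ} {X Y : CochainComplex A ℤ} {y : X ⟶ Y}

variable (F K) in
/-- A presentation of the total complex `K ⊗ X`, for a complex `K` concentrated in degrees zero
and one, by a morphism of complexes `y : X ⟶ Y`: identifications of `K⁰ ⊗ X` with `X` and of
`K¹ ⊗ X` with `Y`, under which the differential of `K` corresponds to `-y`. -/
structure TensorPresentation (y : X ⟶ Y) where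
  /-- The identification of `X` with `K⁰ ⊗ X`. -/
  e₀ (p : ℤ) : X.X p ≅ (F.obj (K.X 0)).obj (X.X p)
  /-- The identification of `Y` with `K¹ ⊗ X`. -/
  e₁ (p : ℤ) : Y.X p ≅ (F.obj (K.X 1)).obj (X.X p)
  isZero (n : ℤ) (h₀ : n ≠ 0) (h₁ : n ≠ 1) : IsZero (K.X n)
  e₀_d (p : ℤ) : (e₀ p).hom ≫ (F.map (K.d 0 1)).app (X.X p) = -(y.f p ≫ (e₁ p).hom)
  e₀_naturality (p q : ℤ) :
    (e₀ p).hom ≫ (F.obj (K.X 0)).map (X.d p q) = X.d p q ≫ (e₀ q).hom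
  e₁_naturality (p q : ℤ) :
    (e₁ p).hom ≫ (F.obj (K.X 1)).map (X.d p q) = Y.d p q ≫ (e₁ q).hom

lemma ιMapBifunctor_d (X : CochainComplex A ℤ) (i j n m : ℤ) (h : i + j = n) (hm : n + 1 = m) :
    ιMapBifunctor K X F (.up ℤ) i j n h ≫ (mapBifunctor K X F (.up ℤ)).d n m =
      (F.map (K.d i (i + 1))).app (X.X j) ≫ ιMapBifunctor K X F (.up ℤ) (i + 1) j m
        (show i + 1 + j = m by lia) +
      i.negOnePow • (F.obj (K.X i)).map (X.d j (j + 1)) ≫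
        ιMapBifunctor K X F (.up ℤ) i (j + 1) m (show i + (j + 1) = m by lia) := by
  rw [mapBifunctor.d_eq, Preadditive.comp_add, mapBifunctor.ι_D₁, mapBifunctor.ι_D₂,
    mapBifunctor.d₁_eq K X F (.up ℤ) (i₁' := i + 1) rfl j m (show i + 1 + j = m by lia),
    mapBifunctor.d₂_eq K X F (.up ℤ) i (i₂' := j + 1) rfl m (show i + (j + 1) = m by lia)]
  congr 1
  exact one_smul _ _

namespace TensorPresentation

variable (P : TensorPresentation F K y)

/-- The inclusion `Xᵖ = K⁰ ⊗ Xᵖ` into the degree `q = p` term of `K ⊗ X`. -/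
def inlX (p q : ℤ) (hpq : p + 0 = q) : X.X p ⟶ (mapBifunctor K X F (.up ℤ)).X q :=
  (P.e₀ p).hom ≫ ιMapBifunctor K X F (.up ℤ) 0 p q (show 0 + p = q by lia)

/-- The inclusion `Yᵖ = K¹ ⊗ Xᵖ` into the degree `q = p + 1` term of `K ⊗ X`. -/
def inrX (p q : ℤ) (hpq : p + 1 = q) : Y.X p ⟶ (mapBifunctor K X F (.up ℤ)).X q :=
  (P.e₁ p).hom ≫ ιMapBifunctor K X F (.up ℤ) 1 p q (show 1 + p = q by lia)

lemma inlX_d (p q : ℤ) (hpq : p + 1 = q) :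
    P.inlX p p (add_zero p) ≫ (mapBifunctor K X F (.up ℤ)).d p q =
      X.d p q ≫ P.inlX q q (add_zero q) - y.f p ≫ P.inrX p q hpq := by
  subst hpq
  have h := P.e₀_d p
  have h1 := P.e₀_naturality p (p + 1)
  rw [inlX, inlX, inrX, Category.assoc, ιMapBifunctor_d X 0 p p (p + 1) (zero_add p) rfl,
    Preadditive.comp_add, Int.negOnePow_zero, one_smul, reassoc_of% h1]
  refine (congrArg (· + _) ((Category.assoc _ _ _).symm.trans (congrArg (· ≫ _) h))).trans ?_
  refine (add_comm _ _).trans ?_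
  rw [Preadditive.neg_comp, ← sub_eq_add_neg, Category.assoc]
  rfl

lemma inrX_d (p q r : ℤ) (hpq : p + 1 = q) (hqr : q + 1 = r) :
    P.inrX p q hpq ≫ (mapBifunctor K X F (.up ℤ)).d q r = -Y.d p q ≫ P.inrX q r hqr := by
  subst hpq
  have h0 : (F.map (K.d 1 (1 + 1))).app (X.X p) = 0 := by
    rw [(P.isZero (1 + 1) (by simp) (by simp)).eq_of_tgt (K.d 1 (1 + 1)) 0, Functor.map_zero,
      zero_app]
  have h1 := P.e₁_naturality p (p + 1)
  rw [inrX, inrX, Category.assoc, ιMapBifunctor_d X 1 p (p + 1) r (add_comm 1 p) hqr, h0,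
    zero_comp, zero_add, Int.negOnePow_one, Units.neg_smul, one_smul, Preadditive.comp_neg,
    reassoc_of% h1]

/-- The inclusion of `Y = K¹ ⊗ X` into `K ⊗ X`, as a cocycle of degree one. -/
def inr : Cocycle Y (mapBifunctor K X F (.up ℤ)) 1 :=
  Cocycle.mk (Cochain.mk fun p q hpq => P.inrX p q hpq) 2 rfl (by
    ext p q hpq
    rw [δ_v 1 2 rfl _ p q hpq (p + 1) (p + 1) (by lia) rfl]
    simp only [Cochain.mk_v]
    rw [P.inrX_d p (p + 1) q rfl (by lia)]
    simp [Int.negOnePow_even 2 ⟨1, rfl⟩])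

/-- The comparison from the cocone of `y : X ⟶ Y` to `K ⊗ X`. -/
def fromCocone : mappingCocone y ⟶ mapBifunctor K X F (.up ℤ) :=
  mappingCocone.desc _ (Cochain.mk fun p q hpq => P.inlX p q hpq) P.inr (by
    ext p q hpq
    rw [Cochain.add_v, δ_v 0 1 rfl _ p q hpq p q (by lia) hpq, Cochain.zero_cochain_comp_v]
    simp only [inr, Cochain.mk_v, Cocycle.mk_coe, Cochain.ofHom_v]
    rw [P.inlX_d p q hpq]
    simp only [Int.negOnePow_one, Units.neg_smul, one_smul, Cochain.zero_v]
    abel)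

/-- The projection from `K ⊗ X` onto the sum of the degree zero and degree one parts. -/
def toCoconeX (n : ℤ) : (mapBifunctor K X F (.up ℤ)).X n ⟶ (mappingCocone y).X n :=
  mapBifunctorDesc fun p q hpq =>
    if h : p = 0 then
      (F.map (K.XIsoOfEq h).hom).app (X.X q) ≫ (P.e₀ q).inv ≫ (mappingCocone.inl y).v q n
          (by subst h; rw [add_zero]; exact (zero_add q).symm.trans hpq)
    else if h : p = 1 then
      (F.map (K.XIsoOfEq h).hom).app (X.X q) ≫ (P.e₁ q).inv ≫ (mappingCocone.inr y).1.v q n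
          (by subst h; exact (add_comm q 1).trans hpq)
    else 0

lemma inlX_toCoconeX (n : ℤ) :
    P.inlX n n (add_zero n) ≫ P.toCoconeX n = (mappingCocone.inl y).v n n (add_zero n) := by
  simp [inlX, toCoconeX]

lemma inrX_toCoconeX (p n : ℤ) (h : p + 1 = n) :
    P.inrX p n h ≫ P.toCoconeX n = (mappingCocone.inr y).1.v p n h := by
  simp [inrX, toCoconeX]

lemma hom_ext {Z : A} {n : ℤ} {a b : (mapBifunctor K X F (.up ℤ)).X n ⟶ Z}
    (h₀ : P.inlX n n (add_zero n) ≫ a = P.inlX n n (add_zero n) ≫ b)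
    (h₁ : P.inrX (n - 1) n (by lia) ≫ a = P.inrX (n - 1) n (by lia) ≫ b) : a = b := by
  refine mapBifunctor.hom_ext fun p q hpq => ?_
  by_cases hp : p = 0
  · subst hp
    obtain rfl : q = n := (zero_add q).symm.trans hpq
    rwa [inlX, Category.assoc, Category.assoc, cancel_epi] at h₀
  by_cases hp' : p = 1
  · subst hp'
    have hq : 1 + q = n := hpq
    obtain rfl : q = n - 1 := by lia
    rwa [inrX, Category.assoc, Category.assoc, cancel_epi] at h₁
  · have : IsZero ((F.obj (K.X p)).obj (X.X q)) := by
      have h1 : IsZero (F.obj (K.X p)) := F.map_isZero (P.isZero p hp hp')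
      exact h1.obj _
    exact this.eq_of_src _ _

lemma cocone_hom_ext {Z : A} {n : ℤ} {a b : (mappingCocone y).X n ⟶ Z}
    (h₀ : (mappingCocone.inl y).v n n (add_zero n) ≫ a =
      (mappingCocone.inl y).v n n (add_zero n) ≫ b)
    (h₁ : (mappingCocone.inr y).1.v (n - 1) n (by lia) ≫ a =
      (mappingCocone.inr y).1.v (n - 1) n (by lia) ≫ b) : a = b := by
  have h := mappingCocone.id_X y n (n - 1) (by lia)
  rw [← Category.id_comp a, ← Category.id_comp b, ← h, Preadditive.add_comp, Preadditive.add_comp,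
    Category.assoc, Category.assoc, Category.assoc, Category.assoc, h₀, h₁]

lemma inl_fromCocone (n : ℤ) : (mappingCocone.inl y).v n n (add_zero n) ≫ P.fromCocone.f n =
    P.inlX n n (add_zero n) := by
  simp [fromCocone]

lemma inr_fromCocone (p n : ℤ) (h : p + 1 = n) :
    (mappingCocone.inr y).1.v p n h ≫ P.fromCocone.f n = P.inrX p n h := by
  simp [fromCocone, inr]

instance : IsIso P.fromCocone := by
  have : ∀ n, IsIso (P.fromCocone.f n) := fun n => by
    refine ⟨P.toCoconeX n, cocone_hom_ext ?_ ?_, P.hom_ext ?_ ?_⟩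
    · rw [reassoc_of% P.inl_fromCocone, P.inlX_toCoconeX, Category.comp_id]
    · rw [reassoc_of% P.inr_fromCocone, P.inrX_toCoconeX, Category.comp_id]
    · rw [reassoc_of% P.inlX_toCoconeX, P.inl_fromCocone, Category.comp_id]
    · rw [reassoc_of% P.inrX_toCoconeX, P.inr_fromCocone, Category.comp_id]
  exact HomologicalComplex.Hom.isIso_of_components _

/-- The projection from `K ⊗ X` to its degree zero part `X`. -/
def fst : mapBifunctor K X F (.up ℤ) ⟶ X := inv P.fromCocone ≫ mappingCocone.fst y

lemma inlX_fst (n : ℤ) : P.inlX n n (add_zero n) ≫ P.fst.f n = 𝟙 _ := by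
  have h : P.fromCocone ≫ P.fst = mappingCocone.fst y := by simp [fst]
  have h' := congrArg (fun t => t.f n) h
  rw [HomologicalComplex.comp_f] at h'
  rw [← P.inl_fromCocone, Category.assoc, h', mappingCocone.inl_v_fst_f]

lemma inrX_fst (p n : ℤ) (hpn : p + 1 = n) : P.inrX p n hpn ≫ P.fst.f n = 0 := by
  have h : P.fromCocone ≫ P.fst = mappingCocone.fst y := by simp [fst]
  have h' := congrArg (fun t => t.f n) h
  rw [HomologicalComplex.comp_f] at h'
  rw [← P.inr_fromCocone, Category.assoc, h', mappingCocone.inr_v_fst_f]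

/-- The projections to the degree zero part are natural. -/
lemma fst_naturality {X' Y' : CochainComplex A ℤ} {y' : X' ⟶ Y'} (P' : TensorPresentation F K y')
    (g : X ⟶ X') (g' : Y ⟶ Y')
    (h₀ : ∀ p, (P.e₀ p).hom ≫ (F.obj (K.X 0)).map (g.f p) = g.f p ≫ (P'.e₀ p).hom)
    (h₁ : ∀ p, (P.e₁ p).hom ≫ (F.obj (K.X 1)).map (g.f p) = g'.f p ≫ (P'.e₁ p).hom) :
    mapBifunctorMap (𝟙 K) g F (.up ℤ) ≫ P'.fst = P.fst ≫ g := by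
  ext n : 1
  rw [HomologicalComplex.comp_f, HomologicalComplex.comp_f]
  refine P.hom_ext ?_ ?_
  · have e : P.inlX n n (add_zero n) ≫ (mapBifunctorMap (𝟙 K) g F (.up ℤ)).f n =
        g.f n ≫ P'.inlX n n (add_zero n) := by
      simp [inlX, reassoc_of% h₀ n]
    rw [reassoc_of% e, inlX_fst, reassoc_of% P.inlX_fst, Category.comp_id]
  · have e : P.inrX (n - 1) n (by lia) ≫ (mapBifunctorMap (𝟙 K) g F (.up ℤ)).f n =
        g'.f (n - 1) ≫ P'.inrX (n - 1) n (by lia) := by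
      simp [inrX, reassoc_of% h₁ (n - 1)]
    rw [reassoc_of% e, inrX_fst, reassoc_of% P.inrX_fst, comp_zero, zero_comp]

lemma cocone_inl_v (y : X ⟶ Y) (n : ℤ) : (mappingCocone.inl y).v n n (add_zero n) =
    (show X.X n ⟶ (mappingCone y).X (n + -1) from (mappingCone.inl y).v n (n + -1) rfl) := by
  refine (Cochain.rightShift_v (mappingCone.inl y) (-1) 0 (zero_add _) n n (add_zero n) (n + -1)
    rfl).trans ?_
  exact Category.comp_id _

lemma cocone_inr_v (y : X ⟶ Y) (n : ℤ) : (mappingCocone.inr y).1.v (n + -1) n (by lia) =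
    (show Y.X (n + -1) ⟶ (mappingCone y).X (n + -1) from (mappingCone.inr y).f (n + -1)) := by
  refine (Cochain.rightShift_v (Cochain.ofHom (mappingCone.inr y)) (-1) 1 (by lia) (n + -1) n
    (by lia) (n + -1) (by lia)).trans ?_
  refine (congrArg (· ≫ _) (Cochain.ofHom_v (mappingCone.inr y) (n + -1))).trans ?_
  exact Category.comp_id _

/-- The map induced on `K ⊗ X` by quasi-isomorphisms of `X` and `Y` is a quasi-isomorphism. -/
lemma quasiIso_mapBifunctorMap {X' Y' : CochainComplex A ℤ} {y' : X' ⟶ Y'}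
    (P : TensorPresentation F K y) (P' : TensorPresentation F K y')
    (g : X ⟶ X') (g' : Y ⟶ Y') (comm : y ≫ g' = g ≫ y')
    (h₀ : ∀ p, (P.e₀ p).hom ≫ (F.obj (K.X 0)).map (g.f p) = g.f p ≫ (P'.e₀ p).hom)
    (h₁ : ∀ p, (P.e₁ p).hom ≫ (F.obj (K.X 1)).map (g.f p) = g'.f p ≫ (P'.e₁ p).hom)
    [QuasiIso g] [QuasiIso g'] :
    QuasiIso (mapBifunctorMap (𝟙 K) g F (.up ℤ)) := by
  have := quasiIso_mappingConeMap y y' g g' comm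
  let t : mappingCocone y ⟶ mappingCocone y' := (mappingCone.map y y' g g' comm)⟦(-1 : ℤ)⟧'
  have ht : QuasiIso t := by
    have e : QuasiIso ((mappingCone.map y y' g g' comm)⟦(-1 : ℤ)⟧') := inferInstance
    exact e
  have h : P.fromCocone ≫ mapBifunctorMap (𝟙 K) g F (.up ℤ) = t ≫ P'.fromCocone := by
    ext n : 1
    rw [HomologicalComplex.comp_f, HomologicalComplex.comp_f]
    refine cocone_hom_ext ?_ ?_
    · have e : (mappingCocone.inl y).v n n (add_zero n) ≫ t.f n =
          g.f n ≫ (mappingCocone.inl y').v n n (add_zero n) := by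
        refine (congrArg (· ≫ (mappingCone.map y y' g g' comm).f (n + -1))
          (cocone_inl_v y n)).trans (Eq.trans ?_ (congrArg (g.f n ≫ ·) (cocone_inl_v y' n)).symm)
        simp [mappingCone.map]
        rfl
      rw [reassoc_of% P.inl_fromCocone, reassoc_of% e, P'.inl_fromCocone]
      simp [inlX, reassoc_of% h₀ n]
    · have e : ∀ (p : ℤ) (hp : p + 1 = n), (mappingCocone.inr y).1.v p n hp ≫ t.f n =
          g'.f p ≫ (mappingCocone.inr y').1.v p n hp := by
        intro p hp
        obtain rfl : p = n + -1 := by lia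
        refine (congrArg (· ≫ (mappingCone.map y y' g g' comm).f (n + -1))
          (cocone_inr_v y n)).trans
            (Eq.trans ?_ (congrArg (g'.f (n + -1) ≫ ·) (cocone_inr_v y' n)).symm)
        simp [mappingCone.map]
        rfl
      rw [reassoc_of% P.inr_fromCocone, reassoc_of% e, P'.inr_fromCocone]
      simp [inrX, reassoc_of% h₁ (n - 1)]
  have : QuasiIso (P.fromCocone ≫ mapBifunctorMap (𝟙 K) g F (.up ℤ)) := by
    rw [h]
    infer_instance
  exact quasiIso_of_comp_left P.fromCocone _

/-- The distinguished triangle `K ⊗ X ⟶ X ⟶ Y ⟶ (K ⊗ X)⟦1⟧`. -/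
lemma exists_distinguished [HasDerivedCategory.{w} A] :
    ∃ h, Triangle.mk (DerivedCategory.Q.map P.fst) (DerivedCategory.Q.map y) h ∈
      distinguishedTriangles (C := DerivedCategory A) :=
  exists_distinguished_of_iso (DerivedCategory.mappingCocone_triangle_distinguished y)
    (DerivedCategory.Q.mapIso (asIso P.fromCocone).symm) (Iso.refl _) (Iso.refl _) _ _
    ((Category.comp_id _).trans (DerivedCategory.Q.map_comp _ _))
    ((Category.comp_id _).trans (Category.id_comp _).symm)

end TensorPresentation

end TwoTermTensor

end

/-! ### The complex `K[-1] ⊗_R X` as the cocone of the unit -/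

section BimoduleTensor

variable {S R : Type u} [Ring S] [Ring R]

/-- A balanced biadditive map induces an additive homomorphism out of `M ⊗_R N`. -/
lemma exists_tensorObj_addHom {M : Bimod S R} {N : ModuleCat.{u} R} {Z : Type*} [AddCommGroup Z]
    (b : (leftPart S R).obj M → N → Z) (h₁ : ∀ m m' n, b (m + m') n = b m n + b m' n)
    (h₂ : ∀ m n n', b m (n + n') = b m n + b m n')
    (hb : ∀ m r n, b ((rightAct M r).hom m) n = b m (r • n)) :
    ∃ g : tensorObj M N →+ Z, ∀ m n, g (tensorMk m n) = b m n := by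
  let b' : (leftPart S R).obj M →+ N →+ Z :=
    AddMonoidHom.mk' (fun m => AddMonoidHom.mk' (b m) (h₂ m)) fun m m' => by
      ext n
      exact h₁ m m' n
  let g₀ : (leftPart S R).obj M ⊗[ℤ] N →+ Z := TensorProduct.liftAddHom b' (fun r m n => by simp)
  have hg₀ : ∀ m n, g₀ (m ⊗ₜ n) = b m n := fun m n => rfl
  have h : ∀ t ∈ tensorRel M N, ∀ s : S, g₀ (s • t) = 0 := by
    intro t ht
    induction ht using Submodule.span_induction with
    | mem t ht =>
      obtain ⟨m, r, n, rfl⟩ := ht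
      intro s
      rw [smul_sub, TensorProduct.smul_tmul', TensorProduct.smul_tmul', map_sub, hg₀, hg₀,
        ← map_smul, hb, sub_self]
    | zero => simp
    | add x y _ _ hx hy => intro s; rw [smul_add, map_add, hx, hy, add_zero]
    | smul a x _ hx => intro s; rw [← mul_smul]; exact hx _
  refine ⟨QuotientAddGroup.lift (tensorRel M N).toAddSubgroup g₀ fun t ht => ?_, fun m n => rfl⟩
  simpa using h t ht 1

lemma tensorObj_induction {M : Bimod S R} {N : ModuleCat.{u} R} {p : tensorObj M N → Prop}
    (h0 : p 0) (hadd : ∀ a b, p a → p b → p (a + b)) (hmk : ∀ m n, p (tensorMk m n)) (t) : p t := by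
  obtain ⟨t, rfl⟩ := Submodule.Quotient.mk_surjective _ t
  induction t with
  | zero => exact h0
  | tmul m n => exact hmk m n
  | add a b ha hb => exact hadd _ _ ha hb

end BimoduleTensor

section

variable {R U : Type u} [Ring R] [Ring U]

lemma exists_regularBimod_addHom (N : ModuleCat.{u} R) :
    ∃ g : tensorObj (regularBimod R) N →+ N,
      ∀ (r : R) (n : N), g (tensorMk (M := regularBimod R) r n) = r • n :=
  exists_tensorObj_addHom (M := regularBimod R) (fun (r : R) (n : N) => r • n)
    (fun a b n => add_smul (show R from a) b n) (fun a n n' => smul_add (show R from a) n n')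
    (fun m r n => by
        change (1 * ((show R from m) * r)) • n = (show R from m) • r • n
        rw [one_mul, mul_smul])

lemma exists_bimodOf_addHom {S : Type u} [Ring S] (g : S →+* U) (f : R →+* U)
    {N : ModuleCat.{u} R} {Z : Type*} [AddCommGroup Z]
    (b : U → N → Z) (h₁ : ∀ m m' n, b (m + m') n = b m n + b m' n)
    (h₂ : ∀ m n n', b m (n + n') = b m n + b m n') (hb : ∀ m r n, b (m * f r) n = b m (r • n)) :
    ∃ h : tensorObj (bimodOf g f) N →+ Z,
      ∀ (x : U) (n : N), h (tensorMk (M := bimodOf g f) x n) = b x n :=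
  exists_tensorObj_addHom (M := bimodOf g f) b h₁ h₂ (fun m r n => by
    change b (g 1 * ((show U from m) * f r)) n = _
    rw [map_one, one_mul]
    exact hb _ _ _)

lemma extendScalars_exists_addHom (f : R →+* U)
    {N : ModuleCat.{u} R} {Z : Type*} [AddCommGroup Z]
    (b : U → N → Z) (h₁ : ∀ m m' n, b (m + m') n = b m n + b m' n)
    (h₂ : ∀ m n n', b m (n + n') = b m n + b m n') (hb : ∀ m r n, b (m * f r) n = b m (r • n)) :
    ∃ h : (extendScalars f).obj N →+ Z, ∀ (x : U) (n : N), h (extMk f x n) = b x n :=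
  exists_bimodOf_addHom _ f b h₁ h₂ hb

lemma extendScalars_addHom_ext (f : R →+* U) {N : ModuleCat.{u} R} {Z : Type*} [AddCommGroup Z]
    {a b : (extendScalars f).obj N →+ Z} (h : ∀ x n, a (extMk f x n) = b (extMk f x n)) :
    a = b :=
  AddMonoidHom.ext (extendScalars_induction (by rw [map_zero, map_zero])
    (fun s t hs ht => by rw [map_add, map_add, hs, ht]) h)

lemma bimodOf_tensorMk (f : R →+* U) {N : ModuleCat.{u} R} (x : U) (r : R) (n : N) :
    tensorMk (M := bimodOf f f) (x * f r : U) n = tensorMk (M := bimodOf f f) x (r • n) := by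
  refine Eq.trans ?_ (tensorMk_balanced (M := bimodOf f f) x r n)
  change _ = tensorMk (M := bimodOf f f) (f 1 * (x * f r) : U) n
  rw [map_one, one_mul]

lemma regularBimod_tensorMk {N : ModuleCat.{u} R} (r : R) (n : N) :
    tensorMk (M := regularBimod R) (1 : R) (r • n) = tensorMk (M := regularBimod R) r n := by
  refine (tensorMk_balanced (M := regularBimod R) (1 : R) r n).symm.trans ?_
  change tensorMk (M := regularBimod R) (1 * (1 * r) : R) n = _
  rw [one_mul, one_mul]

/-- The homomorphism `N ⟶ R ⊗_R N`, `n ↦ 1 ⊗ n`. -/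
def regularTensorHom (N : ModuleCat.{u} R) : N ⟶ tensorObj (regularBimod R) N :=
  ModuleCat.ofHom
    { toFun := fun n => tensorMk (M := regularBimod R) (1 : R) n
      map_add' := fun n n' => tensorMk_add_right _ n n'
      map_smul' := fun r n => by
        refine (regularBimod_tensorMk r n).trans ?_
        change _ = tensorMk (M := regularBimod R) (r * (1 * 1) : R) n
        rw [one_mul, mul_one] }

instance isIso_regularTensorHom (N : ModuleCat.{u} R) : IsIso (regularTensorHom N) := by
  rw [ConcreteCategory.isIso_iff_bijective]
  obtain ⟨g, hg⟩ := exists_regularBimod_addHom N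
  refine ⟨fun n n' h => ?_, tensorObj_induction ⟨0, map_zero _⟩ ?_ fun m n =>
    ⟨(show R from m) • n, regularBimod_tensorMk _ n⟩⟩
  · have h1 : g (tensorMk (M := regularBimod R) (1 : R) n) =
      g (tensorMk (M := regularBimod R) (1 : R) n') := congrArg g h
    rw [hg, hg] at h1
    simpa using h1
  · rintro _ _ ⟨a, rfl⟩ ⟨b, rfl⟩
    exact ⟨a + b, map_add _ _ _⟩

/-- The tensor product `U ⊗_R N`, formed as a left `U`-module, agrees with the one formed as a left
`R`-module. -/
lemma exists_bimodTensorHom (f : R →+* U) (N : ModuleCat.{u} R) :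
    ∃ g : (ModuleCat.restrictScalars f).obj ((extendScalars f).obj N) ⟶ tensorObj (bimodOf f f) N,
      IsIso g ∧ ∀ (x : U) (n : N), g.hom (extMk f x n) = tensorMk (M := bimodOf f f) x n := by
  obtain ⟨g, hg⟩ := extendScalars_exists_addHom f (N := N) (Z := tensorObj (bimodOf f f) N)
    (fun (x : U) n => tensorMk (M := bimodOf f f) x n)
    (fun x x' n => tensorMk_add_left (M := bimodOf f f) x x' n)
    (fun x n n' => tensorMk_add_right _ n n') (bimodOf_tensorMk f)
  obtain ⟨g', hg'⟩ := exists_bimodOf_addHom f f (N := N) (Z := (extendScalars f).obj N)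
    (fun x n => extMk f x n) extMk_add_left extMk_add_right extMk_mul
  have h1 : ∀ t, g' (g t) = t := extendScalars_induction (by simp)
    (fun a b ha hb => by rw [map_add, map_add, ha, hb]) fun x n => by rw [hg, hg']
  have h2 : ∀ t, g (g' t) = t := tensorObj_induction (by simp)
    (fun a b ha hb => by rw [map_add, map_add, ha, hb]) fun x n =>
      (congrArg g (hg' x n)).trans (hg x n)
  let G : (ModuleCat.restrictScalars f).obj ((extendScalars f).obj N) ⟶
      tensorObj (bimodOf f f) N :=
    ModuleCat.ofHom (X := (ModuleCat.restrictScalars f).obj ((extendScalars f).obj N))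
      (Y := tensorObj (bimodOf f f) N)
      { toFun := g
        map_add' := map_add g
        map_smul' := fun r t => by
          refine extendScalars_induction (p := fun t => g (f r • t) = r • g t) ?_ ?_ ?_ t
          · rw [smul_zero, map_zero, smul_zero]
          · intro a b ha hb
            rw [smul_add, map_add, map_add, smul_add, ha, hb]
          · intro x n
            rw [smul_extMk, hg, hg]
            change _ = tensorMk (M := bimodOf f f) (f r * (x * f 1)) n
            rw [map_one, mul_one] }
  refine ⟨G, ?_, hg⟩
  rw [ConcreteCategory.isIso_iff_bijective]
  exact ⟨Function.LeftInverse.injective h1, fun t => ⟨g' t, h2 t⟩⟩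

/-- The isomorphism between the two forms of the tensor product `U ⊗_R N`. -/
def bimodTensorIso (f : R →+* U) (N : ModuleCat.{u} R) :
    (ModuleCat.restrictScalars f).obj ((extendScalars f).obj N) ≅ tensorObj (bimodOf f f) N :=
  have := (exists_bimodTensorHom f N).choose_spec.1
  asIso (exists_bimodTensorHom f N).choose

lemma bimodTensorIso_hom (f : R →+* U) {N : ModuleCat.{u} R} (x : U) (n : N) :
    (bimodTensorIso f N).hom.hom (extMk f x n) = tensorMk (M := bimodOf f f) x n :=
  (exists_bimodTensorHom f N).choose_spec.2 x n

lemma bimodTensorIso_naturality (f : R →+* U) {N N' : ModuleCat.{u} R} (g : N ⟶ N') :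
    (bimodTensorIso f N).hom ≫ ((tensorBifunctor R R).obj (bimodOf f f)).map g =
      (ModuleCat.restrictScalars f).map ((extendScalars f).map g) ≫ (bimodTensorIso f N').hom := by
  have h : (tensorMap (𝟙 (bimodOf f f)) g).hom.toAddMonoidHom.comp
      (bimodTensorIso f N).hom.hom.toAddMonoidHom =
      ((bimodTensorIso f N').hom.hom.toAddMonoidHom.comp
        ((extendScalars f).map g).hom.toAddMonoidHom : (extendScalars f).obj N →+ _) :=
    extendScalars_addHom_ext f fun x n =>
      (congrArg (tensorMap (𝟙 (bimodOf f f)) g).hom (bimodTensorIso_hom f x n)).trans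
        (bimodTensorIso_hom f x (g.hom n)).symm
  exact ModuleCat.hom_ext (LinearMap.ext fun t => DFunLike.congr_fun h t)

lemma regularTensorHom_map_bimodMap (f : R →+* U) (N : ModuleCat.{u} R) :
    regularTensorHom N ≫ ((tensorBifunctor R R).map (bimodMap f)).app N =
      extUnit f N ≫ (bimodTensorIso f N).hom := by
  refine ModuleCat.hom_ext (LinearMap.ext fun n => ?_)
  refine Eq.trans ?_ (bimodTensorIso_hom f 1 n).symm
  change tensorMk (M := bimodOf f f) (f 1 : U) n = _
  rw [map_one]

/-- The isomorphism `N ≅ R ⊗_R N`. -/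
def regularTensorIso (N : ModuleCat.{u} R) : N ≅ tensorObj (regularBimod R) N :=
  asIso (regularTensorHom N)

lemma regularTensorHom_naturality {N N' : ModuleCat.{u} R} (g : N ⟶ N') :
    regularTensorHom N ≫ ((tensorBifunctor R R).obj (regularBimod R)).map g =
      g ≫ regularTensorHom N' := rfl

section

variable (f : R →+* U)

/-- The degree zero term of `K[-1]` is `R`. -/
def shiftKX₀ : ((complexK f)⟦(-1 : ℤ)⟧).X 0 ≅ regularBimod R :=
  (complexK f).XIsoOfEq (show (0 : ℤ) + -1 = -1 by simp) ≪≫ HomologicalComplex.doubleXIso₀ _ _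

/-- The degree one term of `K[-1]` is `U`. -/
def shiftKX₁ : ((complexK f)⟦(-1 : ℤ)⟧).X 1 ≅ bimodOf f f :=
  (complexK f).XIsoOfEq (show (1 : ℤ) + -1 = 0 by simp) ≪≫
    HomologicalComplex.doubleXIso₁ _ _ (by simp)

lemma shiftK_isZero (n : ℤ) (h₀ : n ≠ 0) (h₁ : n ≠ 1) : IsZero (((complexK f)⟦(-1 : ℤ)⟧).X n) :=
  HomologicalComplex.isZero_double_X (c := ComplexShape.up ℤ) (bimodMap f) (i₀ := -1) (i₁ := 0)
    (by simp) (n + -1) (by lia) (by lia)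

lemma shiftK_d :
    (shiftKX₀ f).inv ≫ ((complexK f)⟦(-1 : ℤ)⟧).d 0 1 = -(bimodMap f ≫ (shiftKX₁ f).inv) := by
  have h : (complexK f).d (-1) 0 = _ :=
    HomologicalComplex.double_d (c := ComplexShape.up ℤ) (bimodMap f) (i₀ := -1) (i₁ := 0)
      (by simp) (by simp)
  have h' : ((complexK f)⟦(-1 : ℤ)⟧).d 0 1 = -(complexK f).d (-1) 0 := by
    rw [CochainComplex.shiftFunctor_obj_d']
    simp
  rw [Iso.inv_comp_eq, Preadditive.comp_neg, h']
  refine congrArg Neg.neg (h.trans ?_)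
  simp [shiftKX₀, shiftKX₁]
  rfl

/-- The complex `K[-1] ⊗_R X` is presented by the unit `X ⟶ U ⊗_R X`. -/
def tensorPresentation (X : CochainComplex (ModuleCat.{u} R) ℤ) :
    TensorPresentation (tensorBifunctor R R) ((complexK f)⟦(-1 : ℤ)⟧)
      ((mapComplexAdjunction (extendRestrictAdj f)).unit.app X) where
  e₀ p := regularTensorIso (X.X p) ≪≫
    ((tensorBifunctor R R).mapIso (shiftKX₀ f).symm).app (X.X p)
  e₁ p := bimodTensorIso f (X.X p) ≪≫
    ((tensorBifunctor R R).mapIso (shiftKX₁ f).symm).app (X.X p)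
  isZero n h₀ h₁ := shiftK_isZero f n h₀ h₁
  e₀_d p := by
    have h := congrArg (fun t => ((tensorBifunctor R R).map t).app (X.X p)) (shiftK_d f)
    have h' := regularTensorHom_map_bimodMap f (X.X p)
    simp only [Functor.map_comp, Functor.map_neg, NatTrans.comp_app, NatTrans.app_neg] at h
    refine (Category.assoc _ _ _).trans ((congrArg (_ ≫ ·) h).trans ?_)
    refine (Preadditive.comp_neg _ _).trans ?_
    exact congrArg Neg.neg ((Category.assoc _ _ _).symm.trans
      ((congrArg (· ≫ _) h').trans (Category.assoc _ _ _)))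
  e₀_naturality p q := by
    have h := ((tensorBifunctor R R).map (shiftKX₀ f).inv).naturality (X.d p q)
    refine (Category.assoc _ _ _).trans ((congrArg (_ ≫ ·) h.symm).trans ?_)
    exact (Category.assoc _ _ _).symm.trans
      ((congrArg (· ≫ _) (regularTensorHom_naturality (X.d p q))).trans (Category.assoc _ _ _))
  e₁_naturality p q := by
    have h := ((tensorBifunctor R R).map (shiftKX₁ f).inv).naturality (X.d p q)
    refine (Category.assoc _ _ _).trans ((congrArg (_ ≫ ·) h.symm).trans ?_)
    exact (Category.assoc _ _ _).symm.trans
      ((congrArg (· ≫ _) (bimodTensorIso_naturality f (X.d p q))).trans (Category.assoc _ _ _))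

end

end

/-! ### Hom complexes out of a two-term complex as mapping cones -/

section ConePresentation

open CochainComplex CochainComplex.HomComplex HomologicalComplex Pretriangulated

variable {A : Type*} [Category* A] [Abelian A] {Y B T : CochainComplex A ℤ}

/-- A presentation of a complex `T` as the mapping cone of `c : Y ⟶ B`, by the inclusions of and
the projections onto the terms of `Y` and `B`. -/
structure ConePresentation (c : Y ⟶ B) (β : B ⟶ T) where
  /-- The inclusions of the terms of `Y`. -/
  inl (p q : ℤ) (h : q + 1 = p) : Y.X p ⟶ T.X q
  /-- The projections onto the terms of `Y`. -/
  fst (p q : ℤ) (h : q + 1 = p) : T.X q ⟶ Y.X p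
  /-- The projections onto the terms of `B`. -/
  snd (n : ℤ) : T.X n ⟶ B.X n
  inl_d (p q r : ℤ) (h : q + 1 = p) (h' : p + 1 = r) :
    inl p q h ≫ T.d q p = c.f p ≫ β.f p - Y.d p r ≫ inl r p h'
  inl_fst (p q : ℤ) (h : q + 1 = p) : inl p q h ≫ fst p q h = 𝟙 _
  inl_snd (p q : ℤ) (h : q + 1 = p) : inl p q h ≫ snd q = 0
  inr_fst (p q : ℤ) (h : q + 1 = p) : β.f q ≫ fst p q h = 0
  inr_snd (n : ℤ) : β.f n ≫ snd n = 𝟙 _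
  total (p q : ℤ) (h : q + 1 = p) : fst p q h ≫ inl p q h + snd q ≫ β.f q = 𝟙 _

namespace ConePresentation

variable {c : Y ⟶ B} {β : B ⟶ T} (P : ConePresentation c β)

/-- The comparison from the mapping cone. -/
def fromCone : mappingCone c ⟶ T :=
  mappingCone.desc c (Cochain.mk fun p q hpq => P.inl p q (by lia)) β (by
    ext p
    rw [δ_v (-1) 0 rfl _ p p (by lia) (p - 1) (p + 1) (by lia) (by lia)]
    simp only [Cochain.mk_v, Cochain.ofHom_v, HomologicalComplex.comp_f]
    rw [P.inl_d p (p - 1) (p + 1) (by lia) rfl]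
    simp)

lemma inr_fromCone : mappingCone.inr c ≫ P.fromCone = β := by
  simp [fromCone]

lemma inl_v_fromCone (p q : ℤ) (h : q + 1 = p) :
    (mappingCone.inl c).v p q (by lia) ≫ P.fromCone.f q = P.inl p q h := by
  simp [fromCone]

lemma inr_f_fromCone (q : ℤ) : (mappingCone.inr c).f q ≫ P.fromCone.f q = β.f q := by
  simp [fromCone]

instance : IsIso P.fromCone := by
  have : ∀ n, IsIso (P.fromCone.f n) := fun n => by
    refine ⟨P.fst (n + 1) n rfl ≫ (mappingCone.inl c).v (n + 1) n (by lia) +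
      P.snd n ≫ (mappingCone.inr c).f n, ?_, ?_⟩
    · refine (mappingCone.ext_from_iff c (n + 1) n rfl _ _).2 ⟨?_, ?_⟩
      · rw [reassoc_of% P.inl_v_fromCone (n + 1) n rfl, Preadditive.comp_add,
          reassoc_of% P.inl_fst, reassoc_of% P.inl_snd, zero_comp, add_zero, Category.comp_id]
      · rw [reassoc_of% P.inr_f_fromCone n, Preadditive.comp_add,
          reassoc_of% P.inr_fst, reassoc_of% P.inr_snd, zero_comp, zero_add, Category.comp_id]
    · rw [Preadditive.add_comp, Category.assoc, Category.assoc, P.inl_v_fromCone (n + 1) n rfl,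
        P.inr_f_fromCone, P.total]
  exact HomologicalComplex.Hom.isIso_of_components _

/-- A morphism between presented complexes which is induced by quasi-isomorphisms is a
quasi-isomorphism. -/
lemma quasiIso_of_compatible {Y' B' T' : CochainComplex A ℤ} {c' : Y' ⟶ B'} {β' : B' ⟶ T'}
    (P : ConePresentation c β) (P' : ConePresentation c' β') (a : Y ⟶ Y') (b : B ⟶ B') (t : T ⟶ T')
    (comm : c ≫ b = a ≫ c') (h₁ : ∀ p q h, P.inl p q h ≫ t.f q = a.f p ≫ P'.inl p q h)
    (h₂ : β ≫ t = b ≫ β') [QuasiIso a] [QuasiIso b] : QuasiIso t := by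
  have := quasiIso_mappingConeMap c c' a b comm
  have h : P.fromCone ≫ t = mappingCone.map c c' a b comm ≫ P'.fromCone := by
    ext n : 1
    rw [HomologicalComplex.comp_f, HomologicalComplex.comp_f]
    refine (mappingCone.ext_from_iff c (n + 1) n rfl _ _).2 ⟨?_, ?_⟩
    · rw [reassoc_of% P.inl_v_fromCone (n + 1) n rfl, h₁]
      simp [mappingCone.map, P'.inl_v_fromCone (n + 1) n rfl]
    · rw [reassoc_of% P.inr_f_fromCone n, ← HomologicalComplex.comp_f, h₂]
      simp [mappingCone.map, P'.inr_f_fromCone n]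
  have : QuasiIso (P.fromCone ≫ t) := by
    rw [h]
    infer_instance
  exact quasiIso_of_comp_left P.fromCone _

/-- The distinguished triangle `Y ⟶ B ⟶ T ⟶ Y⟦1⟧`. -/
lemma exists_distinguished [HasDerivedCategory.{w} A] (P : ConePresentation c β) :
    ∃ h, Triangle.mk (DerivedCategory.Q.map c) (DerivedCategory.Q.map β) h ∈
      distinguishedTriangles (C := DerivedCategory A) :=
  exists_distinguished_of_iso (DerivedCategory.mappingCone_triangle_distinguished c)
    (Iso.refl _) (Iso.refl _) (DerivedCategory.Q.mapIso (asIso P.fromCone).symm) _ _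
    ((Category.comp_id _).trans (Category.id_comp _).symm)
    (by
      refine Eq.trans ?_ (Category.id_comp _).symm
      have h : β ≫ inv P.fromCone = mappingCone.inr c :=
        (IsIso.comp_inv_eq _).2 P.inr_fromCone.symm
      exact (DerivedCategory.Q.map_comp _ _).symm.trans (congrArg _ h))

end ConePresentation

end ConePresentation

section HomCochain

open CochainComplex.HomComplex

variable {R S : Type u} [Ring R] [Ring S] {K : CochainComplex (Bimod R S) ℤ}
  {B B' : CochainComplex (ModuleCat.{u} R) ℤ}

/-- The cochain whose only nonzero component is `φ : K^p ⟶ B^q`. -/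
def singleHom {p q : ℤ} (n : ℤ) (φ : (leftPart R S).obj (K.X p) ⟶ B.X q) : HomCochain K B n :=
  Cochain.single (K := leftComplex K) φ n

/-- The component `K^p ⟶ B^q` of a cochain. -/
def evalHom {n : ℤ} (p q : ℤ) (h : p + n = q) (x : HomCochain K B n) :
    (leftPart R S).obj (K.X p) ⟶ B.X q :=
  Cochain.v (F := leftComplex K) x p q h

lemma homCochain_ext {n : ℤ} {x y : HomCochain K B n}
    (h : ∀ p q (hpq : p + n = q), evalHom p q hpq x = evalHom p q hpq y) : x = y :=
  Cochain.ext (F := leftComplex K) x y h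

lemma evalHom_add {n : ℤ} (p q : ℤ) (h : p + n = q) (x y : HomCochain K B n) :
    evalHom p q h (x + y) = evalHom p q h x + evalHom p q h y := rfl

lemma evalHom_smul {n : ℤ} (p q : ℤ) (h : p + n = q) (s : S) (x : HomCochain K B n) :
    evalHom p q h (s • x) = rightAct (K.X p) s ≫ evalHom p q h x :=
  (Cochain.zero_cochain_comp_v (F := leftComplex K) (Cochain.ofHom (rightActComplex K s)) x p q
    h).trans (congrArg (· ≫ _) (Cochain.ofHom_v (rightActComplex K s) p))

lemma evalHom_singleHom {n : ℤ} (p q : ℤ) (h : p + n = q)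
    (φ : (leftPart R S).obj (K.X p) ⟶ B.X q) : evalHom p q h (singleHom n φ) = φ :=
  Cochain.single_v (K := leftComplex K) φ n h

lemma evalHom_singleHom_of_ne {n : ℤ} (p q : ℤ) {p' q' : ℤ} (h : p' + n = q')
    (φ : (leftPart R S).obj (K.X p) ⟶ B.X q) (hp : p' ≠ p) :
    evalHom p' q' h (singleHom n φ) = 0 :=
  Cochain.single_v_eq_zero (K := leftComplex K) φ n p' q' h hp

lemma singleHom_add {p q : ℤ} (n : ℤ) (h : p + n = q)
    (φ ψ : (leftPart R S).obj (K.X p) ⟶ B.X q) :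
    singleHom n (φ + ψ) = singleHom n φ + singleHom n ψ := by
  refine homCochain_ext fun p' q' hpq => ?_
  rw [evalHom_add]
  by_cases hp : p' = p
  · subst hp
    obtain rfl : q = q' := h.symm.trans hpq
    rw [evalHom_singleHom, evalHom_singleHom, evalHom_singleHom]
  · rw [evalHom_singleHom_of_ne _ _ _ _ hp, evalHom_singleHom_of_ne _ _ _ _ hp,
      evalHom_singleHom_of_ne _ _ _ _ hp, add_zero]

lemma singleHom_neg {p q : ℤ} (n : ℤ) (h : p + n = q)
    (φ : (leftPart R S).obj (K.X p) ⟶ B.X q) : singleHom n (-φ) = -singleHom n φ :=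
  (AddMonoidHom.mk' (fun φ => singleHom (K := K) (B := B) (p := p) (q := q) n φ)
    (singleHom_add n h)).map_neg φ

lemma singleHom_zero {p q : ℤ} (n : ℤ) (h : p + n = q) :
    singleHom n (0 : (leftPart R S).obj (K.X p) ⟶ B.X q) = 0 :=
  (AddMonoidHom.mk' (fun φ => singleHom (K := K) (B := B) (p := p) (q := q) n φ)
    (singleHom_add n h)).map_zero

lemma singleHom_units_smul {p q : ℤ} (n : ℤ) (h : p + n = q) (a : ℤˣ)
    (φ : (leftPart R S).obj (K.X p) ⟶ B.X q) : singleHom n (a • φ) = a • singleHom n φ := by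
  rcases Int.units_eq_one_or a with rfl | rfl
  · rw [one_smul, one_smul]
  · rw [Units.neg_smul, Units.neg_smul, one_smul, one_smul, singleHom_neg n h]

lemma singleHom_smul {p q : ℤ} (n : ℤ) (h : p + n = q) (s : S)
    (φ : (leftPart R S).obj (K.X p) ⟶ B.X q) :
    singleHom n (rightAct (K.X p) s ≫ φ) = s • singleHom n φ := by
  refine homCochain_ext fun p' q' hpq => ?_
  rw [evalHom_smul]
  by_cases hp : p' = p
  · subst hp
    obtain rfl : q = q' := h.symm.trans hpq
    rw [evalHom_singleHom, evalHom_singleHom]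
  · rw [evalHom_singleHom_of_ne _ _ _ _ hp, evalHom_singleHom_of_ne _ _ _ _ hp, comp_zero]

lemma singleHom_comp {p q : ℤ} (n : ℤ) (h : p + n = q) (g : B ⟶ B')
    (φ : (leftPart R S).obj (K.X p) ⟶ B.X q) :
    ((homComplex K).map g).f n (singleHom n φ) = singleHom n (φ ≫ g.f q) := by
  refine homCochain_ext fun p' q' hpq => ?_
  have e : ∀ x : HomCochain K B n, evalHom p' q' hpq (((homComplex K).map g).f n x) =
      evalHom p' q' hpq x ≫ g.f q' := fun x =>
    (Cochain.comp_zero_cochain_v (F := leftComplex K) x (Cochain.ofHom g) p' q' hpq).trans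
      (congrArg (_ ≫ ·) (Cochain.ofHom_v g q'))
  refine (e _).trans ?_
  by_cases hp : p' = p
  · subst hp
    obtain rfl : q = q' := h.symm.trans hpq
    rw [evalHom_singleHom, evalHom_singleHom]
  · rw [evalHom_singleHom_of_ne _ _ _ _ hp, evalHom_singleHom_of_ne _ _ _ _ hp, zero_comp]

lemma homD_singleHom {p q : ℤ} (n m : ℤ) (hm : n + 1 = m) (p' q' : ℤ) (hp' : p' + 1 = p)
    (hq' : q + 1 = q') (φ : (leftPart R S).obj (K.X p) ⟶ B.X q) :
    homD K B n m (singleHom n φ) = singleHom m (φ ≫ B.d q q') +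
      m.negOnePow • singleHom m ((leftPart R S).map (K.d p' p) ≫ φ) :=
  Cochain.δ_single (K := leftComplex K) φ n m hm p' q' hp' hq'

end HomCochain

/-! ### The complex `Hom_R(K[-1], B)` as the cone of the counit -/

section HomPresentation

variable {R U : Type u} [Ring R] [Ring U] (f : R →+* U)

/-- The right multiplication by an element of a ring. -/
def mulRightHom (A : Type u) [Ring A] (a : A) : ModuleCat.of A A ⟶ ModuleCat.of A A :=
  ModuleCat.ofHom (LinearMap.toSpanSingleton A A a)

/-- A ring homomorphism `f : R → U`, as a morphism of left `R`-modules. -/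
def ringHomModU : ModuleCat.of R R ⟶ leftModU f :=
  ModuleCat.ofHom (Y := leftModU f)
    { toFun := fun r => f r
      map_add' := fun r s => map_add f r s
      map_smul' := fun r s => map_mul f r s }

/-- The left module underlying the regular bimodule. -/
def leftPartRegular : (leftPart R R).obj (regularBimod R) ≅ ModuleCat.of R R where
  hom := ModuleCat.ofHom (X := (leftPart R R).obj (regularBimod R)) (Y := ModuleCat.of R R)
    { toFun := fun (x : R) => x
      map_add' := fun _ _ => rfl
      map_smul' := fun r x => by
        change r * ((show R from x) * 1) = r * (show R from x)
        rw [mul_one] }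
  inv := ModuleCat.ofHom (X := ModuleCat.of R R) (Y := (leftPart R R).obj (regularBimod R))
    { toFun := fun (x : R) => x
      map_add' := fun _ _ => rfl
      map_smul' := fun r x => by
        change r * (show R from x) = r * ((show R from x) * 1)
        rw [mul_one] }

/-- The left module underlying the bimodule `U`. -/
def leftPartBimodOf : (leftPart R R).obj (bimodOf f f) ≅ leftModU f where
  hom := ModuleCat.ofHom (X := (leftPart R R).obj (bimodOf f f)) (Y := leftModU f)
    { toFun := fun (x : U) => x
      map_add' := fun _ _ => rfl
      map_smul' := fun r x => by
        change f r * ((show U from x) * f 1) = f r * (show U from x)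
        rw [map_one, mul_one] }
  inv := ModuleCat.ofHom (X := leftModU f) (Y := (leftPart R R).obj (bimodOf f f))
    { toFun := fun (x : U) => x
      map_add' := fun _ _ => rfl
      map_smul' := fun r x => by
        change f r * (show U from x) = f r * ((show U from x) * f 1)
        rw [map_one, mul_one] }

/-- The left module underlying the degree zero term of `K[-1]`. -/
def leftX₀ : (leftPart R R).obj (((complexK f)⟦(-1 : ℤ)⟧).X 0) ≅ ModuleCat.of R R :=
  (leftPart R R).mapIso (shiftKX₀ f) ≪≫ leftPartRegular

/-- The left module underlying the degree one term of `K[-1]`. -/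
def leftX₁ : (leftPart R R).obj (((complexK f)⟦(-1 : ℤ)⟧).X 1) ≅ leftModU f :=
  (leftPart R R).mapIso (shiftKX₁ f) ≪≫ leftPartBimodOf f

/-- The right multiplication by `f r` on `U`, as a morphism of left `R`-modules. -/
def mulRightModU (u : U) : leftModU f ⟶ leftModU f :=
  (ModuleCat.restrictScalars f).map (mulRightHom U u)

lemma leftPart_map_d : (leftPart R R).map (((complexK f)⟦(-1 : ℤ)⟧).d 0 1) ≫ (leftX₁ f).hom =
    -((leftX₀ f).hom ≫ ringHomModU f) := by
  have h : ((complexK f)⟦(-1 : ℤ)⟧).d 0 1 ≫ (shiftKX₁ f).hom =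
      -((shiftKX₀ f).hom ≫ bimodMap f) := by
    have h := shiftK_d f
    rw [Iso.inv_comp_eq] at h
    rw [h, Category.assoc, Preadditive.neg_comp, Category.assoc, Iso.inv_hom_id, Category.comp_id,
      Preadditive.comp_neg]
  have h1 := congrArg (fun t => (leftPart R R).map t) h
  have h2 : (leftPart R R).map (bimodMap f) ≫ (leftPartBimodOf f).hom =
    leftPartRegular.hom ≫ ringHomModU f := rfl
  simp only [Functor.map_comp, Functor.map_neg] at h1
  refine (Category.assoc _ _ _).symm.trans ((congrArg (· ≫ _) h1).trans ?_)
  refine (Preadditive.neg_comp _ _).trans (congrArg Neg.neg ?_)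
  exact (Category.assoc _ _ _).trans ((congrArg (_ ≫ ·) h2).trans (Category.assoc _ _ _).symm)

lemma rightAct_leftX₀ (r : R) : rightAct (((complexK f)⟦(-1 : ℤ)⟧).X 0) r ≫ (leftX₀ f).hom =
    (leftX₀ f).hom ≫ mulRightHom R r := by
  have h := rightAct_naturality (shiftKX₀ f).hom r
  have h2 : rightAct (regularBimod R) r ≫ leftPartRegular.hom =
      leftPartRegular.hom ≫ mulRightHom R r := by
    refine ModuleCat.hom_ext (LinearMap.ext fun x => ?_)
    change 1 * ((show R from x) * r) = (show R from x) * r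
    rw [one_mul]
  refine (Category.assoc _ _ _).symm.trans ((congrArg (· ≫ _) h.symm).trans ?_)
  exact (Category.assoc _ _ _).trans ((congrArg (_ ≫ ·) h2).trans (Category.assoc _ _ _).symm)

lemma rightAct_leftX₁ (r : R) : rightAct (((complexK f)⟦(-1 : ℤ)⟧).X 1) r ≫ (leftX₁ f).hom =
    (leftX₁ f).hom ≫ mulRightModU f (f r) := by
  have h := rightAct_naturality (shiftKX₁ f).hom r
  have h2 : rightAct (bimodOf f f) r ≫ (leftPartBimodOf f).hom =
      (leftPartBimodOf f).hom ≫ mulRightModU f (f r) := by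
    refine ModuleCat.hom_ext (LinearMap.ext fun x => ?_)
    change f 1 * ((show U from x) * f r) = (show U from x) * f r
    rw [map_one, one_mul]
  refine (Category.assoc _ _ _).symm.trans ((congrArg (· ≫ _) h.symm).trans ?_)
  exact (Category.assoc _ _ _).trans ((congrArg (_ ≫ ·) h2).trans (Category.assoc _ _ _).symm)

/-- The counit of the adjunction between restriction and coextension of scalars, on complexes. -/
abbrev coextCounit (B : CochainComplex (ModuleCat.{u} R) ℤ) :
    ((ModuleCat.restrictScalars.{u} f).mapHomologicalComplex (ComplexShape.up ℤ)).obj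
      (((ModuleCat.coextendScalars.{u, u, u} f).mapHomologicalComplex (ComplexShape.up ℤ)).obj B) ⟶
      B :=
  (mapComplexAdjunction (ModuleCat.restrictCoextendScalarsAdj.{u, u, u} f)).counit.app B

variable {B : CochainComplex (ModuleCat.{u} R) ℤ}

/-- The `R`-module of `R`-linear maps `U → N`. -/
def coextObj (N : ModuleCat.{u} R) : ModuleCat.{u} R :=
  (ModuleCat.restrictScalars.{u} f).obj ((ModuleCat.coextendScalars.{u, u, u} f).obj N)

variable {f} in
/-- The homomorphism `U ⟶ N` corresponding to an element of the coextension of scalars. -/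
def coextToHom {N : ModuleCat.{u} R} (h : coextObj f N) : leftModU f ⟶ N :=
  ModuleCat.ofHom (X := leftModU f) (Y := N)
    (show (ModuleCat.restrictScalars f).obj (ModuleCat.of U U) →ₗ[R] N from h)

variable {f} in
/-- The element of the coextension of scalars corresponding to a homomorphism `U ⟶ N`. -/
def coextOfHom {N : ModuleCat.{u} R} (φ : leftModU f ⟶ N) : coextObj f N :=
  show (ModuleCat.restrictScalars f).obj (ModuleCat.of U U) →ₗ[R] N from φ.hom

lemma coextToHom_smul {N : ModuleCat.{u} R} (r : R) (h : coextObj f N) :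
    coextToHom (r • h) = mulRightModU f (f r) ≫ coextToHom h := rfl

lemma coextOfHom_smul {N : ModuleCat.{u} R} (r : R) (φ : leftModU f ⟶ N) :
    coextOfHom (mulRightModU f (f r) ≫ φ) = r • coextOfHom φ := rfl

lemma comp_units_smul {C : Type*} [Category* C] [Preadditive C] {X Y Z : C} (g : X ⟶ Y) (a : ℤˣ)
    (h : Y ⟶ Z) : g ≫ (a • h) = a • g ≫ h := by
  rcases Int.units_eq_one_or a with rfl | rfl
  · rw [one_smul, one_smul]
  · rw [Units.neg_smul, Units.neg_smul, one_smul, one_smul, Preadditive.comp_neg]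

lemma units_smul_comp {C : Type*} [Category* C] [Preadditive C] {X Y Z : C} (a : ℤˣ) (g : X ⟶ Y)
    (h : Y ⟶ Z) : (a • g) ≫ h = a • g ≫ h := by
  rcases Int.units_eq_one_or a with rfl | rfl
  · rw [one_smul, one_smul]
  · rw [Units.neg_smul, Units.neg_smul, one_smul, one_smul, Preadditive.neg_comp]

/-- The inclusion of the terms `Hom_R(U, B^p)` into the complex `Hom_R(K[-1], B)`. The sign
`(-1)^q` absorbs the signs of the shift and of the differential of the Hom complex. -/
def homInl (B : CochainComplex (ModuleCat.{u} R) ℤ) (p q : ℤ) (h : q + 1 = p) :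
    coextObj f (B.X p) ⟶ ((homComplex ((complexK f)⟦(-1 : ℤ)⟧)).obj B).X q :=
  ModuleCat.ofHom (X := coextObj f (B.X p))
    (Y := ModuleCat.of R (HomCochain ((complexK f)⟦(-1 : ℤ)⟧) B q))
    { toFun := fun x => singleHom q (q.negOnePow • (leftX₁ f).hom ≫ coextToHom x)
      map_add' := fun x y => by
        rw [← singleHom_add _ (by lia), ← smul_add, ← Preadditive.comp_add]
        rfl
      map_smul' := fun r x => by
        refine (congrArg (fun t => singleHom q (q.negOnePow • (leftX₁ f).hom ≫ t))
          (coextToHom_smul f r x)).trans ?_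
        rw [← Category.assoc, ← rightAct_leftX₁, Category.assoc, ← comp_units_smul,
          singleHom_smul _ (by lia)]
        rfl }

/-- The inclusion of the terms of `B` into the complex `Hom_R(K[-1], B)`. -/
def homInrX (B : CochainComplex (ModuleCat.{u} R) ℤ) (n : ℤ) :
    B.X n ⟶ ((homComplex ((complexK f)⟦(-1 : ℤ)⟧)).obj B).X n :=
  ModuleCat.ofHom (X := B.X n)
    (Y := ModuleCat.of R (HomCochain ((complexK f)⟦(-1 : ℤ)⟧) B n))
    { toFun := fun b => singleHom n ((leftX₀ f).hom ≫
        ModuleCat.ofHom (LinearMap.toSpanSingleton R (B.X n) b))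
      map_add' := fun x y => by
        rw [← singleHom_add _ (by lia), ← Preadditive.comp_add]
        congr 2
        ext
        simp
      map_smul' := fun r x => by
        have : ModuleCat.ofHom (LinearMap.toSpanSingleton R (B.X n) (r • x)) =
          mulRightHom R r ≫ ModuleCat.ofHom (LinearMap.toSpanSingleton R (B.X n) x) := by
          ext
          simp [mulRightHom]
        rw [this, ← Category.assoc, ← rightAct_leftX₀, Category.assoc,
          singleHom_smul _ (by lia)]
        rfl }

/-- The projection of the complex `Hom_R(K[-1], B)` onto the terms `Hom_R(U, B^p)`. -/
def homFst (B : CochainComplex (ModuleCat.{u} R) ℤ) (p q : ℤ) (h : q + 1 = p) :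
    ((homComplex ((complexK f)⟦(-1 : ℤ)⟧)).obj B).X q ⟶ coextObj f (B.X p) :=
  ModuleCat.ofHom (X := ModuleCat.of R (HomCochain ((complexK f)⟦(-1 : ℤ)⟧) B q))
    (Y := coextObj f (B.X p))
    { toFun := fun x => coextOfHom (q.negOnePow • (leftX₁ f).inv ≫ evalHom 1 p (by lia) x)
      map_add' := fun x y => by
        rw [evalHom_add, Preadditive.comp_add, smul_add]
        rfl
      map_smul' := fun r x => by
        have h := rightAct_leftX₁ f r
        rw [← Iso.inv_comp_eq, ← Category.assoc, ← Iso.eq_comp_inv] at h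
        rw [evalHom_smul, ← Category.assoc, h, Category.assoc, ← comp_units_smul,
          coextOfHom_smul]
        rfl }

/-- The projection of the complex `Hom_R(K[-1], B)` onto the terms of `B`. -/
def homSnd (B : CochainComplex (ModuleCat.{u} R) ℤ) (n : ℤ) :
    ((homComplex ((complexK f)⟦(-1 : ℤ)⟧)).obj B).X n ⟶ B.X n :=
  ModuleCat.ofHom (X := ModuleCat.of R (HomCochain ((complexK f)⟦(-1 : ℤ)⟧) B n))
    (Y := B.X n)
    { toFun := fun x => ((leftX₀ f).inv ≫ evalHom 0 n (by lia) x).hom (1 : R)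
      map_add' := fun x y => by
        rw [evalHom_add, Preadditive.comp_add]
        rfl
      map_smul' := fun r x => by
        have h := rightAct_leftX₀ f r
        rw [← Iso.inv_comp_eq, ← Category.assoc, ← Iso.eq_comp_inv] at h
        rw [evalHom_smul, ← Category.assoc, h, Category.assoc]
        refine Eq.trans ?_ (map_smul ((leftX₀ f).inv ≫ evalHom 0 n _ x).hom r (1 : R))
        change ((leftX₀ f).inv ≫ evalHom 0 n _ x).hom ((1 : R) • r) = _
        simp }

lemma homCochain_hom_ext {n : ℤ} {x y : HomCochain ((complexK f)⟦(-1 : ℤ)⟧) B n}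
    (h₀ : evalHom 0 n (zero_add n) x = evalHom 0 n (zero_add n) y)
    (h₁ : evalHom 1 (n + 1) (add_comm 1 n) x = evalHom 1 (n + 1) (add_comm 1 n) y) : x = y := by
  refine homCochain_ext fun p q hpq => ?_
  by_cases hp : p = 0
  · subst hp
    obtain rfl : n = q := (zero_add n).symm.trans hpq
    exact h₀
  by_cases hp' : p = 1
  · subst hp'
    obtain rfl : n + 1 = q := (add_comm n 1).trans hpq
    exact h₁
  · exact ((leftPart R R).map_isZero (shiftK_isZero f p hp hp')).eq_of_src _ _

/-- The inclusion of `B` into the complex `Hom_R(K[-1], B)`. -/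
def homInr (B : CochainComplex (ModuleCat.{u} R) ℤ) :
    B ⟶ (homComplex ((complexK f)⟦(-1 : ℤ)⟧)).obj B where
  f n := homInrX f B n
  comm' n m hnm := by
    refine ModuleCat.hom_ext (LinearMap.ext fun b => ?_)
    have h := homD_singleHom (K := (complexK f)⟦(-1 : ℤ)⟧) n m hnm (-1) m (by simp) hnm
      ((leftX₀ f).hom ≫ ModuleCat.ofHom (LinearMap.toSpanSingleton R (B.X n) b))
    have h0 : ((complexK f)⟦(-1 : ℤ)⟧).d (-1) 0 = 0 :=
      (shiftK_isZero f (-1) (by simp) (by simp)).eq_of_src _ _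
    have h1 : ModuleCat.ofHom (LinearMap.toSpanSingleton R (B.X n) b) ≫ B.d n m =
        ModuleCat.ofHom (LinearMap.toSpanSingleton R (B.X m) ((B.d n m).hom b)) := by
      ext
      simp
    rw [h0, Functor.map_zero, zero_comp, singleHom_zero m (by have : n + 1 = m := hnm; lia),
      smul_zero, add_zero, Category.assoc, h1] at h
    exact h

lemma homInr_naturality {B B' : CochainComplex (ModuleCat.{u} R) ℤ} (g : B ⟶ B') :
    homInr f B ≫ (homComplex ((complexK f)⟦(-1 : ℤ)⟧)).map g = g ≫ homInr f B' := by
  ext n : 1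
  refine ModuleCat.hom_ext (LinearMap.ext fun b => ?_)
  refine (singleHom_comp (K := (complexK f)⟦(-1 : ℤ)⟧) n (zero_add n) g
      ((leftX₀ f).hom ≫ ModuleCat.ofHom (LinearMap.toSpanSingleton R (B.X n) b))).trans ?_
  have h1 : ModuleCat.ofHom (LinearMap.toSpanSingleton R (B.X n) b) ≫ g.f n =
      ModuleCat.ofHom (LinearMap.toSpanSingleton R (B'.X n) ((g.f n).hom b)) := by
    ext
    simp
  rw [Category.assoc, h1]
  rfl

lemma homInl_d (B : CochainComplex (ModuleCat.{u} R) ℤ) (p q r : ℤ) (h : q + 1 = p)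
    (h' : p + 1 = r) (x : coextObj f (B.X p)) :
    homD ((complexK f)⟦(-1 : ℤ)⟧) B q p
      (singleHom q (q.negOnePow • (leftX₁ f).hom ≫ coextToHom x)) =
      singleHom p ((leftX₀ f).hom ≫ ringHomModU f ≫ coextToHom x) -
      singleHom p (p.negOnePow • (leftX₁ f).hom ≫ coextToHom x ≫ B.d p r) := by
  have h2 : (leftPart R R).map (((complexK f)⟦(-1 : ℤ)⟧).d 0 1) ≫ (leftX₁ f).hom ≫
      coextToHom x = -((leftX₀ f).hom ≫ ringHomModU f ≫ coextToHom x) := by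
    refine (Category.assoc _ _ _).symm.trans ((congrArg (· ≫ _) (leftPart_map_d f)).trans ?_)
    rw [Preadditive.neg_comp, Category.assoc]
  have h3 : p.negOnePow = -q.negOnePow := by rw [← h, Int.negOnePow_succ]
  refine (homD_singleHom (K := (complexK f)⟦(-1 : ℤ)⟧) q p h 0 r (by simp) h'
    (q.negOnePow • (leftX₁ f).hom ≫ coextToHom x)).trans ?_
  rw [comp_units_smul, h2, units_smul_comp, Category.assoc, singleHom_units_smul _ (by lia),
    singleHom_units_smul _ (by lia), singleHom_units_smul _ (by lia),
    singleHom_neg _ (by lia), h3]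
  rcases Int.units_eq_one_or q.negOnePow with hq | hq
  · rw [hq]
    simp only [one_smul, Units.neg_smul, neg_neg, sub_neg_eq_add]
    abel
  · rw [hq]
    simp only [neg_neg, one_smul, Units.neg_smul]
    abel

lemma ofHom_toSpanSingleton {N : ModuleCat.{u} R} (φ : ModuleCat.of R R ⟶ N) :
    ModuleCat.ofHom (LinearMap.toSpanSingleton R N (φ.hom (1 : R))) = φ := by
  ext
  simp

/-- The counit `Hom_R(U, N) ⟶ N` is the precomposition with `f : R → U`, up to `Hom_R(R, N) = N`. -/
lemma ringHomModU_comp (N : ModuleCat.{u} R) (x : coextObj f N) :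
    ringHomModU f ≫ coextToHom x = ModuleCat.ofHom (LinearMap.toSpanSingleton R N
      (((ModuleCat.restrictCoextendScalarsAdj.{u, u, u} f).counit.app N).hom x)) := by
  rw [← ofHom_toSpanSingleton (ringHomModU f ≫ coextToHom x)]
  congr 2
  change (coextToHom x).hom (f 1 : U) = (coextToHom x).hom (1 : U)
  rw [map_one]

lemma homInl_d_f (B : CochainComplex (ModuleCat.{u} R) ℤ) (p q r : ℤ) (h : q + 1 = p)
    (h' : p + 1 = r) :
    homInl f B p q h ≫ ((homComplex ((complexK f)⟦(-1 : ℤ)⟧)).obj B).d q p =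
      (show coextObj f (B.X p) ⟶ B.X p from
        (ModuleCat.restrictCoextendScalarsAdj.{u, u, u} f).counit.app (B.X p)) ≫ homInrX f B p -
      (show coextObj f (B.X p) ⟶ coextObj f (B.X r) from
        (ModuleCat.restrictScalars.{u} f).map ((ModuleCat.coextendScalars.{u, u, u} f).map
          (B.d p r))) ≫ homInl f B r p h' :=
  ModuleCat.hom_ext (LinearMap.ext fun x => (homInl_d f B p q r h h' x).trans
    (congrArg (fun t => singleHom p ((leftX₀ f).hom ≫ t) -
      singleHom p (p.negOnePow • (leftX₁ f).hom ≫ coextToHom x ≫ B.d p r))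
        (ringHomModU_comp f (B.X p) x)))

lemma homInl_homFst (p q : ℤ) (h : q + 1 = p) : homInl f B p q h ≫ homFst f B p q h = 𝟙 _ := by
  have h : ∀ x : coextObj f (B.X p), coextOfHom (q.negOnePow • (leftX₁ f).inv ≫
      evalHom 1 p (by lia) (singleHom (K := (complexK f)⟦(-1 : ℤ)⟧) q
        (q.negOnePow • (leftX₁ f).hom ≫ coextToHom x))) = x := fun x => by
    rw [evalHom_singleHom, comp_units_smul, Iso.inv_hom_id_assoc, smul_smul, Int.units_mul_self,
      one_smul]
    rfl
  exact ModuleCat.hom_ext (LinearMap.ext h)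

lemma homInl_homSnd (p q : ℤ) (h : q + 1 = p) : homInl f B p q h ≫ homSnd f B q = 0 := by
  have h : ∀ x : coextObj f (B.X p), ((leftX₀ f).inv ≫
      evalHom 0 q (by lia) (singleHom (K := (complexK f)⟦(-1 : ℤ)⟧) q
        (q.negOnePow • (leftX₁ f).hom ≫ coextToHom x))).hom (1 : R) = 0 := fun x => by
    rw [evalHom_singleHom_of_ne _ _ _ _ zero_ne_one, comp_zero]
    rfl
  exact ModuleCat.hom_ext (LinearMap.ext h)

lemma homInrX_homFst (p q : ℤ) (h : q + 1 = p) : homInrX f B q ≫ homFst f B p q h = 0 := by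
  have h : ∀ x : B.X q, coextOfHom (q.negOnePow • (leftX₁ f).inv ≫
      evalHom 1 p (by lia) (singleHom (K := (complexK f)⟦(-1 : ℤ)⟧) (B := B) q
        ((leftX₀ f).hom ≫ ModuleCat.ofHom (LinearMap.toSpanSingleton R (B.X q) x)))) = 0 :=
    fun x => by
    rw [evalHom_singleHom_of_ne _ _ _ _ one_ne_zero, comp_zero, smul_zero]
    rfl
  exact ModuleCat.hom_ext (LinearMap.ext h)

lemma homInrX_homSnd (n : ℤ) : homInrX f B n ≫ homSnd f B n = 𝟙 _ := by
  have h : ∀ x : B.X n, ((leftX₀ f).inv ≫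
      evalHom 0 n (by lia) (singleHom (K := (complexK f)⟦(-1 : ℤ)⟧) (B := B) n
        ((leftX₀ f).hom ≫ ModuleCat.ofHom (LinearMap.toSpanSingleton R (B.X n) x)))).hom (1 : R) =
      x := fun x => by
    rw [evalHom_singleHom, Iso.inv_hom_id_assoc]
    exact one_smul R x
  exact ModuleCat.hom_ext (LinearMap.ext h)

lemma hom_total (p q : ℤ) (h : q + 1 = p) :
    homFst f B p q h ≫ homInl f B p q h + homSnd f B q ≫ homInrX f B q = 𝟙 _ := by
  subst h
  have h : ∀ x : HomCochain ((complexK f)⟦(-1 : ℤ)⟧) B q,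
      singleHom q (q.negOnePow • (leftX₁ f).hom ≫ coextToHom (coextOfHom
        (q.negOnePow • (leftX₁ f).inv ≫ evalHom 1 (q + 1) (by lia) x))) +
      singleHom q ((leftX₀ f).hom ≫ ModuleCat.ofHom (LinearMap.toSpanSingleton R (B.X q)
        (((leftX₀ f).inv ≫ evalHom 0 q (by lia) x).hom (1 : R)))) = x := fun x => by
    rw [ofHom_toSpanSingleton, Iso.hom_inv_id_assoc]
    have e : ∀ φ : leftModU f ⟶ B.X (q + 1), coextToHom (coextOfHom φ) = φ := fun φ => rfl
    rw [e, comp_units_smul, smul_smul, Int.units_mul_self, one_smul, Iso.hom_inv_id_assoc]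
    refine homCochain_hom_ext f ?_ ?_
    · rw [evalHom_add, evalHom_singleHom_of_ne _ _ _ _ zero_ne_one, evalHom_singleHom, zero_add]
    · rw [evalHom_add, evalHom_singleHom_of_ne 0 _ _ _ one_ne_zero, evalHom_singleHom, add_zero]
  exact ModuleCat.hom_ext (LinearMap.ext h)

/-- The complex `Hom_R(K[-1], B)` is the mapping cone of the counit `Hom_R(U, B) ⟶ B`. -/
def homPresentation (B : CochainComplex (ModuleCat.{u} R) ℤ) :
    ConePresentation (coextCounit f B) (homInr f B) where
  inl p q h := homInl f B p q h
  fst p q h := homFst f B p q h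
  snd n := homSnd f B n
  inl_d p q r h h' := homInl_d_f f B p q r h h'
  inl_fst p q h := homInl_homFst f p q h
  inl_snd p q h := homInl_homSnd f p q h
  inr_fst p q h := homInrX_homFst f p q h
  inr_snd n := homInrX_homSnd f n
  total p q h := hom_total f p q h

end HomPresentation

/-! ### Compatibility with quasi-isomorphisms and cohomology -/

section Compatibility

variable {R U : Type u} [Ring R] [Ring U] (f : R →+* U)

/-- The functor `X ↦ U ⊗_R X` on complexes. -/
abbrev extendComplex : CochainComplex (ModuleCat.{u} R) ℤ ⥤ CochainComplex (ModuleCat.{u} U) ℤ :=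
  (extendScalars f).mapHomologicalComplex (ComplexShape.up ℤ)

/-- The functor `X ↦ Hom_R(U, X)` on complexes. -/
abbrev coextendComplex : CochainComplex (ModuleCat.{u} R) ℤ ⥤ CochainComplex (ModuleCat.{u} U) ℤ :=
  (ModuleCat.coextendScalars.{u, u, u} f).mapHomologicalComplex (ComplexShape.up ℤ)

/-- The restriction of scalars on complexes. -/
abbrev restrictComplex : CochainComplex (ModuleCat.{u} U) ℤ ⥤ CochainComplex (ModuleCat.{u} R) ℤ :=
  (ModuleCat.restrictScalars.{u} f).mapHomologicalComplex (ComplexShape.up ℤ)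

lemma tensorPresentation_e₀_naturality {X X' : CochainComplex (ModuleCat.{u} R) ℤ} (g : X ⟶ X')
    (p : ℤ) : ((tensorPresentation f X).e₀ p).hom ≫
      ((tensorBifunctor R R).obj (((complexK f)⟦(-1 : ℤ)⟧).X 0)).map (g.f p) =
      g.f p ≫ ((tensorPresentation f X').e₀ p).hom := by
  have h := ((tensorBifunctor R R).map (shiftKX₀ f).inv).naturality (g.f p)
  refine (Category.assoc _ _ _).trans ((congrArg (_ ≫ ·) h.symm).trans ?_)
  exact (Category.assoc _ _ _).symm.trans
    ((congrArg (· ≫ _) (regularTensorHom_naturality (g.f p))).trans (Category.assoc _ _ _))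

lemma tensorPresentation_e₁_naturality {X X' : CochainComplex (ModuleCat.{u} R) ℤ} (g : X ⟶ X')
    (p : ℤ) : ((tensorPresentation f X).e₁ p).hom ≫
      ((tensorBifunctor R R).obj (((complexK f)⟦(-1 : ℤ)⟧).X 1)).map (g.f p) =
      ((restrictComplex f).map ((extendComplex f).map g)).f p ≫
        ((tensorPresentation f X').e₁ p).hom := by
  have h := ((tensorBifunctor R R).map (shiftKX₁ f).inv).naturality (g.f p)
  refine (Category.assoc _ _ _).trans ((congrArg (_ ≫ ·) h.symm).trans ?_)
  exact (Category.assoc _ _ _).symm.trans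
    ((congrArg (· ≫ _) (bimodTensorIso_naturality f (g.f p))).trans (Category.assoc _ _ _))

/-- The projection `K[-1] ⊗_R X ⟶ X`. -/
def tensorFst (X : CochainComplex (ModuleCat.{u} R) ℤ) :
    (tensorComplex ((complexK f)⟦(-1 : ℤ)⟧)).obj X ⟶ X :=
  (tensorPresentation f X).fst

lemma tensorFst_naturality {X X' : CochainComplex (ModuleCat.{u} R) ℤ} (g : X ⟶ X') :
    (tensorComplex ((complexK f)⟦(-1 : ℤ)⟧)).map g ≫ tensorFst f X' = tensorFst f X ≫ g :=
  (tensorPresentation f X).fst_naturality (tensorPresentation f X') g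
    ((restrictComplex f).map ((extendComplex f).map g)) (tensorPresentation_e₀_naturality f g)
    (tensorPresentation_e₁_naturality f g)

lemma quasiIso_tensorComplex_map (hfd : FlatDimensionLE f 1)
    {X X' : CochainComplex (ModuleCat.{u} R) ℤ} (g : X ⟶ X')
    (hX : ∀ n, LeftAcyclic (extendScalars f) (X.X n))
    (hX' : ∀ n, LeftAcyclic (extendScalars f) (X'.X n)) [QuasiIso g] :
    QuasiIso ((tensorComplex ((complexK f)⟦(-1 : ℤ)⟧)).map g) := by
  have h : QuasiIso ((extendComplex f).map g) := quasiIso_map_of_leftAcyclic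
    (fun h m _ => LeftAcyclic.of_subobject (fun C => hfd C 2 one_lt_two) h m) g hX hX'
  have h' : QuasiIso ((restrictComplex f).map ((extendComplex f).map g)) := inferInstance
  exact (tensorPresentation f X).quasiIso_mapBifunctorMap (tensorPresentation f X') g
    ((restrictComplex f).map ((extendComplex f).map g))
    ((mapComplexAdjunction (extendRestrictAdj f)).unit.naturality g).symm
    (tensorPresentation_e₀_naturality f g) (tensorPresentation_e₁_naturality f g)

lemma homInl_naturality {B B' : CochainComplex (ModuleCat.{u} R) ℤ} (g : B ⟶ B') (p q : ℤ)
    (h : q + 1 = p) :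
    homInl f B p q h ≫ ((homComplex ((complexK f)⟦(-1 : ℤ)⟧)).map g).f q =
      (show coextObj f (B.X p) ⟶ coextObj f (B'.X p) from
        ((restrictComplex f).map ((coextendComplex f).map g)).f p) ≫ homInl f B' p q h := by
  have h : ∀ x : coextObj f (B.X p), ((homComplex ((complexK f)⟦(-1 : ℤ)⟧)).map g).f q
      (singleHom (K := (complexK f)⟦(-1 : ℤ)⟧) q (q.negOnePow • (leftX₁ f).hom ≫ coextToHom x)) =
      singleHom (K := (complexK f)⟦(-1 : ℤ)⟧) q
        (q.negOnePow • (leftX₁ f).hom ≫ coextToHom x ≫ g.f p) := fun x =>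
    (singleHom_comp (K := (complexK f)⟦(-1 : ℤ)⟧) q (by lia) g _).trans (by
      rw [units_smul_comp, Category.assoc])
  exact ModuleCat.hom_ext (LinearMap.ext h)

lemma quasiIso_homComplex_map (hpd : HasProjectiveDimensionLE (leftModU f) 1)
    {B B' : CochainComplex (ModuleCat.{u} R) ℤ} (g : B ⟶ B')
    (hB : ∀ n, RightAcyclic.{u} (leftModU f) (B.X n))
    (hB' : ∀ n, RightAcyclic.{u} (leftModU f) (B'.X n)) [QuasiIso g] :
    QuasiIso ((homComplex ((complexK f)⟦(-1 : ℤ)⟧)).map g) := by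
  have h : QuasiIso ((coextendComplex f).map g) :=
    quasiIso_map_of_rightAcyclic hpd (epi_coextendScalars_map_iff f) g hB hB'
  have h' : QuasiIso ((restrictComplex f).map ((coextendComplex f).map g)) := inferInstance
  exact (homPresentation f B).quasiIso_of_compatible (homPresentation f B')
    ((restrictComplex f).map ((coextendComplex f).map g)) g _
    ((mapComplexAdjunction
      (ModuleCat.restrictCoextendScalarsAdj.{u, u, u} f)).counit.naturality g).symm
    (homInl_naturality f g) (homInr_naturality f g)

end Compatibility

section HomologyCriteria

variable {R U : Type u} [Ring R] [Ring U] (f : R →+* U)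
  [HasDerivedCategory.{w} (ModuleCat.{u} R)] [HasDerivedCategory.{w'} (ModuleCat.{u} U)]

open DerivedCategory

lemma isZero_homology_Q_iff {A : Type*} [Category* A] [Abelian A] [HasDerivedCategory.{w} A]
    (X : CochainComplex A ℤ) (n : ℤ) :
    IsZero ((homologyFunctor A n).obj (Q.obj X)) ↔ X.ExactAt n := by
  rw [HomologicalComplex.exactAt_iff_isZero_homology]
  exact ((homologyFunctorFactors A n).app X).isZero_iff

lemma isZero_iff_forall_isZero_homology {A : Type*} [Category* A] [Abelian A]
    [HasDerivedCategory.{w} A] (Z : DerivedCategory A) :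
    IsZero Z ↔ ∀ n, IsZero ((homologyFunctor A n).obj Z) := by
  have e := Q.objObjPreimageIso Z
  rw [← e.isZero_iff, isZero_Q_obj_iff_acyclic]
  refine forall_congr' fun n => ?_
  rw [← isZero_homology_Q_iff, ((homologyFunctor A n).mapIso e).isZero_iff]

/-- The cohomology of `𝕃u^* Z` vanishes in degree `n` if and only if `U ⊗_R Hⁿ(Z) = 0` and
`Tor₁(U, Hⁿ⁺¹(Z)) = 0`. -/
lemma isZero_homology_leftDerived_iff (hfd : FlatDimensionLE f 1)
    {Lu : DerivedCategory (ModuleCat.{u} R) ⥤ DerivedCategory (ModuleCat.{u} U)}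
    (cLu : Q ⋙ Lu ⟶ extendComplex f ⋙ Q)
    (hcLu : ∀ X, (∀ n, LeftAcyclic (extendScalars f) (X.X n)) → IsIso (cLu.app X))
    (Z : DerivedCategory (ModuleCat.{u} R)) (n : ℤ) :
    IsZero ((homologyFunctor _ n).obj (Lu.obj Z)) ↔
      IsZero ((extendScalars f).obj ((homologyFunctor _ n).obj Z)) ∧
        LeftAcyclic (extendScalars f) ((homologyFunctor _ (n + 1)).obj Z) := by
  obtain ⟨r, π, hπ, hr⟩ := exists_leftAcyclic_resolution f hfd
  have hπ := hπ (Q.objPreimage Z)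
  have := hcLu _ (hr (Q.objPreimage Z))
  let X := r.obj (Q.objPreimage Z)
  let e : Q.obj X ≅ Z := asIso (Q.map (π.app (Q.objPreimage Z))) ≪≫ Q.objObjPreimageIso Z
  let e' : Lu.obj Z ≅ Q.obj ((extendComplex f).obj X) := Lu.mapIso e.symm ≪≫ asIso (cLu.app X)
  let h : ∀ m, (homologyFunctor _ m).obj Z ≅ X.homology m := fun m =>
    (homologyFunctor _ m).mapIso e.symm ≪≫ (homologyFunctorFactors _ m).app X
  rw [((homologyFunctor _ n).mapIso e').isZero_iff, isZero_homology_Q_iff,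
    exactAt_mapHomologicalComplex_iff
      (fun h m _ => LeftAcyclic.of_subobject (fun C => hfd C 2 one_lt_two) h m) X (hr _),
    ((extendScalars f).mapIso (h n)).isZero_iff]
  exact and_congr_right fun _ => ⟨fun t => t.of_iso (h (n + 1)), fun t => t.of_iso (h (n + 1)).symm⟩

lemma RightAcyclic.of_iso {A : Type*} [Category* A] [Abelian A] [HasExt.{w} A] {W M M' : A}
    (hW : HasProjectiveDimensionLE W 1) (e : M ≅ M') (hM : RightAcyclic W M) : RightAcyclic W M' :=
  RightAcyclic.of_epi hW hM e.hom

/-- The cohomology of `ℝu^! Z` vanishes in degree `n` if and only if `Ext¹(U, Hⁿ⁻¹(Z)) = 0` and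
`Hom(U, Hⁿ(Z)) = 0`. -/
lemma isZero_homology_rightDerived_iff (hpd : HasProjectiveDimensionLE (leftModU f) 1)
    {Ru : DerivedCategory (ModuleCat.{u} R) ⥤ DerivedCategory (ModuleCat.{u} U)}
    (cRu : coextendComplex f ⋙ Q ⟶ Q ⋙ Ru)
    (hcRu : ∀ X, (∀ n, RightAcyclic.{u} (leftModU f) (X.X n)) → IsIso (cRu.app X))
    (Z : DerivedCategory (ModuleCat.{u} R)) (n : ℤ) :
    IsZero ((homologyFunctor _ n).obj (Ru.obj Z)) ↔
      RightAcyclic.{u} (leftModU f) ((homologyFunctor _ (n - 1)).obj Z) ∧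
        Subsingleton (leftModU f ⟶ ((homologyFunctor _ n).obj Z)) := by
  obtain ⟨r, ι, hι, hr⟩ := exists_rightAcyclic_resolution f hpd
  have hι := hι (Q.objPreimage Z)
  have := hcRu _ (hr (Q.objPreimage Z))
  let X := r.obj (Q.objPreimage Z)
  let e : Z ≅ Q.obj X := (Q.objObjPreimageIso Z).symm ≪≫ asIso (Q.map (ι.app (Q.objPreimage Z)))
  let e' : Ru.obj Z ≅ Q.obj ((coextendComplex f).obj X) := Ru.mapIso e ≪≫ (asIso (cRu.app X)).symm
  let h : ∀ m, (homologyFunctor _ m).obj Z ≅ X.homology m := fun m =>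
    (homologyFunctor _ m).mapIso e ≪≫ (homologyFunctorFactors _ m).app X
  rw [((homologyFunctor _ n).mapIso e').isZero_iff, isZero_homology_Q_iff,
    exactAt_mapHomologicalComplex_iff' hpd (epi_coextendScalars_map_iff f) X (hr _),
    ← isZero_coextendScalars_iff,
    ((ModuleCat.coextendScalars.{u, u, u} f).mapIso (h n)).isZero_iff]
  exact and_congr_left fun _ => ⟨fun t => t.of_iso hpd (h (n - 1)).symm,
    fun t => t.of_iso hpd (h (n - 1))⟩

lemma isZero_homology_restrictD_iff (Y : DerivedCategory (ModuleCat.{u} U)) (n : ℤ) :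
    IsZero ((homologyFunctor _ n).obj ((restrictD f).obj Y)) ↔
      IsZero ((homologyFunctor _ n).obj Y) := by
  let e := Q.objObjPreimageIso Y
  let X := Q.objPreimage Y
  let e' : (restrictD f).obj Y ≅ Q.obj ((restrictComplex f).obj X) := (restrictD f).mapIso e.symm ≪≫
    (ModuleCat.restrictScalars.{u} f).mapDerivedCategoryFactors.app X
  rw [((homologyFunctor _ n).mapIso e').isZero_iff, isZero_homology_Q_iff,
    ← ((homologyFunctor _ n).mapIso e).isZero_iff, isZero_homology_Q_iff]
  exact (X.sc n).exact_map_iff_of_faithful (ModuleCat.restrictScalars.{u} f)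

/-- A functor preserves all boundedness conditions if the vanishing of its cohomology in degree `n`
is controlled by the degrees `n - 1`, `n` and `n + 1` of the argument. -/
lemma isBounded_obj_of_homology {A B : Type*} [Category* A] [Abelian A] [HasDerivedCategory.{w} A]
    [Category* B] [Abelian B] [HasDerivedCategory.{w'} B]
    (Φ : DerivedCategory A ⥤ DerivedCategory B)
    (h : ∀ X n, (∀ i, n - 1 ≤ i → i ≤ n + 1 → IsZero ((homologyFunctor A i).obj X)) →
      IsZero ((homologyFunctor B n).obj (Φ.obj X))) (s : BoundSymbol) (X : DerivedCategory A)
    (hX : IsBounded A s X) : IsBounded B s (Φ.obj X) := by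
  have hp : TStructure.t.plus X → TStructure.t.plus (Φ.obj X) := by
    rintro ⟨n, hn⟩
    exact ⟨n - 1, (isGE_iff _ _).2 fun i hi => h X i fun j _ hj =>
      (isGE_iff X n).1 hn j (by lia)⟩
  have hm : TStructure.t.minus X → TStructure.t.minus (Φ.obj X) := by
    rintro ⟨n, hn⟩
    exact ⟨n + 1, (isLE_iff _ _).2 fun i hi => h X i fun j hj _ =>
      (isLE_iff X n).1 hn j (by lia)⟩
  cases s
  · exact ⟨hp hX.1, hm hX.2⟩
  · exact hp hX
  · exact hm hX
  · trivial

instance {A : Type*} [Category* A] [Abelian A] [HasDerivedCategory.{w} A] (s : BoundSymbol) :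
    (IsBounded A s).IsClosedUnderIsomorphisms := by
  cases s <;> dsimp only [IsBounded] <;> infer_instance

end HomologyCriteria

/-! ### The gluing triangles -/

section

variable {R U : Type u} [Ring R] [Ring U] (f : R →+* U)
  [HasDerivedCategory.{w} (ModuleCat.{u} R)]

open DerivedCategory Pretriangulated

variable {f} {T H : DerivedCategory (ModuleCat.{u} R) ⥤ DerivedCategory (ModuleCat.{u} R)}
  {cT : Q ⋙ T ⟶ tensorComplex ((complexK f)⟦(-1 : ℤ)⟧) ⋙ Q}
  {cH : homComplex ((complexK f)⟦(-1 : ℤ)⟧) ⋙ Q ⟶ Q ⋙ H}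

lemma exists_leftAcyclic_model (hfd : FlatDimensionLE f 1) (Z : DerivedCategory (ModuleCat.{u} R)) :
    ∃ X : CochainComplex (ModuleCat.{u} R) ℤ, (∀ n, LeftAcyclic (extendScalars f) (X.X n)) ∧
      Nonempty (Z ≅ Q.obj X) := by
  obtain ⟨r, π, hπ, hr⟩ := exists_leftAcyclic_resolution f hfd
  have hπ := hπ (Q.objPreimage Z)
  exact ⟨_, hr (Q.objPreimage Z),
    ⟨(asIso (Q.map (π.app (Q.objPreimage Z))) ≪≫ Q.objObjPreimageIso Z).symm⟩⟩

lemma exists_rightAcyclic_model (hpd : HasProjectiveDimensionLE (leftModU f) 1)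
    (Z : DerivedCategory (ModuleCat.{u} R)) :
    ∃ X : CochainComplex (ModuleCat.{u} R) ℤ, (∀ n, RightAcyclic.{u} (leftModU f) (X.X n)) ∧
      Nonempty (Z ≅ Q.obj X) := by
  obtain ⟨r, ι, hι, hr⟩ := exists_rightAcyclic_resolution f hpd
  have hι := hι (Q.objPreimage Z)
  exact ⟨_, hr (Q.objPreimage Z),
    ⟨(Q.objObjPreimageIso Z).symm ≪≫ asIso (Q.map (ι.app (Q.objPreimage Z)))⟩⟩

variable (cT) in
/-- The natural map `K[-1] ⊗^𝕃 Z ⟶ Z` induced by the projection of complexes. -/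
lemma exists_ε : ∃ ε : T ⟶ 𝟭 _, ∀ X, ε.app (Q.obj X) = cT.app X ≫ Q.map (tensorFst f X) :=
  exists_natTrans_of_isLocalization Q (HomologicalComplex.quasiIso _ _)
    (F := T) (G := 𝟭 _)
    { app := fun X => cT.app X ≫ Q.map (tensorFst f X)
      naturality := fun X Y g => by
        have h := cT.naturality g
        have h' := congrArg (fun t => Q.map t) (tensorFst_naturality f g)
        simp only [CategoryTheory.Functor.map_comp] at h'
        refine (Category.assoc _ _ _).symm.trans ((congrArg (· ≫ _) h).trans ?_)
        exact (Category.assoc _ _ _).trans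
          ((congrArg (_ ≫ ·) h').trans (Category.assoc _ _ _).symm) }

variable (cH) in
/-- The natural map `Z ⟶ ℝHom(K[-1], Z)` induced by the inclusion of complexes. -/
lemma exists_η : ∃ η : 𝟭 _ ⟶ H, ∀ X, η.app (Q.obj X) = Q.map (homInr f X) ≫ cH.app X :=
  exists_natTrans_of_isLocalization Q (HomologicalComplex.quasiIso _ _)
    (F := 𝟭 _) (G := H)
    { app := fun X => Q.map (homInr f X) ≫ cH.app X
      naturality := fun X Y g => by
        have h := cH.naturality g
        have h' := congrArg (fun t => Q.map t) (homInr_naturality f g)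
        simp only [CategoryTheory.Functor.map_comp] at h'
        refine (Category.assoc _ _ _).symm.trans ((congrArg (· ≫ _) h'.symm).trans ?_)
        exact (Category.assoc _ _ _).trans
          ((congrArg (_ ≫ ·) h).trans (Category.assoc _ _ _).symm) }

variable [HasDerivedCategory.{w'} (ModuleCat.{u} U)]
  {Lu Ru : DerivedCategory (ModuleCat.{u} R) ⥤ DerivedCategory (ModuleCat.{u} U)}
  {cLu : Q ⋙ Lu ⟶ extendComplex f ⋙ Q} {cRu : coextendComplex f ⋙ Q ⟶ Q ⋙ Ru}

variable (cLu) in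
/-- The adjunction `𝕃u^* ⊣ u_*`, with its unit and counit on the level of complexes. Restriction of
scalars is exact, so it is its own right derived functor. -/
lemma exists_adjunction_left (hfd : FlatDimensionLE f 1)
    (hcLu : ∀ X, (∀ n, LeftAcyclic (extendScalars f) (X.X n)) → IsIso (cLu.app X)) :
    ∃ adj : Lu ⊣ restrictD f,
      (∀ X, adj.unit.app (Q.obj X) ≫ (restrictD f).map (cLu.app X) =
        Q.map ((mapComplexAdjunction (extendRestrictAdj f)).unit.app X) ≫
          (ModuleCat.restrictScalars.{u} f).mapDerivedCategoryFactors.inv.app _) ∧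
      ∀ Y, Lu.map ((ModuleCat.restrictScalars.{u} f).mapDerivedCategoryFactors.inv.app Y) ≫
          adj.counit.app (Q.obj Y) =
        cLu.app _ ≫ Q.map ((mapComplexAdjunction (extendRestrictAdj f)).counit.app Y) := by
  obtain ⟨r, π, hπ, hr⟩ := exists_leftAcyclic_resolution f hfd
  exact exists_derived_adjunction (mapComplexAdjunction (extendRestrictAdj f))
    (HomologicalComplex.quasiIso _ _) (HomologicalComplex.quasiIso _ _) cLu
    (ModuleCat.restrictScalars.{u} f).mapDerivedCategoryFactors.inv r π hπ (fun X => hcLu _ (hr X))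
    (𝟭 _) (𝟙 _) (fun X => MorphismProperty.id_mem _ X) (fun X => inferInstance)

variable (cRu) in
/-- The adjunction `u_* ⊣ ℝu^!`, with its counit on the level of complexes. -/
lemma exists_adjunction_right (hpd : HasProjectiveDimensionLE (leftModU f) 1)
    (hcRu : ∀ X, (∀ n, RightAcyclic.{u} (leftModU f) (X.X n)) → IsIso (cRu.app X)) :
    ∃ adj : restrictD f ⊣ Ru, ∀ X,
      (restrictD f).map (cRu.app X) ≫ adj.counit.app (Q.obj X) =
        (ModuleCat.restrictScalars.{u} f).mapDerivedCategoryFactors.hom.app _ ≫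
          Q.map (coextCounit f X) := by
  obtain ⟨r, ι, hι, hr⟩ := exists_rightAcyclic_resolution f hpd
  obtain ⟨adj, -, h⟩ := exists_derived_adjunction
    (mapComplexAdjunction (ModuleCat.restrictCoextendScalarsAdj.{u, u, u} f))
    (HomologicalComplex.quasiIso _ _) (HomologicalComplex.quasiIso _ _)
    (ModuleCat.restrictScalars.{u} f).mapDerivedCategoryFactors.hom cRu
    (𝟭 _) (𝟙 _) (fun X => MorphismProperty.id_mem _ X) (fun X => inferInstance)
    r ι hι (fun X => hcRu _ (hr X))
  exact ⟨adj, h⟩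

/-- The counit of the derived adjunction is invertible: modules over `U` are acyclic for the
extension of scalars, which takes them to themselves. -/
lemma isIso_counit (hf : IsHomologicalEpi f)
    (hcLu : ∀ X, (∀ n, LeftAcyclic (extendScalars f) (X.X n)) → IsIso (cLu.app X))
    (adj : Lu ⊣ restrictD f)
    (h : ∀ Y, Lu.map ((ModuleCat.restrictScalars.{u} f).mapDerivedCategoryFactors.inv.app Y) ≫
          adj.counit.app (Q.obj Y) =
        cLu.app _ ≫ Q.map ((mapComplexAdjunction (extendRestrictAdj f)).counit.app Y)) :
    IsIso adj.counit := by
  have h1 : ∀ Y, IsIso (adj.counit.app (Q.obj Y)) := fun Y => by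
    have := hcLu ((restrictComplex f).obj Y) fun n => hf.leftAcyclic_restrictScalars (Y.X n)
    have h2 : ∀ n, IsIso (((mapComplexAdjunction (extendRestrictAdj f)).counit.app Y).f n) :=
      fun n => hf.isIso_extCounit (Y.X n)
    have : IsIso ((mapComplexAdjunction (extendRestrictAdj f)).counit.app Y) :=
      HomologicalComplex.Hom.isIso_of_components _
    have h3 : IsIso
        (Lu.map ((ModuleCat.restrictScalars.{u} f).mapDerivedCategoryFactors.inv.app Y) ≫
          adj.counit.app (Q.obj Y)) := by
      rw [h]
      infer_instance
    exact IsIso.of_isIso_comp_left (Lu.map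
      ((ModuleCat.restrictScalars.{u} f).mapDerivedCategoryFactors.inv.app Y)) _
  have : ∀ Z, IsIso (adj.counit.app Z) := fun Z => by
    have := h1 (Q.objPreimage Z)
    exact (NatTrans.isIso_app_iff_of_iso adj.counit (Q.objObjPreimageIso Z)).1 this
  exact NatIso.isIso_of_isIso_app _

/-- The gluing triangle `K[-1] ⊗^𝕃 Z ⟶ Z ⟶ u_* 𝕃u^* Z`. -/
lemma exists_left_triangle (hfd : FlatDimensionLE f 1)
    (hcLu : ∀ X, (∀ n, LeftAcyclic (extendScalars f) (X.X n)) → IsIso (cLu.app X))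
    (hcT : ∀ X, (∀ n, LeftAcyclic (extendScalars f) (X.X n)) → IsIso (cT.app X))
    (adj : Lu ⊣ restrictD f)
    (hadj : ∀ X, adj.unit.app (Q.obj X) ≫ (restrictD f).map (cLu.app X) =
        Q.map ((mapComplexAdjunction (extendRestrictAdj f)).unit.app X) ≫
          (ModuleCat.restrictScalars.{u} f).mapDerivedCategoryFactors.inv.app _)
    {ε : T ⟶ 𝟭 _} (hε : ∀ X, ε.app (Q.obj X) = cT.app X ≫ Q.map (tensorFst f X))
    (Z : DerivedCategory (ModuleCat.{u} R)) :
    ∃ h, Triangle.mk (ε.app Z) (adj.unit.app Z) h ∈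
      distTriang (DerivedCategory (ModuleCat.{u} R)) := by
  obtain ⟨X, hX, ⟨e⟩⟩ := exists_leftAcyclic_model hfd Z
  have := hcLu X hX
  have := hcT X hX
  obtain ⟨h, hh⟩ := (tensorPresentation f X).exists_distinguished
  let β := (ModuleCat.restrictScalars.{u} f).mapDerivedCategoryFactors
  let e₃ : (restrictD f).obj (Lu.obj Z) ≅
      Q.obj ((restrictComplex f).obj ((extendComplex f).obj X)) :=
    (restrictD f).mapIso (Lu.mapIso e) ≪≫ (restrictD f).mapIso (asIso (cLu.app X)) ≪≫
      β.app ((extendComplex f).obj X)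
  let eT : T.obj (Q.obj X) ≅ Q.obj ((tensorComplex ((complexK f)⟦(-1 : ℤ)⟧)).obj X) :=
    asIso (cT.app X)
  refine exists_distinguished_of_iso hh (T.mapIso e ≪≫ eT) e e₃ _ _ ?_ ?_
  · refine (ε.naturality e.hom).symm.trans ?_
    exact (congrArg (_ ≫ ·) (hε X)).trans (Category.assoc _ _ _).symm
  · have h1 := adj.unit.naturality e.hom
    have h2 : (adj.unit.app (Q.obj X) ≫ (restrictD f).map (cLu.app X)) ≫ β.hom.app _ =
        Q.map ((mapComplexAdjunction (extendRestrictAdj f)).unit.app X) := by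
      rw [hadj]
      exact (Category.assoc _ _ _).trans ((congrArg (_ ≫ ·) (β.inv_hom_id_app _)).trans
        (Category.comp_id _))
    refine Eq.trans ?_ (congrArg (e.hom ≫ ·) h2)
    refine (Category.assoc _ _ _).symm.trans ((congrArg (· ≫ _) h1.symm).trans ?_)
    refine (Category.assoc _ _ _).trans (congrArg (_ ≫ ·) ?_)
    exact (Category.assoc _ _ _).symm

/-- The gluing triangle `u_* ℝu^! Z ⟶ Z ⟶ ℝHom(K[-1], Z)`. -/
lemma exists_right_triangle (hpd : HasProjectiveDimensionLE (leftModU f) 1)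
    (hcRu : ∀ X, (∀ n, RightAcyclic.{u} (leftModU f) (X.X n)) → IsIso (cRu.app X))
    (hcH : ∀ X, (∀ n, RightAcyclic.{u} (leftModU f) (X.X n)) → IsIso (cH.app X))
    (adj : restrictD f ⊣ Ru)
    (hadj : ∀ X, (restrictD f).map (cRu.app X) ≫ adj.counit.app (Q.obj X) =
        (ModuleCat.restrictScalars.{u} f).mapDerivedCategoryFactors.hom.app _ ≫
          Q.map (coextCounit f X))
    {η : 𝟭 _ ⟶ H} (hη : ∀ X, η.app (Q.obj X) = Q.map (homInr f X) ≫ cH.app X)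
    (Z : DerivedCategory (ModuleCat.{u} R)) :
    ∃ h, Triangle.mk (adj.counit.app Z) (η.app Z) h ∈
      distTriang (DerivedCategory (ModuleCat.{u} R)) := by
  obtain ⟨X, hX, ⟨e⟩⟩ := exists_rightAcyclic_model hpd Z
  have := hcRu X hX
  have := hcH X hX
  obtain ⟨h, hh⟩ := (homPresentation f X).exists_distinguished
  let β := (ModuleCat.restrictScalars.{u} f).mapDerivedCategoryFactors
  let e₁ : (restrictD f).obj (Ru.obj Z) ≅
      Q.obj ((restrictComplex f).obj ((coextendComplex f).obj X)) :=
    (restrictD f).mapIso (Ru.mapIso e) ≪≫ (restrictD f).mapIso (asIso (cRu.app X)).symm ≪≫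
      β.app ((coextendComplex f).obj X)
  refine exists_distinguished_of_iso hh e₁ e (H.mapIso e ≪≫ (asIso (cH.app X)).symm) _ _ ?_ ?_
  · have h1 := adj.counit.naturality e.hom
    have h2 : (restrictD f).map (inv (cRu.app X)) ≫ β.hom.app _ ≫ Q.map (coextCounit f X) =
        adj.counit.app (Q.obj X) := by
      refine (congrArg (_ ≫ ·) (hadj X).symm).trans ?_
      refine (Category.assoc _ _ _).symm.trans ?_
      rw [← CategoryTheory.Functor.map_comp, IsIso.inv_hom_id, CategoryTheory.Functor.map_id]
      exact Category.id_comp _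
    refine h1.symm.trans ((congrArg (_ ≫ ·) h2.symm).trans ?_)
    exact (congrArg (_ ≫ ·) (Category.assoc _ _ _).symm).trans (Category.assoc _ _ _).symm
  · have h1 := η.naturality e.hom
    have h2 : η.app (Q.obj X) ≫ inv (cH.app X) = Q.map (homInr f X) := by
      rw [hη]
      exact (Category.assoc _ _ _).trans ((congrArg (_ ≫ ·) (IsIso.hom_inv_id _)).trans
        (Category.comp_id _))
    refine Eq.trans ?_ (congrArg (e.hom ≫ ·) h2)
    refine (Category.assoc _ _ _).symm.trans ((congrArg (· ≫ _) h1.symm).trans ?_)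
    exact Category.assoc _ _ _

end

/-! ### Complexes with comodule or contramodule cohomology -/

section

open DerivedCategory Pretriangulated

/-- An object property of a triangulated category which amounts to a triangulated condition
together with the vanishing of a triangulated functor is triangulated. -/
lemma isTriangulated_of_iff {D Z : Type*} [Category* D] [Category* Z] [HasZeroObject D]
    [HasZeroObject Z] [Preadditive D] [Preadditive Z] [HasShift D ℤ] [HasShift Z ℤ]
    [∀ n : ℤ, (CategoryTheory.shiftFunctor D n).Additive]
    [∀ n : ℤ, (CategoryTheory.shiftFunctor Z n).Additive]
    [Pretriangulated D] [Pretriangulated Z] {P PD : ObjectProperty D} [PD.IsTriangulated]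
    [PD.IsClosedUnderIsomorphisms]
    (L : D ⥤ Z) [L.CommShift ℤ] [L.IsTriangulated] (h : ∀ X, P X ↔ PD X ∧ IsZero (L.obj X)) :
    P.IsTriangulated := by
  obtain rfl : P = PD ⊓ L.kernel := by
    ext X
    exact h X
  infer_instance

variable {R U : Type u} [Ring R] [Ring U] {f : R →+* U}
  [HasDerivedCategory.{w} (ModuleCat.{u} R)] [HasDerivedCategory.{w'} (ModuleCat.{u} U)]
  {Lu Ru : DerivedCategory (ModuleCat.{u} R) ⥤ DerivedCategory (ModuleCat.{u} U)}
  {T H : DerivedCategory (ModuleCat.{u} R) ⥤ DerivedCategory (ModuleCat.{u} R)}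

/-- The complexes with comodule cohomology form the kernel of `𝕃u^*`. -/
lemma hasComoduleCohomology_iff (hfd : FlatDimensionLE f 1)
    (cLu : Q ⋙ Lu ⟶ extendComplex f ⋙ Q)
    (hcLu : ∀ X, (∀ n, LeftAcyclic (extendScalars f) (X.X n)) → IsIso (cLu.app X))
    (s : BoundSymbol) (Z : DerivedCategory (ModuleCat.{u} R)) :
    HasComoduleCohomology f s Z ↔ IsBounded _ s Z ∧ IsZero (Lu.obj Z) := by
  refine and_congr_right fun _ => ?_
  simp only [IsComodule, isZero_iff_forall_isZero_homology (Lu.obj Z),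
    isZero_homology_leftDerived_iff f hfd cLu hcLu, torU, isZero_leftDerived_one_iff]
  refine ⟨fun h n => ⟨(h n).1, (h (n + 1)).2⟩, fun h n => ⟨(h n).1, ?_⟩⟩
  have := (h (n - 1)).2
  rwa [sub_add_cancel] at this

/-- The complexes with contramodule cohomology form the kernel of `ℝu^!`. -/
lemma hasContramoduleCohomology_iff (hpd : HasProjectiveDimensionLE (leftModU f) 1)
    (cRu : coextendComplex f ⋙ Q ⟶ Q ⋙ Ru)
    (hcRu : ∀ X, (∀ n, RightAcyclic.{u} (leftModU f) (X.X n)) → IsIso (cRu.app X))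
    (s : BoundSymbol) (Z : DerivedCategory (ModuleCat.{u} R)) :
    HasContramoduleCohomology f s Z ↔ IsBounded _ s Z ∧ IsZero (Ru.obj Z) := by
  refine and_congr_right fun _ => ?_
  simp only [IsContramodule, isZero_iff_forall_isZero_homology (Ru.obj Z),
    isZero_homology_rightDerived_iff f hpd cRu hcRu]
  refine ⟨fun h n => ⟨(h (n - 1)).2, (h n).1⟩, fun h n => ⟨(h n).2, ?_⟩⟩
  have := (h (n + 1)).1
  rwa [add_sub_cancel_right] at this

lemma isBounded_leftDerived (hfd : FlatDimensionLE f 1)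
    (cLu : Q ⋙ Lu ⟶ extendComplex f ⋙ Q)
    (hcLu : ∀ X, (∀ n, LeftAcyclic (extendScalars f) (X.X n)) → IsIso (cLu.app X))
    (s : BoundSymbol) (Z : DerivedCategory (ModuleCat.{u} R)) (hZ : IsBounded _ s Z) :
    IsBounded _ s (Lu.obj Z) :=
  isBounded_obj_of_homology Lu (fun X n h => by
    have h0 := h n (by lia) (by lia)
    have h1 := h (n + 1) (by lia) (by lia)
    refine (isZero_homology_leftDerived_iff f hfd cLu hcLu X n).2
      ⟨(extendScalars f).map_isZero h0, ?_⟩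
    have : Projective ((homologyFunctor (ModuleCat.{u} R) (n + 1)).obj X) := h1.projective
    exact LeftAcyclic.of_projective _) s Z hZ

lemma isBounded_rightDerived (hpd : HasProjectiveDimensionLE (leftModU f) 1)
    (cRu : coextendComplex f ⋙ Q ⟶ Q ⋙ Ru)
    (hcRu : ∀ X, (∀ n, RightAcyclic.{u} (leftModU f) (X.X n)) → IsIso (cRu.app X))
    (s : BoundSymbol) (Z : DerivedCategory (ModuleCat.{u} R)) (hZ : IsBounded _ s Z) :
    IsBounded _ s (Ru.obj Z) :=
  isBounded_obj_of_homology Ru (fun X n h => by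
    have h0 := h n (by lia) (by lia)
    have h1 := h (n - 1) (by lia) (by lia)
    refine (isZero_homology_rightDerived_iff f hpd cRu hcRu X n).2
      ⟨?_, ⟨fun a b => h0.eq_of_tgt a b⟩⟩
    have : Injective ((homologyFunctor (ModuleCat.{u} R) (n - 1)).obj X) := h1.injective
    exact RightAcyclic.of_injective _) s Z hZ

lemma isBounded_restrictD (s : BoundSymbol) (Y : DerivedCategory (ModuleCat.{u} U))
    (hY : IsBounded _ s Y) : IsBounded _ s ((restrictD f).obj Y) :=
  isBounded_obj_of_homology (restrictD f) (fun Y n h =>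
    (isZero_homology_restrictD_iff f Y n).2 (h n (by lia) (by lia))) s Y hY

end

end Matlis

end

theorem mainTheorem5 {R U : Type u} [Ring R] [Ring U]
    [HasDerivedCategory.{w} (ModuleCat.{u} R)] [HasDerivedCategory.{w'} (ModuleCat.{u} U)]
    (f : R →+* U) (hf : IsHomologicalEpi f) (hfd : FlatDimensionLE f 1)
    (hpd : HasProjectiveDimensionLE (leftModU f) 1) :
    -- the derived functors `𝕃u^*`, `ℝu^!`, `K[-1] ⊗^𝕃_R -` and `ℝHom_R(K[-1], -)`
    ∃ (Lu : DerivedCategory (ModuleCat.{u} R) ⥤ DerivedCategory (ModuleCat.{u} U))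
      (Ru : DerivedCategory (ModuleCat.{u} R) ⥤ DerivedCategory (ModuleCat.{u} U))
      (T : DerivedCategory (ModuleCat.{u} R) ⥤ DerivedCategory (ModuleCat.{u} R))
      (H : DerivedCategory (ModuleCat.{u} R) ⥤ DerivedCategory (ModuleCat.{u} R))
      (cLu : DerivedCategory.Q ⋙ Lu ⟶
        (Matlis.extendScalars f).mapHomologicalComplex (ComplexShape.up ℤ) ⋙ DerivedCategory.Q)
      (cRu : (ModuleCat.coextendScalars.{u, u, u} f).mapHomologicalComplex (ComplexShape.up ℤ) ⋙
        DerivedCategory.Q ⟶ DerivedCategory.Q ⋙ Ru)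
      (cT : DerivedCategory.Q ⋙ T ⟶
        tensorComplex ((complexK f)⟦(-1 : ℤ)⟧) ⋙ DerivedCategory.Q)
      (cH : homComplex ((complexK f)⟦(-1 : ℤ)⟧) ⋙ DerivedCategory.Q ⟶
        DerivedCategory.Q ⋙ H)
      (_ : Lu.CommShift ℤ) (_ : Ru.CommShift ℤ) (_ : T.CommShift ℤ) (_ : H.CommShift ℤ),
      Lu.IsLeftDerivedFunctor cLu
        (HomologicalComplex.quasiIso (ModuleCat.{u} R) (ComplexShape.up ℤ)) ∧
      Ru.IsRightDerivedFunctor cRu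
        (HomologicalComplex.quasiIso (ModuleCat.{u} R) (ComplexShape.up ℤ)) ∧
      T.IsLeftDerivedFunctor cT
        (HomologicalComplex.quasiIso (ModuleCat.{u} R) (ComplexShape.up ℤ)) ∧
      H.IsRightDerivedFunctor cH
        (HomologicalComplex.quasiIso (ModuleCat.{u} R) (ComplexShape.up ℤ)) ∧
      Lu.IsTriangulated ∧ Ru.IsTriangulated ∧ T.IsTriangulated ∧ H.IsTriangulated ∧
      ∀ s : BoundSymbol,
        -- `D^s_co` and `D^s_ctra` are triangulated subcategories, and all functors restrict
        ∃ (_ : (HasComoduleCohomology f s).IsTriangulated)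
          (_ : (HasContramoduleCohomology f s).IsTriangulated)
          (hu : ∀ Y, IsBounded _ s Y → IsBounded _ s ((restrictD f).obj Y))
          (hLu : ∀ X, IsBounded _ s X → IsBounded _ s (Lu.obj X))
          (hRu : ∀ X, IsBounded _ s X → IsBounded _ s (Ru.obj X))
          (hT : ∀ X, IsBounded _ s X → HasComoduleCohomology f s (T.obj X))
          (hH : ∀ X, IsBounded _ s X → HasContramoduleCohomology f s (H.obj X)),
          -- the triangulated equivalence between `D^s_co` and `D^s_ctra`
          (∃ e : DCo f s ≌ DCtra f s,
            e.functor = restrictFunctor H (HasComoduleCohomology f s)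
              (HasContramoduleCohomology f s) (fun X hX => hH X hX.1) ∧
            e.inverse = restrictFunctor T (HasContramoduleCohomology f s)
              (HasComoduleCohomology f s) (fun X hX => hT X hX.1)) ∧
          (restrictFunctor H (HasComoduleCohomology f s)
            (HasContramoduleCohomology f s) (fun X hX => hH X hX.1)).IsTriangulated ∧
          (restrictFunctor T (HasContramoduleCohomology f s)
            (HasComoduleCohomology f s) (fun X hX => hT X hX.1)).IsTriangulated ∧
          -- the recollement of `D^s(R-mod)` by `D^s(U-mod)` and `D^s_co ≃ D^s_ctra`
          IsRecollement
            (restrictFunctor Lu (IsBounded _ s) (IsBounded _ s) hLu)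
            (restrictFunctor (restrictD f)
              (IsBounded _ s) (IsBounded _ s) hu)
            (restrictFunctor Ru (IsBounded _ s) (IsBounded _ s) hRu)
            (inclusionFunctor (HasComoduleCohomology f s) (IsBounded _ s)
              (fun _ hX => hX.1))
            (restrictFunctor T (IsBounded _ s)
              (HasComoduleCohomology f s) hT)
            (restrictFunctor H (HasComoduleCohomology f s)
                (HasContramoduleCohomology f s) (fun X hX => hH X hX.1) ⋙
              inclusionFunctor (HasContramoduleCohomology f s)
                (IsBounded _ s) (fun _ hX => hX.1)) := by
  -- derived functors, computed by resolutions with acyclic terms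
  obtain ⟨rL, π, hπ, hrL⟩ := exists_leftAcyclic_resolution f hfd
  obtain ⟨rR, ι, hι, hrR⟩ := exists_rightAcyclic_resolution f hpd
  obtain ⟨Lu, cLu, hcLu⟩ := exists_leftDerived DerivedCategory.Q
    (HomologicalComplex.quasiIso (ModuleCat.{u} R) (ComplexShape.up ℤ))
    (fun X => ∀ n, LeftAcyclic (extendScalars f) (X.X n)) rL π hπ hrL
    (extendComplex f ⋙ DerivedCategory.Q) (fun {X Y} g hX hY hg =>
      (DerivedCategory.isIso_Q_map_iff_quasiIso _ _).2 (have : QuasiIso g := hg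
        quasiIso_map_of_leftAcyclic
          (fun h m _ => LeftAcyclic.of_subobject (fun C => hfd C 2 one_lt_two) h m) g hX hY))
  obtain ⟨T, cT, hcT⟩ := exists_leftDerived DerivedCategory.Q
    (HomologicalComplex.quasiIso (ModuleCat.{u} R) (ComplexShape.up ℤ))
    (fun X => ∀ n, LeftAcyclic (extendScalars f) (X.X n)) rL π hπ hrL
    (tensorComplex ((complexK f)⟦(-1 : ℤ)⟧) ⋙ DerivedCategory.Q) (fun {X Y} g hX hY hg =>
      (DerivedCategory.isIso_Q_map_iff_quasiIso _ _).2 (have : QuasiIso g := hg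
        quasiIso_tensorComplex_map f hfd g hX hY))
  obtain ⟨Ru, cRu, hcRu⟩ := exists_rightDerived DerivedCategory.Q
    (HomologicalComplex.quasiIso (ModuleCat.{u} R) (ComplexShape.up ℤ))
    (fun X => ∀ n, RightAcyclic.{u} (leftModU f) (X.X n)) rR ι hι hrR
    (coextendComplex f ⋙ DerivedCategory.Q) (fun {X Y} g hX hY hg =>
      (DerivedCategory.isIso_Q_map_iff_quasiIso _ _).2 (have : QuasiIso g := hg
        quasiIso_map_of_rightAcyclic hpd (epi_coextendScalars_map_iff f) g hX hY))
  obtain ⟨H, cH, hcH⟩ := exists_rightDerived DerivedCategory.Q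
    (HomologicalComplex.quasiIso (ModuleCat.{u} R) (ComplexShape.up ℤ))
    (fun X => ∀ n, RightAcyclic.{u} (leftModU f) (X.X n)) rR ι hι hrR
    (homComplex ((complexK f)⟦(-1 : ℤ)⟧) ⋙ DerivedCategory.Q) (fun {X Y} g hX hY hg =>
      (DerivedCategory.isIso_Q_map_iff_quasiIso _ _).2 (have : QuasiIso g := hg
        quasiIso_homComplex_map f hpd g hX hY))
  -- the adjunctions and the two gluing triangles
  obtain ⟨adjL, hadjL, hadjL'⟩ := exists_adjunction_left cLu hfd hcLu
  obtain ⟨adjR, hadjR⟩ := exists_adjunction_right cRu hpd hcRu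
  have := isIso_counit hf hcLu adjL hadjL'
  have : (restrictD f).Full := adjL.fullyFaithfulROfIsIsoCounit.full
  have : (restrictD f).Faithful := adjL.fullyFaithfulROfIsIsoCounit.faithful
  obtain ⟨ε, hε⟩ := exists_ε cT
  obtain ⟨η, hη⟩ := exists_η cH
  have hG : HasGluingTriangles adjL adjR ε η :=
    ⟨exists_left_triangle hfd hcLu hcT adjL hadjL hε,
      exists_right_triangle hpd hcRu hcH adjR hadjR hη⟩
  -- the triangulated structures come from the adjunctions with `u_*` and from the gluing triangles
  let : Lu.CommShift ℤ := adjL.leftAdjointCommShift ℤ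
  have : adjL.CommShift ℤ := adjL.commShift_of_rightAdjoint ℤ
  have : Lu.IsTriangulated := adjL.isTriangulated_leftAdjoint
  let : Ru.CommShift ℤ := adjR.rightAdjointCommShift ℤ
  have : adjR.CommShift ℤ := adjR.commShift_of_leftAdjoint ℤ
  have : Ru.IsTriangulated := adjR.isTriangulated_rightAdjoint
  obtain ⟨_, _⟩ := hG.exists_commShift_T
  obtain ⟨_, _⟩ := hG.exists_commShift_H
  refine ⟨Lu, Ru, T, H, cLu, cRu, cT, cH, inferInstance, inferInstance, inferInstance,
    inferInstance, isLeftDerivedFunctor_of_deformation _ cLu rL π hπ fun X => hcLu _ (hrL X),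
    isRightDerivedFunctor_of_deformation _ cRu rR ι hι fun X => hcRu _ (hrR X),
    isLeftDerivedFunctor_of_deformation _ cT rL π hπ fun X => hcT _ (hrL X),
    isRightDerivedFunctor_of_deformation _ cH rR ι hι fun X => hcH _ (hrR X),
    inferInstance, inferInstance, inferInstance, inferInstance, fun s => ?_⟩
  -- boundedness conditions, and the kernels of `𝕃u^*` and `ℝu^!`
  have hCo := hasComoduleCohomology_iff hfd cLu hcLu s
  have hCtra := hasContramoduleCohomology_iff hpd cRu hcRu s
  have hu : ∀ Y, IsBounded _ s Y → IsBounded _ s ((restrictD f).obj Y) := isBounded_restrictD s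
  have hLu := isBounded_leftDerived hfd cLu hcLu s
  have hRu := isBounded_rightDerived hpd cRu hcRu s
  have hT : ∀ X, IsBounded _ s X → HasComoduleCohomology f s (T.obj X) := fun X hX => by
    obtain ⟨h, hd⟩ := hG.exists_left X
    exact (hCo _).2 ⟨(IsBounded _ s).ext_of_isTriangulatedClosed₁ _ hd hX (hu _ (hLu _ hX)),
      hG.isZero_obj_left X⟩
  have hH : ∀ X, IsBounded _ s X → HasContramoduleCohomology f s (H.obj X) := fun X hX => by
    obtain ⟨h, hd⟩ := hG.exists_right X
    exact (hCtra _).2 ⟨(IsBounded _ s).ext_of_isTriangulatedClosed₃ _ hd (hu _ (hRu _ hX)) hX,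
      hG.isZero_obj_right X⟩
  have : (HasComoduleCohomology f s).IsTriangulated := isTriangulated_of_iff Lu hCo
  have : (HasContramoduleCohomology f s).IsTriangulated := isTriangulated_of_iff Ru hCtra
  exact ⟨inferInstance, inferInstance, hu, hLu, hRu, hT, hH,
    ⟨hG.equivalence hCo hCtra hT hH, rfl, rfl⟩, inferInstance, inferInstance,
    hG.isRecollement hCo hCtra hT hH hu hLu hRu⟩
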